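/- Let $g\ge 2$ and let $\Gamma\subset \mathrm{SL}(2,\mathbb R)$ be a Fuchsian Schottky group: a discrete, purely loxodromic group, free on $g_1,\dots,g_g$ (put $g_{i+g}=g_i^{-1}$), with a marking by $2g$ disjoint Jordan curves on $\mathbb P^1(\mathbb C)$ such that each $g_k$ maps the interior of its curve onto the exterior of the curve of $g_k^{-1}$, the coordinate being chosen so that $\infty$ is outside all the curves. Let $\Lambda_\Gamma\subset\mathbb C$ be its limit set, $\delta_H$ the Hausdorff dimension of $\Lambda_\Gamma$, $\Omega_\Gamma=\mathbb P^1(\mathbb C)\setminus\Lambda_\Gamma$, and $X=\Gamma\backslash\Omega_\Gamma$ the associated curve, of genus $g$. Let $\mu$ be a Patterson–Sullivan measure, i.e. a nonzero finite measure on $\Lambda_\Gamma$ with $(\gamma^*d\mu)(x)=|\gamma'(x)|^{\delta_H}d\mu(x)$ for all $\gamma\in\Gamma$, and $\mathcal L=L^2(\Lambda_\Gamma,\mu)$ (complex coefficients). For a reduced word $w$ in the $g_i$, let $\Lambda_\Gamma(w)$ be the set of limits $\lim_n (a_0\cdots a_n)\infty$ over the infinite reduced sequences $a_0a_1\dots$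 beginning with $w$, and $\chi_w$ its characteristic function. Let $\mathcal P_n\subset\mathcal L$ be spanned by the $\chi_w$ with $w$ of length $n+1$, $\Pi_n$ the orthogonal projection on $\mathcal P_n$, and $\hat\Pi_n=\Pi_n-\Pi_{n-1}$ (with $\Pi_{-1}=0$). On $\mathcal H=\mathcal L\oplus\mathcal L$ let $D=\sum_n (n+1)\hat\Pi_n$ on $\mathcal L\oplus 0$ and $D=-\sum_n n\hat\Pi_n$ on $0\oplus\mathcal L$, with maximal domain, and let $\Pi(\lambda,D)$ be its spectral projections. With $w_{n,k}=g_k\cdots g_k$ ($n$ times) put $v_{n,k}=\hat\Pi_n\chi_{w_{n+1,k}}$ and let $\mathcal V$ be the linear span of all $v_{n,k}$, $n\ge 0$, $1\le k\le 2g$; its graded pieces are $\hat\Pi_n\mathcal V$. The real Frobenius $\bar F_\infty$ preserves the grading and acts on $\hat\Pi_n\mathcal P_n\cong \mathcal P_n/\mathcal P_{n-1}$ by $(-1)^n$ times the map induced by $\chi_{a_0\cdots a_n}\mapsto\chi_{a_0^{-1}\cdots a_n^{-1}}$; $\mathcal V^{\bar F_\infty=id}$ is the space of its invariants in $\mathcal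 V$. Let $\pi(\mathcal V)$ and $\pi(\mathcal V,\bar F_\infty=id)$ be the orthogonal projections on the norm closures of $0\oplus\mathcal V$ and $0\oplus\mathcal V^{\bar F_\infty=id}$. For $\pi$ one of these and an operator $D'$ put $$\zeta_{\pi,D'}(s,z)=\sum_{\lambda\in\mathrm{Spec}(D')}\mathrm{Tr}(\pi\,\Pi(\lambda,D'))\,(s-\lambda)^{-z}$$ (principal branch). Let $\Gamma_{\mathbb C}(s)=(2\pi)^{-s}\Gamma(s)$, $\Gamma_{\mathbb R}(s)=2^{-1/2}\pi^{-s/2}\Gamma(s/2)$, and let $$L_{\mathbb C}(H^1(X),s)=\prod_{p,q}\Gamma_{\mathbb C}(s-\min(p,q))^{h^{p,q}},\qquad L_{\mathbb R}(H^1(X),s)=\prod_{p<q}\Gamma_{\mathbb C}(s-p)^{h^{p,q}}\prod_p\Gamma_{\mathbb R}(s-p)^{h^{p,+}}\Gamma_{\mathbb R}(s-p+1)^{h^{p,-}}$$ with $h^{p,q}=\dim_{\mathbb C}H^{p,q}(X)$ and $h^{p,\pm}$ the dimension of the $\pm(-1)^p$-eigenspace on $H^{p,p}(X)$ of the involution $F_\infty$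 induced by complex conjugation on $X$. Finally, let $S_i$ be the partial isometry $(S_if)(x)=\chi_{g_i}(x)\,|(g_i^{-1})'(x)|^{\delta_H/2}f(g_i^{-1}x)$ of $\mathcal L$, $\mathcal O_A$ the Cuntz–Krieger C*-algebra generated by the $S_i$, $\mathcal F_A\subset\mathcal O_A$ its AF core, i.e. the C*-algebra generated by the $S_\alpha S_\beta^*$ with $|\alpha|=|\beta|$, and $\rho$ the diagonal action on $\mathcal H$. **Proposition 6.8.** 1. For every $s\in\mathbb C\setminus\{0,-1,-2,\dots\}$ and both choices of $\pi$, all the operators $\pi\,\Pi(\lambda,D/2\pi)$ have finite rank, the series $\zeta_{\pi,D/2\pi}(s/2\pi,z)$ converges for $\mathrm{Re}\,z$ large and continues meromorphically to a half-plane containing $z=0$, where it is regular, and $$\exp\Big(-\tfrac{d}{dz}\zeta_{\pi(\mathcal V),D/2\pi}(s/2\pi,z)\big|_{z=0}\Big)^{-1}=L_{\mathbb C}(H^1(X),s)=\Gamma_{\mathbb C}(s)^{2g},$$ $$\exp\Big(-\tfrac{d}{dz}\zeta_{\pi(\mathcal V,\bar F_\infty=id),D/2\pi}(s/2\pi,z)\big|_{z=0}\Big)^{-1}=L_{\mathbb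 R}(H^1(X),s)=\Gamma_{\mathbb C}(s)^{g}.$$ 2. The operators $S_i$ are bounded, and $Q_{i,n}=S_i^nS_i^{*n}$ is a projection in $\mathcal F_A$ which acts on $\mathcal L$ as multiplication by $\chi_{w_{n,i}}$. For all $n\ge 0$ and $i$, $$\Pi(-n,D)\,\rho(Q_{i,n+1})\,\Pi(-n,D)=t_{n,i}\,\pi_{n,i},\qquad t_{n,i}=\frac{\|v_{n,i}\|^2}{\|\chi_{w_{n+1,i}}\|^2}\in(0,1],\qquad t_{0,i}=1,$$ where $\pi_{n,i}$ is the orthogonal projection on the line $0\oplus\mathbb C v_{n,i}$. Consequently $\pi(\mathcal V)$ is obtained from these projections by normalised compression: for all $n\ge0$ $$\pi(\mathcal V)\,\Pi(-n,D)=\Pi(-n,D)\,\rho\Big(\sum_i t_{n,i}^{-1}Q_{i,n+1}\Big)\,\Pi(-n,D),$$ the range of $\Pi(-n,D)\,\rho(\sum_iQ_{i,n+1})\,\Pi(-n,D)$ is $0\oplus\hat\Pi_n\mathcal V$, and $\pi(\mathcal V)\,\Pi(\lambda,D)=0$ for $\lambda\notin\{0,-1,-2,\dots\}$. -/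

import Mathlib

open MeasureTheory Filter Topology
open scoped MatrixGroups

noncomputable section

namespace ArchFactor

/-! ### Marked Schottky groups -/

/-- Index set of the `2g` letters `g_1, …, g_g, g_1⁻¹, …, g_g⁻¹`:
`(i, true)` stands for `g_i` and `(i, false)` for `g_i⁻¹`. -/
abbrev Letter (g : ℕ) := Fin g × Bool

/-- The inverse letter. -/
def Letter.inv {g : ℕ} (a : Letter g) : Letter g := (a.1, !a.2)

/-- A Schottky group of rank `g` with a choice of free generators and of a marking:
a discrete, purely loxodromic subgroup of `SL(2, ℂ)` (mapping isomorphically to `PSL(2, ℂ)`), free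
on `gen`, together with `2g` disjoint Jordan curves such that each `g_k` maps the interior of its
curve onto the exterior of the curve of `g_k⁻¹`.  The coordinate on the sphere is normalised so
that `∞` lies outside all curves; hence the limit set is a subset of `ℂ`. -/
structure SchottkyGroup (g : ℕ) where
  /-- the generators -/
  gen : Fin g → SL(2, ℂ)
  discrete : DiscreteTopology (FreeGroup.lift gen).range
  /-- every nontrivial word is loxodromic: its trace is not in `[-2, 2]`
  (in particular it is not `±1`, so the group is free on `gen`) -/
  loxodromic : ∀ w : FreeGroup (Fin g), w ≠ 1 →
    ¬ ∃ t : ℝ, |t| ≤ 2 ∧ Matrix.trace (FreeGroup.lift gen w).1 = (t : ℂ)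
  /-- the interiors of the curves of the marking -/
  disc : Letter g → Set ℂ
  disc_open : ∀ a, IsOpen (disc a)
  disc_bounded : ∀ a, Bornology.IsBounded (disc a)
  disc_jordan : ∀ a, Nonempty (Circle ≃ₜ frontier (disc a))
  disc_disjoint : ∀ a b, a ≠ b → Disjoint (closure (disc a)) (closure (disc b))
  disc_map : ∀ a : Letter g,
    (fun z : OnePoint ℂ => (FreeGroup.lift gen (FreeGroup.mk [a]) : GL (Fin 2) ℂ) • z) ''
        ((fun z : ℂ => (z : OnePoint ℂ)) '' disc a) =
      ((fun z : ℂ => (z : OnePoint ℂ)) '' closure (disc a.inv))ᶜ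

/-- The fractional linear transformation of a matrix, on the finite part of the sphere. -/
def mobius (A : SL(2, ℂ)) (z : ℂ) : ℂ := (A.1 0 0 * z + A.1 0 1) / (A.1 1 0 * z + A.1 1 1)

/-- `|γ'(z)| = |c z + d|⁻²`. -/
def absDeriv (A : SL(2, ℂ)) (z : ℂ) : ℝ := (‖A.1 1 0 * z + A.1 1 1‖ ^ 2)⁻¹

namespace SchottkyGroup

variable {g : ℕ} (S : SchottkyGroup g)

/-- The identification of reduced words with elements of `Γ`. -/
def rep : FreeGroup (Fin g) →* SL(2, ℂ) := FreeGroup.lift S.gen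

/-- The group element of a letter. -/
def letter (a : Letter g) : SL(2, ℂ) := S.rep (FreeGroup.mk [a])

/-- The group is Fuchsian: it consists of real matrices. -/
def IsFuchsian : Prop :=
  ∀ i, ∃ A : SL(2, ℝ), S.gen i = Matrix.SpecialLinearGroup.map (algebraMap ℝ ℂ) A

/-- The limit set `Λ_Γ`: the closure of the set of fixed points of the loxodromic elements. -/
def limitSet : Set ℂ :=
  closure {z : ℂ | ∃ w : FreeGroup (Fin g), w ≠ 1 ∧
    (S.rep w : GL (Fin 2) ℂ) • (z : OnePoint ℂ) = (z : OnePoint ℂ)}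

/-- The group element `a_0 a_1 ⋯ a_n`. -/
def partialProd (a : ℕ → Letter g) (n : ℕ) : SL(2, ℂ) :=
  ((List.range (n + 1)).map fun k => S.letter (a k)).prod

/-- The cylinder `Λ_Γ(w)`: the set of limit points `lim_n (a_0 ⋯ a_n) x₀` over all infinite reduced
sequences `a_0 a_1 …` that begin with the word `w`; the base point is `x₀ = ∞`. -/
def cylinder {m : ℕ} (w : Fin m → Letter g) : Set ℂ :=
  {x | ∃ a : ℕ → Letter g, (∀ k, a (k + 1) ≠ (a k).inv) ∧ (∀ k : Fin m, a k = w k) ∧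
    Tendsto (fun n => (S.partialProd a n : GL (Fin 2) ℂ) • (OnePoint.infty : OnePoint ℂ)) atTop
      (𝓝 (x : OnePoint ℂ))}

/-- `μ` is a Patterson–Sullivan measure: a nonzero finite measure carried by the limit set with
`(γ^* dμ)(x) = |γ'(x)|^δ dμ(x)`, where `δ` is the Hausdorff dimension of the limit set. -/
structure IsPattersonSullivan (μ : Measure ℂ) : Prop where
  finite : IsFiniteMeasure μ
  ne_zero : μ ≠ 0
  carried : μ S.limitSetᶜ = 0
  conformal : ∀ (w : FreeGroup (Fin g)) (E : Set ℂ), MeasurableSet E → E ⊆ S.limitSet →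
    μ (mobius (S.rep w) '' E) =
      ∫⁻ x in E, ENNReal.ofReal (absDeriv (S.rep w) x ^ (dimH S.limitSet).toReal) ∂μ

/-! ### The first cohomology of the curve `X = Γ \ Ω_Γ` and its local factors -/

/-- The holomorphic differentials on `X = Γ \ Ω_Γ`, as the `Γ`-invariant holomorphic differentials
`f(z) dz` on `Ω_Γ ⊂ ℙ¹(ℂ)`; holomorphy at `∞` means `f(z) = O(z⁻²)`.
The function `f` is extended by `0` to the limit set. -/
def differentials : Submodule ℂ (ℂ → ℂ) where
  carrier := {f | (∀ z ∈ S.limitSet, f z = 0) ∧ DifferentiableOn ℂ f S.limitSetᶜ ∧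
    f =O[cocompact ℂ] (fun z => (z ^ 2)⁻¹) ∧
    ∀ w : FreeGroup (Fin g), ∀ z ∉ S.limitSet, (S.rep w).1 1 0 * z + (S.rep w).1 1 1 ≠ 0 →
      f (mobius (S.rep w) z) * (((S.rep w).1 1 0 * z + (S.rep w).1 1 1) ^ 2)⁻¹ = f z}
  zero_mem' := ⟨fun _ _ => rfl, differentiableOn_const 0, Asymptotics.isBigO_zero _ _, by simp⟩
  add_mem' := by
    rintro f h ⟨f1, f2, f3, f4⟩ ⟨h1, h2, h3, h4⟩
    refine ⟨fun z hz => by simp [f1 z hz, h1 z hz], f2.add h2, f3.add h3, fun w z hz hd => ?_⟩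
    rw [Pi.add_apply, Pi.add_apply, add_mul, f4 w z hz hd, h4 w z hz hd]
  smul_mem' := by
    rintro c f ⟨f1, f2, f3, f4⟩
    refine ⟨fun z hz => by simp [f1 z hz], f2.const_smul c, f3.const_smul_left c,
      fun w z hz hd => ?_⟩
    rw [Pi.smul_apply, Pi.smul_apply, smul_eq_mul, smul_eq_mul, mul_assoc, f4 w z hz hd]

/-- The genus of `X`. -/
def genus : ℕ := Module.finrank ℂ S.differentials

/-- The complex conjugates of the holomorphic differentials: `v` stands for `v(z) dz̄`. -/
def conjDifferentials : Submodule ℂ (ℂ → ℂ) where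
  carrier := {v | (fun z => (starRingEnd ℂ) (v z)) ∈ S.differentials}
  zero_mem' := by
    have h : (fun z : ℂ => (starRingEnd ℂ) ((0 : ℂ → ℂ) z)) = 0 := by ext; simp
    rw [Set.mem_ofPred_eq, h]
    exact zero_mem _
  add_mem' := by
    intro u v hu hv
    have h : (fun z : ℂ => (starRingEnd ℂ) ((u + v) z)) =
        (fun z => (starRingEnd ℂ) (u z)) + fun z => (starRingEnd ℂ) (v z) := by ext; simp
    rw [Set.mem_ofPred_eq, h]
    exact add_mem hu hv
  smul_mem' := by
    intro c v hv
    have h : (fun z : ℂ => (starRingEnd ℂ) ((c • v) z)) =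
        (starRingEnd ℂ) c • fun z => (starRingEnd ℂ) (v z) := by ext; simp
    rw [Set.mem_ofPred_eq, h]
    exact Submodule.smul_mem _ _ hv

/-- The Hodge decomposition of `H¹(X, ℂ)`, the space of harmonic forms `u dz + v dz̄` on `X`,
written as pairs `(u, v)`: `H^{1,0}` consists of the holomorphic differentials, `H^{0,1}` of their
conjugates, and all other pieces vanish. -/
def hodgePiece (p q : ℤ) : Submodule ℂ ((ℂ → ℂ) × (ℂ → ℂ)) :=
  if p = 1 ∧ q = 0 then S.differentials.prod ⊥
  else if p = 0 ∧ q = 1 then (⊥ : Submodule ℂ (ℂ → ℂ)).prod S.conjDifferentials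
  else ⊥

end SchottkyGroup

/-- The `ℂ`-linear involution `F_∞`, the pull-back under `z ↦ z̄`:
`u(z) dz + v(z) dz̄ ↦ v(z̄) dz + u(z̄) dz̄`. -/
def cohomFrobenius : ((ℂ → ℂ) × (ℂ → ℂ)) →ₗ[ℂ] ((ℂ → ℂ) × (ℂ → ℂ)) where
  toFun x := (fun z => x.2 ((starRingEnd ℂ) z), fun z => x.1 ((starRingEnd ℂ) z))
  map_add' _ _ := rfl
  map_smul' _ _ := rfl

/-- `Γ_ℂ(s) = (2π)^{-s} Γ(s)`. -/
def gammaC (s : ℂ) : ℂ := (2 * Real.pi : ℂ) ^ (-s) * Complex.Gamma s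

/-- `Γ_ℝ(s) = 2^{-1/2} π^{-s/2} Γ(s/2)`. -/
def gammaR (s : ℂ) : ℂ :=
  (2 : ℂ) ^ (-(1 / 2) : ℂ) * (Real.pi : ℂ) ^ (-(s / 2)) * Complex.Gamma (s / 2)

namespace SchottkyGroup

variable {g : ℕ} (S : SchottkyGroup g)

/-- `h^{p,q}` of `H¹(X)`. -/
def hodgeNumber (p q : ℤ) : ℕ := Module.finrank ℂ (S.hodgePiece p q)

/-- `h^{p,+}` for `ε = 1` and `h^{p,-}` for `ε = -1`: the dimension of the
`ε (-1)^p`-eigenspace of `F_∞` on `H^{p,p}`. -/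
def hodgeNumberSign (p : ℤ) (ε : ℂ) : ℕ :=
  Module.finrank ℂ ↥(S.hodgePiece p p ⊓
    LinearMap.ker (cohomFrobenius - (ε * (-1) ^ p) • LinearMap.id))

/-- `L_ℂ(H¹(X), s) = ∏_{p,q} Γ_ℂ(s - min(p,q))^{h^{p,q}}`. -/
def LC (s : ℂ) : ℂ :=
  ∏ᶠ pq : ℤ × ℤ, gammaC (s - (min pq.1 pq.2 : ℤ)) ^ S.hodgeNumber pq.1 pq.2

/-- `L_ℝ(H¹(X), s) =
∏_{p<q} Γ_ℂ(s - p)^{h^{p,q}} ∏_p Γ_ℝ(s - p)^{h^{p,+}} Γ_ℝ(s - p + 1)^{h^{p,-}}`. -/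
def LR (s : ℂ) : ℂ :=
  (∏ᶠ pq : {pq : ℤ × ℤ // pq.1 < pq.2},
      gammaC (s - (pq.1.1 : ℤ)) ^ S.hodgeNumber pq.1.1 pq.1.2) *
    ∏ᶠ p : ℤ, gammaR (s - p) ^ S.hodgeNumberSign p 1 *
      gammaR (s - p + 1) ^ S.hodgeNumberSign p (-1)

end SchottkyGroup

/-! ### Zeta functions of unbounded operators and regularized determinants -/

section Operators

variable {H : Type*} [NormedAddCommGroup H] [InnerProductSpace ℂ H] [CompleteSpace H]

/-- The spectrum of an unbounded operator: the complement of the set of `c` for which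
`D - c : dom D → H` has a bounded two-sided inverse. -/
def spec (D : H →ₗ.[ℂ] H) : Set ℂ :=
  {c | ¬ ∃ R : H →L[ℂ] H, (∀ y, ∃ h : R y ∈ D.domain, D ⟨R y, h⟩ - c • R y = y) ∧
    ∀ x : D.domain, R (D x - c • (x : H)) = x}

/-- The eigenspace of an unbounded operator. -/
def eigenspace (D : H →ₗ.[ℂ] H) (c : ℂ) : Submodule ℂ H :=
  (LinearMap.ker (D.toFun - c • D.domain.subtype)).map D.domain.subtype

/-- The spectral projection `Π(c, D)`, the orthogonal projection on the eigenspace. -/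
def spectralProj (D : H →ₗ.[ℂ] H) (c : ℂ) : H →L[ℂ] H :=
  (eigenspace D c).topologicalClosure.starProjection

/-- The trace of a bounded operator of finite rank: the trace of the operator induced on its
range. -/
def finiteRankTrace (T : H →L[ℂ] H) : ℂ :=
  LinearMap.trace ℂ (LinearMap.range (T : H →ₗ[ℂ] H))
    ((T : H →ₗ[ℂ] H).restrict (p := LinearMap.range (T : H →ₗ[ℂ] H))
      (q := LinearMap.range (T : H →ₗ[ℂ] H)) fun x _ => ⟨x, rfl⟩)

/-- `d` is the regularized determinant
`exp (- d/dz ζ_{π,D}(s, z) |_{z = 0})` of the zeta function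
`ζ_{π,D}(s, z) = ∑_{c ∈ Spec D} Tr(π Π(c, D)) (s - c)^{-z}`: all the operators `π Π(c, D)` have
finite rank, the series converges for `Re z` large, and `Z` is its meromorphic continuation to a
half-plane that contains `0`, regular at `0`.
(Such a continuation has only one possible germ at `0`.) -/
def IsRegularizedDet (P : H →L[ℂ] H) (D : H →ₗ.[ℂ] H) (s d : ℂ) : Prop :=
  (∀ c : ℂ, FiniteDimensional ℂ
    (LinearMap.range ((P * spectralProj D c : H →L[ℂ] H) : H →ₗ[ℂ] H))) ∧
  ∃ (Z : ℂ → ℂ) (a b : ℝ), b < 0 ∧ MeromorphicOn Z {z | b < z.re} ∧ AnalyticAt ℂ Z 0 ∧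
    (∀ z : ℂ, a < z.re →
      HasSum (fun c : spec D => finiteRankTrace (P * spectralProj D c) * (s - c) ^ (-z)) (Z z)) ∧
    d = Complex.exp (-deriv Z 0)

/-- The operator `(∑ T_n) ⊕ (∑ U_n)` on `H ⊕ H`, on the domain where the two series are summable. -/
def seriesOp (T U : ℕ → H →L[ℂ] H) : WithLp 2 (H × H) →ₗ.[ℂ] WithLp 2 (H × H) where
  domain :=
    { carrier := {x | Summable (fun n => T n x.fst) ∧ Summable (fun n => U n x.snd)}
      zero_mem' := by simp [summable_zero]
      add_mem' := fun {x y} hx hy =>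
        ⟨by simpa using hx.1.add hy.1, by simpa using hx.2.add hy.2⟩
      smul_mem' := fun c x hx =>
        ⟨by simpa using hx.1.const_smul c, by simpa using hx.2.const_smul c⟩ }
  toFun :=
    { toFun := fun x => WithLp.toLp 2 (∑' n, T n x.1.fst, ∑' n, U n x.1.snd)
      map_add' := by
        rintro ⟨x, hx⟩ ⟨y, hy⟩
        have h1 := hx.1.tsum_add hy.1
        have h2 := hx.2.tsum_add hy.2
        rw [← WithLp.toLp_add, Prod.mk_add_mk, ← h1, ← h2]
        simp
      map_smul' := by
        rintro c ⟨x, hx⟩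
        have h1 := hx.1.tsum_const_smul c
        have h2 := hx.2.tsum_const_smul c
        rw [RingHom.id_apply, ← WithLp.toLp_smul, Prod.smul_mk, ← h1, ← h2]
        simp }

end Operators

/-! ### The dynamical spectral triple -/

namespace SchottkyGroup

variable {g : ℕ} (S : SchottkyGroup g) (μ : Measure ℂ)

/-- The Hilbert space `𝓛 = L²(Λ_Γ, μ)`. -/
abbrev L2 (μ : Measure ℂ) := Lp ℂ 2 μ

open Classical in
/-- The characteristic function of a cylinder, as an element of `𝓛`. -/
def chi {m : ℕ} (w : Fin m → Letter g) : L2 μ :=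
  if h : MemLp ((S.cylinder w).indicator fun _ => (1 : ℂ)) 2 μ then h.toLp _ else 0

/-- `𝓟_n`, spanned by the characteristic functions of the cylinders of words of length `n + 1`.
(The cylinder of a word that is not reduced is empty.) -/
def P (n : ℕ) : Submodule ℂ (L2 μ) :=
  Submodule.span ℂ (Set.range fun w : Fin (n + 1) → Letter g => S.chi μ w)

instance (n : ℕ) : FiniteDimensional ℂ (S.P μ n) :=
  FiniteDimensional.span_of_finite ℂ (Set.finite_range _)

/-- The projections `Π̂_n = Π_n - Π_{n-1}`, with `Π_n` the orthogonal projection on `𝓟_n`. -/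
def gradedProj : ℕ → (L2 μ →L[ℂ] L2 μ)
  | 0 => (S.P μ 0).starProjection
  | n + 1 => (S.P μ (n + 1)).starProjection - (S.P μ n).starProjection

/-- The word `w_{n,k} = g_k g_k ⋯ g_k` (`n` times). -/
def powWord (n : ℕ) (k : Letter g) : Fin n → Letter g := fun _ => k

/-- The generator `Π̂_n χ(w_{n+1,k})` of `𝓥`. -/
def vGen (n : ℕ) (k : Letter g) : L2 μ := S.gradedProj μ n (S.chi μ (powWord (n + 1) k))

/-- The subspace `𝓥` of `𝓛`. -/
def V : Submodule ℂ (L2 μ) :=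
  Submodule.span ℂ (Set.range fun nk : ℕ × Letter g => S.vGen μ nk.1 nk.2)

/-- The graded piece `Π̂_n 𝓥`, i.e. `gr_{2p} 𝓥` for `p = -n`. -/
def grV (n : ℕ) : Submodule ℂ (L2 μ) := (S.V μ).map (S.gradedProj μ n : L2 μ →ₗ[ℂ] L2 μ)

/-- The change of orientation `g_k ↔ g_k⁻¹` on `𝓟_n`: it takes the characteristic function of the
cylinder of `a_0 ⋯ a_n` to that of `a_0⁻¹ ⋯ a_n⁻¹` (precomposed with `Π_n`). -/
def flip (n : ℕ) : L2 μ →L[ℂ] L2 μ :=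
  ∑ w : Fin (n + 1) → Letter g,
    ((((‖S.chi μ w‖ ^ 2)⁻¹ : ℝ) : ℂ) • innerSL ℂ (S.chi μ w)).smulRight
      (S.chi μ fun k => (w k).inv)

/-- The real Frobenius on the `n`-th graded piece `𝓟_n ∩ 𝓟_{n-1}^⊥ ≅ 𝓟_n / 𝓟_{n-1}`: `(-1)^n`
times the map induced by the change of orientation. -/
def frobenius (n : ℕ) : L2 μ →L[ℂ] L2 μ :=
  (-1 : ℂ) ^ n • (S.gradedProj μ n ∘L S.flip μ n ∘L S.gradedProj μ n)

/-- The invariants of the real Frobenius in `𝓥`.  The real Frobenius preserves the grading, so that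
a vector is invariant if and only if all its components are. -/
def VInv : Submodule ℂ (L2 μ) where
  carrier := {v | v ∈ S.V μ ∧ ∀ n, S.frobenius μ n v = S.gradedProj μ n v}
  zero_mem' := ⟨zero_mem _, by simp⟩
  add_mem' := fun hu hv => ⟨add_mem hu.1 hv.1, fun n => by rw [map_add, map_add, hu.2, hv.2]⟩
  smul_mem' := fun c v hv => ⟨Submodule.smul_mem _ c hv.1, fun n => by
    rw [map_smul, map_smul, hv.2]⟩

/-- The Hilbert space `𝓗 = 𝓛 ⊕ 𝓛`. -/
abbrev HSpace (μ : Measure ℂ) := WithLp 2 (L2 μ × L2 μ)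

/-- The inclusion of `0 ⊕ 𝓛` in `𝓗`. -/
def inr (μ : Measure ℂ) : L2 μ →ₗ[ℂ] HSpace μ :=
  (WithLp.linearEquiv 2 ℂ (L2 μ × L2 μ)).symm.toLinearMap ∘ₗ LinearMap.inr ℂ (L2 μ) (L2 μ)

/-- The operator `D`, equal to `∑ (n + 1) Π̂_n` on `𝓛 ⊕ 0` and to `- ∑ n Π̂_n` on `0 ⊕ 𝓛`, with its
maximal domain (a series of pairwise orthogonal vectors converges if and only if it is
unconditionally summable). -/
def dirac : HSpace μ →ₗ.[ℂ] HSpace μ :=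
  seriesOp (fun n => ((n : ℂ) + 1) • S.gradedProj μ n) (fun n => (-(n : ℂ)) • S.gradedProj μ n)

/-- `π(𝓥)`, the orthogonal projection on the norm closure of `0 ⊕ 𝓥`. -/
def projV : HSpace μ →L[ℂ] HSpace μ :=
  ((S.V μ).map (inr μ)).topologicalClosure.starProjection

/-- `π(𝓥, F̄_∞ = id)`, the orthogonal projection on the norm closure of `0 ⊕ 𝓥^{F̄_∞ = id}`. -/
def projVInv : HSpace μ →L[ℂ] HSpace μ :=
  ((S.VInv μ).map (inr μ)).topologicalClosure.starProjection

/-- `T` is the partial isometry attached to the letter `i`: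
`(T f)(x) = χ_{g_i}(x) |(g_i⁻¹)'(x)|^{δ/2} f(g_i⁻¹ x)`. -/
def IsCuntzKriegerGen (i : Letter g) (T : L2 μ →L[ℂ] L2 μ) : Prop :=
  ∀ f : L2 μ, (T f : ℂ → ℂ) =ᵐ[μ] (S.cylinder (powWord 1 i)).indicator fun x =>
    ((absDeriv (S.letter i)⁻¹ x ^ ((dimH S.limitSet).toReal / 2) : ℝ) : ℂ) *
      f (mobius (S.letter i)⁻¹ x)

/-- The generator `S_i` of the Cuntz–Krieger algebra `𝓞_A`, acting on `𝓛`: the bounded operator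
which satisfies `IsCuntzKriegerGen` (there is at most one). -/
def ckGen (i : Letter g) : L2 μ →L[ℂ] L2 μ := Classical.epsilon (S.IsCuntzKriegerGen μ i)

/-- `S_{i_1} ⋯ S_{i_k}`. -/
def ckWord (l : List (Letter g)) : L2 μ →L[ℂ] L2 μ := (l.map (S.ckGen μ)).prod

/-- The Cuntz–Krieger algebra `𝓞_A`, the C⋆-algebra generated by the `S_i`. -/
def ckAlgebra : StarSubalgebra ℂ (L2 μ →L[ℂ] L2 μ) :=
  (StarAlgebra.adjoin ℂ (Set.range (S.ckGen μ))).topologicalClosure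

/-- The AF core `𝓕_A` of `𝓞_A`, the C⋆-algebra generated by the `S_α S_β^*` with `|α| = |β|`. -/
def afCore : StarSubalgebra ℂ (L2 μ →L[ℂ] L2 μ) :=
  (StarAlgebra.adjoin ℂ {T | ∃ α β : List (Letter g), α.length = β.length ∧
    T = S.ckWord μ α * star (S.ckWord μ β)}).topologicalClosure

/-- `Q_{i,n} = S_i^n S_i^{*n}`. -/
def Q (i : Letter g) (n : ℕ) : L2 μ →L[ℂ] L2 μ := S.ckGen μ i ^ n * star (S.ckGen μ i) ^ n

/-- The diagonal action on `𝓗 = 𝓛 ⊕ 𝓛`. -/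
def diag {μ : Measure ℂ} (T : L2 μ →L[ℂ] L2 μ) : HSpace μ →L[ℂ] HSpace μ :=
  (WithLp.prodContinuousLinearEquiv 2 ℂ (L2 μ) (L2 μ)).symm.toContinuousLinearMap ∘L
    (T.prodMap T) ∘L (WithLp.prodContinuousLinearEquiv 2 ℂ (L2 μ) (L2 μ)).toContinuousLinearMap

/-- The compression `Π(-n, D) ρ(T) Π(-n, D)`. -/
def compress (n : ℕ) (T : L2 μ →L[ℂ] L2 μ) : HSpace μ →L[ℂ] HSpace μ :=
  spectralProj (S.dirac μ) (-n) * diag T * spectralProj (S.dirac μ) (-n)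

/-- The normalising factor `‖Π̂_n χ(w_{n+1,i})‖² / ‖χ(w_{n+1,i})‖²`. -/
def weight (n : ℕ) (i : Letter g) : ℝ :=
  ‖S.vGen μ n i‖ ^ 2 / ‖S.chi μ (powWord (n + 1) i)‖ ^ 2

end SchottkyGroup

end ArchFactor

end

noncomputable section

namespace ArchFactor

/-! ### The zeta function `∑ (s + n)^{-z}` for complex `s` -/

/-! Everything is diagonal for the grading `gradedProj`. Ping-pong on the discs shows that only
finitely many group elements have lower left coefficient below a given bound, so the images of ∞
under longer and longer prefixes converge uniformly. Hence the limit set is coded by infinite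
reduced words, and cylinders are compact and shrink uniformly to points. Cylinder functions are
therefore total in L², the Π̂_n form a complete orthogonal family (`isGrading_gradedProj`), and the
eigenspace of D at -n is exactly 0 ⊕ ran Π̂_n. The eigenvalues n + 1 of the first summand never
interfere.

Conformality of μ, with g ≥ 2, gives every reduced cylinder positive mass. Then v_{n,k} is
χ(w_{n+1,k}) minus its mean over the preceding cylinder (`vGen_succ`). For fixed n these vectors are
nonzero with disjoint supports, so each graded piece of 𝓥 has dimension 2g. The Frobenius sends
v_{n,k} to (-1)^n v_{n,k⁻¹}, which leaves invariants of dimension g. Both zeta functions are thus a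
constant multiple N of ∑ ((s + n)/2π)^{-z}. Comparing this series with the Riemann zeta function and
Euler's product for Γ gives Γ_ℂ(s)^N (`exists_regularized_gammaC`, `exists_isRegularizedDet`). The
local factors involve only h^{1,0} and h^{0,1}, which are equal by conjugation.

For the second half, S_i and S_i^* are mutually inverse weighted compositions between a cylinder and
the set of points whose code does not start with g_i⁻¹, so Q_{i,n} is multiplication by an indicator
(`Q_apply`). On 𝓟_n the operator Q_{i,n+1} agrees with the rank-one projection on χ(w_{n+1,i}).
Compressing that by Π̂_n gives the projection on v_{n,i}, scaled by the ratio of squared norms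
(`gradedProj_mul_Q_mul`). -/

lemma norm_one_add_cpow_neg_sub_le {z u : ℂ} {R : ℝ} (hR : 1 ≤ R) (hz : ‖z‖ ≤ R)
    (hu : 2 * R * ‖u‖ ≤ 1) : ‖(1 + u) ^ (-z) - 1 + z * u‖ ≤ 5 * R ^ 2 * ‖u‖ ^ 2 := by
  have hu0 := norm_nonneg u
  have hu2 : ‖u‖ ≤ 1 / 2 := by nlinarith
  have h1 : 1 + u ≠ 0 := by
    intro h
    have : u = -1 := by linear_combination h
    rw [this] at hu2; norm_num at hu2
  have hlog : ‖Complex.log (1 + u) - u‖ ≤ ‖u‖ ^ 2 := by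
    refine (Complex.norm_log_one_add_sub_self_le (by linarith)).trans ?_
    have : (1 - ‖u‖)⁻¹ ≤ 2 := by
      rw [inv_le_comm₀ (by linarith) (by norm_num)]; linarith
    nlinarith [sq_nonneg ‖u‖]
  have hlog' : ‖Complex.log (1 + u)‖ ≤ 2 * ‖u‖ := by
    have := norm_add_le (Complex.log (1 + u) - u) u
    rw [sub_add_cancel] at this
    nlinarith
  set w := -z * Complex.log (1 + u) with hw
  have hwn : ‖w‖ ≤ 2 * R * ‖u‖ := by
    rw [hw, norm_mul, norm_neg]
    nlinarith [norm_nonneg z, norm_nonneg (Complex.log (1 + u))]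
  have h2 : ‖Complex.exp w - 1 - w‖ ≤ ‖w‖ ^ 2 :=
    Complex.norm_exp_sub_one_sub_id_le (hwn.trans hu)
  have h3 : (1 + u) ^ (-z) - 1 + z * u =
      (Complex.exp w - 1 - w) + -z * (Complex.log (1 + u) - u) := by
    rw [Complex.cpow_def_of_ne_zero h1, hw, mul_comm (Complex.log _)]; ring
  rw [h3]
  refine (norm_add_le _ _).trans ?_
  have h4 : ‖-z * (Complex.log (1 + u) - u)‖ ≤ R * ‖u‖ ^ 2 := by
    rw [norm_mul, norm_neg]; gcongr
  have h5 : ‖w‖ ^ 2 ≤ (2 * R * ‖u‖) ^ 2 := by gcongr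
  nlinarith [sq_nonneg ‖u‖]

lemma ofReal_mul_cpow {r : ℝ} (hr : 0 < r) {x : ℂ} (hx : x ≠ 0) (z : ℂ) :
    ((r : ℂ) * x) ^ z = (r : ℂ) ^ z * x ^ z := by
  have hr' : (r : ℂ) ≠ 0 := by exact_mod_cast hr.ne'
  rw [Complex.cpow_def_of_ne_zero (mul_ne_zero hr' hx), Complex.cpow_def_of_ne_zero hr',
    Complex.cpow_def_of_ne_zero hx, Complex.log_ofReal_mul hr hx, ← Complex.exp_add,
    Complex.ofReal_log hr.le]
  congr 1; ring

/-- The `m`-th term of the series comparing `∑ (s + m)^{-z}` with the Riemann zeta function. -/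
def hurwitzTerm (s : ℂ) (m : ℕ) (z : ℂ) : ℂ :=
  (s + m) ^ (-z) - ((m + 1 : ℕ) : ℂ) ^ (-z) + z * (s - 1) * ((m + 1 : ℕ) : ℂ) ^ (-z - 1)

/-- With t = m + 1 and u = (s - 1)/t one has s + m = t(1 + u). The term is then t^{-z} times a
second-order Taylor remainder in u, hence of size t^{1/2} · t^{-2}. Only the positive factor t is
pulled out of a power, so no branch problem arises. -/
lemma norm_hurwitzTerm_le {s : ℂ} {R : ℝ} (hR : 1 ≤ R) {m : ℕ}
    (hm : 2 * R * ‖s - 1‖ ≤ m + 1) {z : ℂ} (hz : ‖z‖ ≤ R) (hz' : -(1 / 2) < z.re) :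
    ‖hurwitzTerm s m z‖ ≤ 5 * R ^ 2 * ‖s - 1‖ ^ 2 * ((m + 1 : ℕ) : ℝ) ^ (-(3 / 2) : ℝ) := by
  set t : ℝ := ((m + 1 : ℕ) : ℝ) with ht
  have htm : t = m + 1 := by push_cast [ht]; ring
  have ht1 : 1 ≤ t := by rw [htm]; linarith [Nat.cast_nonneg (α := ℝ) m]
  have ht0 : 0 < t := by linarith
  have htc : ((m + 1 : ℕ) : ℂ) = (t : ℂ) := by simp [ht]
  have htne : (t : ℂ) ≠ 0 := by exact_mod_cast ht0.ne'
  set u : ℂ := (s - 1) / t with hu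
  have hun : ‖u‖ = ‖s - 1‖ / t := by
    rw [hu, norm_div, Complex.norm_real, Real.norm_of_nonneg ht0.le]
  have hu1 : 2 * R * ‖u‖ ≤ 1 := by
    rw [hun, ← mul_div_assoc, div_le_one ht0, htm]; exact hm
  have h1u : 1 + u ≠ 0 := by
    intro h
    have h' : u = -1 := by linear_combination h
    rw [h'] at hu1
    norm_num at hu1; linarith
  have hsm : s + m = (t : ℂ) * (1 + u) := by
    rw [hu, mul_add, mul_div_cancel₀ _ htne, ← htc]; push_cast; ring
  have hterm : hurwitzTerm s m z = (t : ℂ) ^ (-z) * ((1 + u) ^ (-z) - 1 + z * u) := by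
    rw [hurwitzTerm, hsm, htc, ofReal_mul_cpow ht0 h1u, Complex.cpow_sub _ _ htne,
      Complex.cpow_one, hu]
    ring
  have h2 := norm_one_add_cpow_neg_sub_le hR hz hu1
  rw [hterm, norm_mul, Complex.norm_cpow_eq_rpow_re_of_pos ht0, Complex.neg_re]
  have h3 : t ^ (-z.re) ≤ t ^ (1 / 2 : ℝ) := Real.rpow_le_rpow_of_exponent_le ht1 (by linarith)
  have h4 : t ^ (-(3 / 2) : ℝ) = t ^ (1 / 2 : ℝ) * (t ^ 2)⁻¹ := by
    rw [← Real.rpow_natCast t 2, ← Real.rpow_neg ht0.le, ← Real.rpow_add ht0]; norm_num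
  calc t ^ (-z.re) * ‖(1 + u) ^ (-z) - 1 + z * u‖
      ≤ t ^ (1 / 2 : ℝ) * (5 * R ^ 2 * ‖u‖ ^ 2) := by gcongr
    _ = _ := by rw [h4, hun, div_pow]; ring

lemma differentiable_hurwitzTerm {s : ℂ} (hs : ∀ n : ℕ, s ≠ -n) (m : ℕ) :
    Differentiable ℂ (hurwitzTerm s m) := by
  have h1 : s + m ≠ 0 := fun h => hs m (by linear_combination h)
  have h2 : ((m + 1 : ℕ) : ℂ) ≠ 0 := by exact_mod_cast m.succ_ne_zero
  intro z
  have e1 : DifferentiableAt ℂ (fun z : ℂ => (s + m) ^ (-z)) z :=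
    (differentiableAt_id.neg).const_cpow (Or.inl h1)
  have e2 : DifferentiableAt ℂ (fun z : ℂ => ((m + 1 : ℕ) : ℂ) ^ (-z)) z :=
    (differentiableAt_id.neg).const_cpow (Or.inl h2)
  have e3 : DifferentiableAt ℂ (fun z : ℂ => ((m + 1 : ℕ) : ℂ) ^ (-z - 1)) z :=
    (differentiableAt_id.neg.sub_const 1).const_cpow (Or.inl h2)
  exact (e1.sub e2).add ((differentiableAt_id.mul_const _).mul e3)

lemma deriv_hurwitzTerm_zero {s : ℂ} (hs : ∀ n : ℕ, s ≠ -n) (m : ℕ) :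
    deriv (hurwitzTerm s m) 0 =
      -Complex.log (s + m) + Complex.log ((m + 1 : ℕ) : ℂ) + (s - 1) / ((m + 1 : ℕ) : ℂ) := by
  have h1 : s + m ≠ 0 := fun h => hs m (by linear_combination h)
  have h2 : ((m + 1 : ℕ) : ℂ) ≠ 0 := by exact_mod_cast m.succ_ne_zero
  have e1 : HasDerivAt (fun z : ℂ => (s + m) ^ (-z)) _ 0 :=
    (hasDerivAt_id (0 : ℂ)).neg.const_cpow (Or.inl h1)
  have e2 : HasDerivAt (fun z : ℂ => ((m + 1 : ℕ) : ℂ) ^ (-z)) _ 0 :=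
    (hasDerivAt_id (0 : ℂ)).neg.const_cpow (Or.inl h2)
  have e3 : HasDerivAt (fun z : ℂ => ((m + 1 : ℕ) : ℂ) ^ (-z - 1)) _ 0 :=
    ((hasDerivAt_id (0 : ℂ)).neg.sub_const 1).const_cpow (Or.inl h2)
  have := ((e1.sub e2).add (((hasDerivAt_id (0 : ℂ)).mul_const (s - 1)).mul e3)).deriv
  refine Eq.trans this ?_
  simp [Complex.cpow_neg_one]
  ring

lemma summable_hurwitz_bound (C : ℝ) (M : ℕ) :
    Summable fun m : ℕ => C * ((m + M + 1 : ℕ) : ℝ) ^ (-(3 / 2) : ℝ) := by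
  have h : Summable fun m : ℕ => (m : ℝ) ^ (-(3 / 2) : ℝ) :=
    Real.summable_nat_rpow.mpr (by norm_num)
  exact ((summable_nat_add_iff (M + 1)).mpr h).mul_left C

/-- The estimate holds once m is large compared with ‖s - 1‖. Dropping M initial terms makes it
uniform on a bounded piece of the half-plane, and the dropped terms are harmless for convergence. -/
lemma hurwitzTerm_bounds (s : ℂ) (R : ℝ) : ∃ M : ℕ, ∃ C : ℝ, ∀ (m : ℕ) (z : ℂ),
    z ∈ {z : ℂ | -(1 / 2) < z.re} ∩ Metric.ball 0 R → 
    ‖hurwitzTerm s (m + M) z‖ ≤ C * ((m + M + 1 : ℕ) : ℝ) ^ (-(3 / 2) : ℝ) := by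
  obtain ⟨M, hM⟩ := exists_nat_ge (2 * max R 1 * ‖s - 1‖)
  refine ⟨M, _, fun m z hz => norm_hurwitzTerm_le (le_max_right R 1) ?_ ?_ hz.1⟩
  · push_cast; linarith [Nat.cast_nonneg (α := ℝ) m]
  · have := mem_ball_zero_iff.mp hz.2
    exact this.le.trans (le_max_left _ _)

lemma summable_hurwitzTerm (s : ℂ) {z : ℂ} (hz : -(1 / 2) < z.re) :
    Summable fun m => hurwitzTerm s m z := by
  obtain ⟨M, C, h⟩ := hurwitzTerm_bounds s (‖z‖ + 1)
  refine (summable_nat_add_iff M).mp (Summable.of_norm_bounded (summable_hurwitz_bound C M)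
    fun m => h m z ⟨hz, by simp⟩)

lemma isOpen_halfPlane_ball (R : ℝ) :
    IsOpen ({z : ℂ | -(1 / 2) < z.re} ∩ Metric.ball 0 R) :=
  (isOpen_lt continuous_const Complex.continuous_re).inter Metric.isOpen_ball

lemma differentiableAt_tsum_hurwitzTerm {s : ℂ} (hs : ∀ n : ℕ, s ≠ -n) {z : ℂ}
    (hz : -(1 / 2) < z.re) : 
    DifferentiableAt ℂ (fun z => ∑' m, hurwitzTerm s m z) z ∧
      HasSum (fun m => deriv (hurwitzTerm s m) z) (deriv (fun z => ∑' m, hurwitzTerm s m z) z) := by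
  obtain ⟨M, C, h⟩ := hurwitzTerm_bounds s (‖z‖ + 1)
  set U := {z : ℂ | -(1 / 2) < z.re} ∩ Metric.ball 0 (‖z‖ + 1) with hU
  have hUo : IsOpen U := isOpen_halfPlane_ball _
  have hzU : z ∈ U := ⟨hz, by simp⟩
  have hsb := summable_hurwitz_bound C M
  have hd := Complex.differentiableOn_tsum_of_summable_norm hsb
    (fun m => (differentiable_hurwitzTerm hs (m + M)).differentiableOn) hUo h
  have hsum := Complex.hasSum_deriv_of_summable_norm hsb
    (fun m => (differentiable_hurwitzTerm hs (m + M)).differentiableOn) hUo h hzU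
  have hfin : DifferentiableAt ℂ (fun z => ∑ m ∈ Finset.range M, hurwitzTerm s m z) z :=
    DifferentiableAt.fun_sum fun m _ => (differentiable_hurwitzTerm hs m) z
  have heq : (fun z => ∑' m, hurwitzTerm s m z) =ᶠ[𝓝 z]
      fun z => ∑ m ∈ Finset.range M, hurwitzTerm s m z + ∑' m, hurwitzTerm s (m + M) z := by
    filter_upwards [hUo.mem_nhds hzU] with y hy
    exact ((summable_hurwitzTerm s hy.1).sum_add_tsum_nat_add M).symm
  have hdz := hd.differentiableAt (hUo.mem_nhds hzU)
  refine ⟨(hfin.add hdz).congr_of_eventuallyEq heq, ?_⟩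
  rw [heq.deriv_eq, deriv_fun_add hfin hdz,
    deriv_fun_sum fun m _ => (differentiable_hurwitzTerm hs m) z]
  rw [← hasSum_nat_add_iff' M]
  simpa using hsum

/-- Termwise differentiation at 0 makes the exponential of a partial sum equal to M! / ∏ (s + j) ·
exp((s - 1) H_M). This is Euler's sequence for Γ up to factors governed by H_n - log n → γ. The
remaining power of e^γ is cancelled later by ζ₁'(1) = γ. -/
lemma exp_deriv_tsum_hurwitzTerm {s : ℂ} (hs : ∀ n : ℕ, s ≠ -n) :
    Complex.exp (deriv (fun z => ∑' m, hurwitzTerm s m z) 0) =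
      Complex.Gamma s * Complex.exp ((s - 1) * Real.eulerMascheroniConstant) := by
  have h := (differentiableAt_tsum_hurwitzTerm hs (z := 0) (by norm_num)).2
  -- The index is shifted by one because `Complex.GammaSeq s n` has n + 1 factors in its
  -- denominator.
  have h1 := ((Complex.continuous_exp.tendsto _).comp
    (h.tendsto_sum_nat.comp (tendsto_add_atTop_nat 1)))
  have h2 : Tendsto (fun n : ℕ => Complex.GammaSeq s n * (((n : ℂ) + 1) / n) *
      Complex.exp ((s - 1) * ((harmonic n - Real.log n : ℝ) : ℂ)) *
        Complex.exp ((s - 1) / ((n + 1 : ℕ) : ℂ))) atTop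
      (𝓝 (Complex.Gamma s * 1 *
        Complex.exp ((s - 1) * (Real.eulerMascheroniConstant : ℂ)) * Complex.exp 0)) := by
    refine (((Complex.GammaSeq_tendsto_Gamma s).mul ?_).mul ?_).mul ?_
    · have := tendsto_inv_atTop_nhds_zero_nat (𝕜 := ℂ)
      have h3 : Tendsto (fun n : ℕ => 1 + (n : ℂ)⁻¹) atTop (𝓝 (1 + 0)) := this.const_add 1
      rw [add_zero] at h3
      refine h3.congr' ?_
      filter_upwards [eventually_ne_atTop 0] with n hn
      have : (n : ℂ) ≠ 0 := by exact_mod_cast hn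
      field_simp
    · refine (Complex.continuous_exp.tendsto _).comp (Tendsto.const_mul _ ?_)
      exact (Complex.continuous_ofReal.tendsto _).comp Real.tendsto_harmonic_sub_log
    · refine (Complex.continuous_exp.tendsto _).comp ?_
      have := (tendsto_inv_atTop_nhds_zero_nat (𝕜 := ℂ)).comp (tendsto_add_atTop_nat 1)
      simpa [div_eq_mul_inv] using this.const_mul (s - 1)
  rw [mul_one, Complex.exp_zero, mul_one] at h2
  refine tendsto_nhds_unique (h1.congr' ?_) h2
  filter_upwards [eventually_ne_atTop 0] with n hn
  have hn' : (n : ℂ) ≠ 0 := by exact_mod_cast hn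
  have hnr : (0 : ℝ) < n := by exact_mod_cast Nat.pos_of_ne_zero hn
  have hprod : ∀ M : ℕ, Complex.exp (∑ m ∈ Finset.range M, deriv (hurwitzTerm s m) 0) =
      (M.factorial : ℂ) / (∏ j ∈ Finset.range M, (s + j)) *
        Complex.exp ((s - 1) * ((harmonic M : ℝ) : ℂ)) := by
    intro M
    induction M with
    | zero => simp
    | succ M ih =>
      have h1 : s + M ≠ 0 := fun h => hs M (by linear_combination h)
      have h2 : ((M + 1 : ℕ) : ℂ) ≠ 0 := by exact_mod_cast M.succ_ne_zero
      rw [Finset.sum_range_succ, Complex.exp_add, ih, deriv_hurwitzTerm_zero hs, Complex.exp_add,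
        Complex.exp_add, Complex.exp_neg, Complex.exp_log h1, Complex.exp_log h2,
        Finset.prod_range_succ, harmonic_succ, Nat.factorial_succ]
      have : (s - 1) * (((harmonic M + ((M + 1 : ℕ) : ℚ)⁻¹ : ℚ) : ℝ) : ℂ) =
          (s - 1) * ((harmonic M : ℝ) : ℂ) + (s - 1) / ((M + 1 : ℕ) : ℂ) := by
        push_cast; ring
      rw [this, Complex.exp_add]
      push_cast
      field_simp
  have hP : ∏ j ∈ Finset.range (n + 1), (s + j) ≠ 0 :=
    Finset.prod_ne_zero_iff.mpr fun j _ h => hs j (by linear_combination h)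
  simp only [Function.comp_apply]
  rw [hprod (n + 1), Complex.GammaSeq, harmonic_succ, Nat.factorial_succ]
  have e1 : (s - 1) * (((harmonic n + ((n + 1 : ℕ) : ℚ)⁻¹ : ℚ) : ℝ) : ℂ) =
      (s - 1) * ((harmonic n - Real.log n : ℝ) : ℂ) + (s - 1) / ((n + 1 : ℕ) : ℂ) +
        (s - 1) * Complex.log n := by
    rw [← Complex.natCast_log]
    push_cast; ring
  have e2 : Complex.exp ((s - 1) * Complex.log n) = (n : ℂ) ^ s / n := by
    rw [mul_comm, ← Complex.cpow_def_of_ne_zero hn', Complex.cpow_sub _ _ hn', Complex.cpow_one]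
  rw [e1, Complex.exp_add, Complex.exp_add, e2]
  push_cast
  field_simp

/-- The analytic continuation of `∑ (s + m)^{-z}` to `Re z > -1/2`. -/
def hurwitzCont (s z : ℂ) : ℂ :=
  (∑' m, hurwitzTerm s m z) + riemannZeta z - (s - 1) * riemannZeta₁ (z + 1)

/-- The two subtracted series are added back as ζ(z) and z(s - 1)ζ(z + 1). In the second one the
factor z absorbs the pole of ζ(z + 1) at z = 0, which is why `hurwitzCont` is written with the
entire function `riemannZeta₁`. -/
lemma hasSum_hurwitzCont (s : ℂ) {z : ℂ} (hz : 1 < z.re) :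
    HasSum (fun m : ℕ => (s + m) ^ (-z)) (hurwitzCont s z) := by
  have h1 := (summable_hurwitzTerm s (z := z) (by linarith)).hasSum
  have key : ∀ w : ℂ, 1 < w.re →
      HasSum (fun m : ℕ => ((m + 1 : ℕ) : ℂ) ^ (-w)) (riemannZeta w) := by
    intro w hw
    rw [zeta_eq_tsum_one_div_nat_add_one_cpow hw]
    have hs : Summable fun m : ℕ => 1 / ((m : ℂ) + 1) ^ w := by
      have := (summable_nat_add_iff 1).mpr (Complex.summable_one_div_nat_cpow.mpr hw)
      simpa using this
    convert hs.hasSum using 2 with m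
    rw [Complex.cpow_neg, one_div]; push_cast; rfl
  have hz1 : 1 < (z + 1).re := by simp; linarith
  have hz0 : z ≠ 0 := by rintro rfl; norm_num at hz
  have h2 := (h1.add (key z hz)).sub ((key (z + 1) hz1).mul_left (z * (s - 1)))
  have e : hurwitzCont s z = ∑' m, hurwitzTerm s m z + riemannZeta z -
      z * (s - 1) * riemannZeta (z + 1) := by
    rw [hurwitzCont, riemannZeta_eq_inv_sub_mul (s := z + 1) (by simpa using hz0),
      add_sub_cancel_right]
    field_simp
  rw [e]
  refine h2.congr_fun fun m => ?_
  rw [hurwitzTerm, neg_add']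
  ring

lemma meromorphicAt_riemannZeta (z : ℂ) : MeromorphicAt riemannZeta z := by
  have h : MeromorphicAt (fun z : ℂ => (z - 1)⁻¹ * riemannZeta₁ z) z := by
    refine MeromorphicAt.mul (MeromorphicAt.inv (by fun_prop)) ?_
    exact (differentiable_riemannZeta₁.analyticAt z).meromorphicAt
  refine h.congr ?_
  by_cases hz : z = 1
  · subst hz
    filter_upwards [self_mem_nhdsWithin] with w hw
    exact (riemannZeta_eq_inv_sub_mul hw).symm
  · filter_upwards [nhdsWithin_le_nhds (isOpen_compl_singleton.mem_nhds hz)] with w hw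
    exact (riemannZeta_eq_inv_sub_mul hw).symm

lemma analyticAt_tsum_hurwitzTerm {s : ℂ} (hs : ∀ n : ℕ, s ≠ -n) {z : ℂ}
    (hz : -(1 / 2) < z.re) : AnalyticAt ℂ (fun z => ∑' m, hurwitzTerm s m z) z :=
  DifferentiableOn.analyticAt (s := {z : ℂ | -(1 / 2) < z.re})
    (fun _ hw => (differentiableAt_tsum_hurwitzTerm hs hw).1.differentiableWithinAt)
    ((isOpen_lt continuous_const Complex.continuous_re).mem_nhds hz)

/-- The inputs are ζ'(0) = -½ log 2π and ζ₁'(1) = γ. The first is the origin of the 1/√(2π) in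
Lerch's formula. -/
lemma hasDerivAt_hurwitzCont {s : ℂ} (hs : ∀ n : ℕ, s ≠ -n) :
    HasDerivAt (hurwitzCont s) (deriv (fun z => ∑' m, hurwitzTerm s m z) 0 +
      -Complex.log (2 * Real.pi) / 2 - (s - 1) * Real.eulerMascheroniConstant) 0 := by
  have h1 := (differentiableAt_tsum_hurwitzTerm hs (z := 0) (by norm_num)).1.hasDerivAt
  have h2 : HasDerivAt riemannZeta (-Complex.log (2 * Real.pi) / 2) 0 := by
    rw [← deriv_riemannZeta_zero]
    exact (differentiableAt_riemannZeta (by norm_num)).hasDerivAt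
  have h3 : HasDerivAt (fun z => riemannZeta₁ (z + 1)) (Real.eulerMascheroniConstant : ℂ) 0 := by
    have : HasDerivAt riemannZeta₁ (Real.eulerMascheroniConstant : ℂ) (0 + 1) := by
      rw [zero_add, ← deriv_riemannZeta₁_one]
      exact (differentiable_riemannZeta₁ 1).hasDerivAt
    simpa using this.comp_add_const 0 1
  exact (h1.add h2).sub (h3.const_mul (s - 1))

/-- This value is needed because the derivative of (2π)^z at 0 multiplies it. -/
lemma hurwitzCont_zero (s : ℂ) : hurwitzCont s 0 = 1 / 2 - s := by
  have : ∀ m, hurwitzTerm s m 0 = 0 := fun m => by simp [hurwitzTerm]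
  simp [hurwitzCont, this, riemannZeta_zero]
  ring

/-- The zeta-regularized product of the numbers `(s + n) / 2π`, each taken with multiplicity `N`,
is `gammaC s ^ (-N)`. -/
theorem exists_regularized_gammaC {s : ℂ} (hs : ∀ n : ℕ, s ≠ -n) (N : ℕ) :
    ∃ Z : ℂ → ℂ, MeromorphicOn Z {z | -(1 / 2) < z.re} ∧ AnalyticAt ℂ Z 0 ∧
      (∀ z : ℂ, 1 < z.re → HasSum
        (fun n : ℕ => (N : ℂ) * (s / (2 * Real.pi) - -(n : ℂ) * (2 * Real.pi : ℂ)⁻¹) ^ (-z))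
          (Z z)) ∧
      Complex.exp (deriv Z 0) = gammaC s ^ N := by
  have hpi : (0 : ℝ) < 2 * Real.pi := by positivity
  have hpc : (2 * Real.pi : ℂ) ≠ 0 := by exact_mod_cast hpi.ne'
  have hpow : Differentiable ℂ fun z : ℂ => (2 * Real.pi : ℂ) ^ z :=
    fun z => differentiableAt_id.const_cpow (Or.inl hpc)
  -- Dividing every s + n by 2π multiplies the series by (2π)^z.
  refine ⟨fun z => N * ((2 * Real.pi : ℂ) ^ z * hurwitzCont s z), ?_, ?_, ?_, ?_⟩
  · intro z hz
    refine (MeromorphicAt.const _ _).mul ((hpow.analyticAt z).meromorphicAt.mul ?_)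
    refine ((analyticAt_tsum_hurwitzTerm hs hz).meromorphicAt.add
      (meromorphicAt_riemannZeta z)).sub ((MeromorphicAt.const _ _).mul ?_)
    have : Differentiable ℂ fun z => riemannZeta₁ (z + 1) := by fun_prop
    exact (this.analyticAt z).meromorphicAt
  · refine analyticAt_const.mul ((hpow.analyticAt 0).mul ?_)
    refine ((analyticAt_tsum_hurwitzTerm hs (by norm_num)).add ?_).sub (analyticAt_const.mul ?_)
    · exact DifferentiableOn.analyticAt (s := {1}ᶜ) differentiableOn_riemannZeta
        (isOpen_compl_singleton.mem_nhds (by simp))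
    · have : Differentiable ℂ fun z => riemannZeta₁ (z + 1) := by fun_prop
      exact this.analyticAt 0
  · intro z hz
    have h := ((hasSum_hurwitzCont s hz).mul_left ((2 * Real.pi : ℂ) ^ z)).mul_left (N : ℂ)
    refine h.congr_fun ?_
    intro n
    have h1 : s + n ≠ 0 := fun h => hs n (by linear_combination h)
    have e : s / (2 * Real.pi) - -(n : ℂ) * (2 * Real.pi : ℂ)⁻¹ =
        (((2 * Real.pi)⁻¹ : ℝ) : ℂ) * (s + n) := by
      push_cast; field_simp; ring
    rw [e, ofReal_mul_cpow (inv_pos.mpr hpi) h1]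
    congr 2
    rw [Complex.ofReal_inv, Complex.inv_cpow, Complex.cpow_neg, inv_inv]
    · push_cast; rfl
    · rw [Complex.arg_ofReal_of_nonneg hpi.le]; exact Real.pi_pos.ne
  · have hd := ((((hasDerivAt_id (0 : ℂ)).const_cpow (c := (2 * Real.pi : ℂ)) (Or.inl hpc)).mul
      (hasDerivAt_hurwitzCont hs)).const_mul (N : ℂ)).deriv
    have hd' : deriv (fun z => N * ((2 * Real.pi : ℂ) ^ z * hurwitzCont s z)) 0 = _ := hd
    rw [hd', Complex.exp_nat_mul, hurwitzCont_zero]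
    congr 1
    simp only [id, Complex.cpow_zero, one_mul, mul_one]
    -- The ½ log 2π from the value ½ - s cancels -½ log 2π from ζ'(0), leaving exactly (2π)^{-s}.
    have e : ∀ x y : ℂ, Complex.log (2 * Real.pi) * (1 / 2 - s) +
        (x + -Complex.log (2 * Real.pi) / 2 - y) =
        Complex.log (2 * Real.pi) * (-s) + x + -y := by intros; ring
    rw [e, Complex.exp_add, Complex.exp_add, exp_deriv_tsum_hurwitzTerm hs, gammaC,
      ← Complex.cpow_def_of_ne_zero hpc, mul_assoc, mul_assoc, ← Complex.exp_add, add_neg_cancel,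
      Complex.exp_zero, mul_one]

/-! ### Ping-pong dynamics of a Schottky group -/

lemma Letter.inv_inv {g : ℕ} (a : Letter g) : a.inv.inv = a := by simp [Letter.inv]

lemma Letter.inv_ne {g : ℕ} (a : Letter g) : a.inv ≠ a := by
  intro h
  have := congrArg Prod.snd h
  simp [Letter.inv] at this

lemma Letter.inv_injective {g : ℕ} : Function.Injective (Letter.inv (g := g)) :=
  Function.Involutive.injective Letter.inv_inv

lemma Letter.inv_eq_iff {g : ℕ} {a b : Letter g} : a.inv = b ↔ a = b.inv :=
  ⟨fun h => by rw [← h, inv_inv], fun h => by rw [h, inv_inv]⟩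

lemma Letter.ne_inv_iff {g : ℕ} {a b : Letter g} : b ≠ a.inv ↔ (a.1 = b.1 → a.2 = b.2) := by
  rcases a with ⟨i, x⟩
  rcases b with ⟨j, y⟩
  cases x <;> cases y <;> simp [Letter.inv, eq_comm]

namespace SchottkyGroup

variable {g : ℕ} (S : SchottkyGroup g)

/-- The lower left coefficient of a group element. -/
def lowerLeft (w : FreeGroup (Fin g)) : ℂ := (S.rep w).1 1 0

/-- The image of `∞` under a group element which does not fix `∞`. -/
def orbitPt (w : FreeGroup (Fin g)) : ℂ := (S.rep w).1 0 0 / (S.rep w).1 1 0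

lemma rep_inv_apply (w : FreeGroup (Fin g)) :
    (S.rep w⁻¹).1 0 0 = (S.rep w).1 1 1 ∧ (S.rep w⁻¹).1 0 1 = -(S.rep w).1 0 1 ∧
    (S.rep w⁻¹).1 1 0 = -(S.rep w).1 1 0 ∧ (S.rep w⁻¹).1 1 1 = (S.rep w).1 0 0 := by
  rw [map_inv]
  change (Matrix.adjugate (S.rep w).1) 0 0 = _ ∧ (Matrix.adjugate (S.rep w).1) 0 1 = _ ∧
    (Matrix.adjugate (S.rep w).1) 1 0 = _ ∧ (Matrix.adjugate (S.rep w).1) 1 1 = _ 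
  rw [Matrix.adjugate_fin_two]
  simp

lemma rep_det (w : FreeGroup (Fin g)) :
    (S.rep w).1 0 0 * (S.rep w).1 1 1 - (S.rep w).1 0 1 * (S.rep w).1 1 0 = 1 := by
  have := (S.rep w).2
  rwa [Matrix.det_fin_two] at this

lemma rep_mul_apply (w v : FreeGroup (Fin g)) (i j : Fin 2) :
    (S.rep (w * v)).1 i j = (S.rep w).1 i 0 * (S.rep v).1 0 j + (S.rep w).1 i 1 * (S.rep v).1 1 j := by
  rw [map_mul]
  change ((S.rep w).1 * (S.rep v).1) i j = _
  rw [Matrix.mul_apply, Fin.sum_univ_two]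

lemma lowerLeft_inv (w : FreeGroup (Fin g)) : S.lowerLeft w⁻¹ = -S.lowerLeft w :=
  (S.rep_inv_apply w).2.2.1

lemma rep_smul_infty (w : FreeGroup (Fin g)) :
    (S.rep w : GL (Fin 2) ℂ) • (OnePoint.infty : OnePoint ℂ) =
      if S.lowerLeft w = 0 then OnePoint.infty else (S.orbitPt w : OnePoint ℂ) :=
  OnePoint.smul_infty_eq_ite _

lemma rep_smul_coe (w : FreeGroup (Fin g)) (z : ℂ) :
    (S.rep w : GL (Fin 2) ℂ) • (z : OnePoint ℂ) =
      if (S.rep w).1 1 0 * z + (S.rep w).1 1 1 = 0 then OnePoint.infty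
        else (mobius (S.rep w) z : OnePoint ℂ) :=
  OnePoint.smul_some_eq_ite

/-- The marking axiom for a⁻¹ writes the exterior of the curve of a as the a⁻¹-image of the disc of
a⁻¹, and applying a undoes this. -/
lemma letter_smul_mem {a : Letter g} {p : OnePoint ℂ}
    (hp : p ∉ (fun z : ℂ => (z : OnePoint ℂ)) '' closure (S.disc a)) :
    (S.rep (FreeGroup.mk [a]) : GL (Fin 2) ℂ) • p ∈
      (fun z : ℂ => (z : OnePoint ℂ)) '' S.disc a.inv := by
  have h := S.disc_map a.inv
  rw [Letter.inv_inv] at h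
  have hp' : p ∈ ((fun z : ℂ => (z : OnePoint ℂ)) '' closure (S.disc a))ᶜ := hp
  rw [← h] at hp'
  obtain ⟨q, hq, rfl⟩ := hp'
  change (S.rep _ : GL (Fin 2) ℂ) • (S.rep _ : GL (Fin 2) ℂ) • q ∈ _
  have e : (S.rep (FreeGroup.mk [a]) : GL (Fin 2) ℂ) *
      (S.rep (FreeGroup.mk [a.inv]) : GL (Fin 2) ℂ) = 1 := by
    rw [← map_mul, ← map_mul]
    have : (FreeGroup.mk [a] * FreeGroup.mk [a.inv] : FreeGroup (Fin g)) = 1 := by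
      have : (FreeGroup.mk [a.inv] : FreeGroup (Fin g)) = (FreeGroup.mk [a])⁻¹ := by
        rw [FreeGroup.inv_mk]; rfl
      rw [this, mul_inv_cancel]
    rw [this, map_one, map_one]
  rw [← mul_smul, e, one_smul]
  exact hq

lemma disc_inv_disjoint {a b : Letter g} (hab : b ≠ a.inv) :
    Disjoint (closure (S.disc b.inv)) (closure (S.disc a)) :=
  S.disc_disjoint _ _ fun h => hab (Letter.inv_eq_iff.mp h)

/-- Ping-pong: the suffix starting with b lands in the disc of b⁻¹. That disc is disjoint from the
closed disc of a because ab is reduced, so a can be applied in turn. -/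
lemma mk_cons_smul_mem (L : List (Letter g)) (a : Letter g)
    (h : FreeGroup.IsReduced (a :: L)) {p : OnePoint ℂ}
    (hp : ∀ b ∈ (a :: L).getLast?, p ∉ (fun z : ℂ => (z : OnePoint ℂ)) '' closure (S.disc b)) :
    (S.rep (FreeGroup.mk (a :: L)) : GL (Fin 2) ℂ) • p ∈
      (fun z : ℂ => (z : OnePoint ℂ)) '' S.disc a.inv := by
  induction L generalizing a with
  | nil => exact S.letter_smul_mem (hp a (by simp))
  | cons b L ih =>
    have h' := FreeGroup.isReduced_cons_cons.mp h
    have hb := ih b h'.2 (by simpa [List.getLast?_cons_cons] using hp)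
    have e : (FreeGroup.mk (a :: b :: L) : FreeGroup (Fin g)) =
        FreeGroup.mk [a] * FreeGroup.mk (b :: L) := by rw [FreeGroup.mul_mk]; rfl
    rw [e, map_mul, map_mul, mul_smul]
    refine S.letter_smul_mem ?_
    rintro ⟨y, hy, hy'⟩
    obtain ⟨x, hx, hx'⟩ := hb
    have hxy : x = y := OnePoint.coe_injective (hx'.trans hy'.symm)
    subst hxy
    exact Set.disjoint_left.mp (S.disc_inv_disjoint (Letter.ne_inv_iff.mpr h'.1))
      (subset_closure hx) hy

/-- The base point ∞ lies outside all discs, so every nonempty reduced word moves it into the disc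
named by its first letter, and in particular off ∞. -/
lemma orbitPt_mk_cons {L : List (Letter g)} {a : Letter g} (h : FreeGroup.IsReduced (a :: L)) :
    S.lowerLeft (FreeGroup.mk (a :: L)) ≠ 0 ∧ S.orbitPt (FreeGroup.mk (a :: L)) ∈ S.disc a.inv := by
  have := S.mk_cons_smul_mem L a h (p := OnePoint.infty) (by
    rintro b - ⟨y, -, hy⟩
    exact OnePoint.coe_ne_infty y hy)
  rw [rep_smul_infty] at this
  split_ifs at this with h0
  · obtain ⟨y, -, hy⟩ := this
    exact absurd hy (OnePoint.coe_ne_infty y)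
  · obtain ⟨y, hy, hy'⟩ := this
    have : y = _ := OnePoint.coe_injective hy'
    exact ⟨h0, this ▸ hy⟩

lemma orbitPt_inv_mk_concat {L : List (Letter g)} {b : Letter g}
    (h : FreeGroup.IsReduced (L ++ [b])) :
    S.orbitPt (FreeGroup.mk (L ++ [b]))⁻¹ ∈ S.disc b := by
  have e : FreeGroup.invRev (L ++ [b]) = b.inv :: FreeGroup.invRev L := by
    simp [FreeGroup.invRev, Letter.inv]
  have h2 : FreeGroup.IsReduced (b.inv :: FreeGroup.invRev L) := by
    rw [← e, FreeGroup.isReduced_iff_reduce_eq, FreeGroup.reduce_invRev, h.reduce_eq]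
  rw [FreeGroup.inv_mk, e]
  have := (S.orbitPt_mk_cons h2).2
  rwa [Letter.inv_inv] at this

lemma exists_cons {w : FreeGroup (Fin g)} (hw : w ≠ 1) :
    ∃ (a : Letter g) (L : List (Letter g)), FreeGroup.IsReduced (a :: L) ∧
      w = FreeGroup.mk (a :: L) ∧ w.norm = L.length + 1 := by
  have h := FreeGroup.isReduced_toWord (x := w)
  have h1 : w.toWord ≠ [] := fun h => hw (FreeGroup.toWord_eq_nil_iff.mp h)
  obtain ⟨a, L, e⟩ := List.exists_cons_of_ne_nil h1
  refine ⟨a, L, e ▸ h, by rw [← e, FreeGroup.mk_toWord], ?_⟩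
  rw [FreeGroup.norm, e]; rfl

lemma lowerLeft_ne_zero {w : FreeGroup (Fin g)} (hw : w ≠ 1) : S.lowerLeft w ≠ 0 := by
  obtain ⟨a, L, h, rfl, -⟩ := exists_cons hw
  exact (S.orbitPt_mk_cons h).1

lemma exists_radius : ∃ R : ℝ, 0 < R ∧ ∀ w : FreeGroup (Fin g), w ≠ 1 → ‖S.orbitPt w‖ ≤ R := by
  have h : Bornology.IsBounded (⋃ a, S.disc a) := Bornology.isBounded_iUnion.mpr S.disc_bounded
  obtain ⟨R, hR0, hR⟩ := h.exists_pos_norm_le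
  refine ⟨R, hR0, fun w hw => hR _ ?_⟩
  obtain ⟨a, L, h, rfl, -⟩ := exists_cons hw
  exact Set.mem_iUnion.mpr ⟨_, (S.orbitPt_mk_cons h).2⟩

lemma exists_sep : ∃ δ : ℝ, 0 < δ ∧ ∀ a b : Letter g, a ≠ b → ∀ x ∈ closure (S.disc a),
    ∀ y ∈ closure (S.disc b), δ ≤ ‖x - y‖ := by
  have h : ∀ ab : Letter g × Letter g, ∃ δ : ℝ, 0 < δ ∧ (ab.1 ≠ ab.2 →
      ∀ x ∈ closure (S.disc ab.1), ∀ y ∈ closure (S.disc ab.2), δ ≤ ‖x - y‖) := by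
    rintro ⟨a, b⟩
    by_cases hab : a = b
    · exact ⟨1, one_pos, fun h => absurd hab h⟩
    · obtain ⟨δ, hδ, h⟩ := Metric.exists_pos_forall_lt_edist
        ((S.disc_bounded a).isCompact_closure) isClosed_closure (S.disc_disjoint a b hab)
      refine ⟨δ, by exact_mod_cast hδ, fun _ x hx y hy => ?_⟩
      have := h x hx y hy
      rw [edist_dist, ← ENNReal.ofReal_coe_nnreal] at this
      rw [← dist_eq_norm]
      exact (ENNReal.ofReal_lt_ofReal_iff'.mp this).1.le
  choose δ hδ hδ' using h
  rcases isEmpty_or_nonempty (Letter g × Letter g) with he | hne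
  · exact ⟨1, one_pos, fun a b => (he.false (a, b)).elim⟩
  · obtain ⟨m, hm⟩ := Finite.exists_min δ
    exact ⟨δ m, hδ m, fun a b hab x hx y hy => (hm (a, b)).trans (hδ' (a, b) hab x hx y hy)⟩

/-! ### Contraction estimates from the pole and the image of ∞ -/

/-- A lower bound for the mutual distances of the discs of the marking. -/
def sep : ℝ := Classical.choose S.exists_sep

lemma sep_pos : 0 < S.sep := (Classical.choose_spec S.exists_sep).1

lemma sep_le {a b : Letter g} (hab : a ≠ b) {x y : ℂ} (hx : x ∈ closure (S.disc a))
    (hy : y ∈ closure (S.disc b)) : S.sep ≤ ‖x - y‖ :=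
  (Classical.choose_spec S.exists_sep).2 a b hab x hx y hy

/-- The pole of w is w⁻¹∞. -/
lemma denom_eq {w : FreeGroup (Fin g)} (hw : w ≠ 1) (z : ℂ) :
    (S.rep w).1 1 0 * z + (S.rep w).1 1 1 = S.lowerLeft w * (z - S.orbitPt w⁻¹) := by
  have hc := S.lowerLeft_ne_zero hw
  obtain ⟨h1, -, h2, -⟩ := S.rep_inv_apply w
  rw [orbitPt, h1, h2]
  unfold lowerLeft at *
  field_simp
  ring

/-- The identity behind every estimate below: away from its pole w⁻¹∞, a Möbius map with large lower
left coefficient c is within O(|c|⁻²) of the constant w∞. -/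
lemma mobius_sub_orbitPt {w : FreeGroup (Fin g)} (hw : w ≠ 1) {z : ℂ} (hz : z ≠ S.orbitPt w⁻¹) :
    mobius (S.rep w) z - S.orbitPt w = -(S.lowerLeft w ^ 2 * (z - S.orbitPt w⁻¹))⁻¹ := by
  have hc := S.lowerLeft_ne_zero hw
  have hd := S.denom_eq hw z
  have hz' := sub_ne_zero.mpr hz
  have hdet := S.rep_det w
  have hne : (S.rep w).1 1 0 * z + (S.rep w).1 1 1 ≠ 0 := by
    rw [hd]; exact mul_ne_zero hc hz'
  have e : S.lowerLeft w ^ 2 * (z - S.orbitPt w⁻¹) =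
      S.lowerLeft w * ((S.rep w).1 1 0 * z + (S.rep w).1 1 1) := by rw [hd]; ring
  rw [e, mobius, orbitPt]
  unfold lowerLeft at *
  rw [div_sub_div _ _ hne hc, ← one_div, ← neg_div, div_eq_div_iff (mul_ne_zero hne hc)
    (mul_ne_zero hc hne)]
  linear_combination (-(S.rep w).1 1 0 * ((S.rep w).1 1 0 * z + (S.rep w).1 1 1)) * hdet

lemma mobius_mul {w v : FreeGroup (Fin g)} {z : ℂ}
    (hz : (S.rep v).1 1 0 * z + (S.rep v).1 1 1 ≠ 0) :
    mobius (S.rep (w * v)) z = mobius (S.rep w) (mobius (S.rep v) z) := by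
  simp only [mobius, rep_mul_apply]
  rw [← mul_div_mul_right ((S.rep w).1 0 0 * _ + _) _ hz]
  congr 1 <;> field_simp <;> ring

lemma orbitPt_mul {w v : FreeGroup (Fin g)} (hv : v ≠ 1) :
    S.orbitPt (w * v) = mobius (S.rep w) (S.orbitPt v) := by
  have hc : (S.rep v).1 1 0 ≠ 0 := S.lowerLeft_ne_zero hv
  simp only [mobius, orbitPt, rep_mul_apply]
  rw [eq_comm, ← mul_div_mul_right ((S.rep w).1 0 0 * _ + _) _ hc]
  congr 1 <;> field_simp

lemma orbitPt_ne {v w : FreeGroup (Fin g)} (h : v ≠ w) (hv : v ≠ 1) (hw : w ≠ 1) :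
    S.orbitPt v ≠ S.orbitPt w := by
  intro e
  have hcv : (S.rep v).1 1 0 ≠ 0 := S.lowerLeft_ne_zero hv
  have hcw : (S.rep w).1 1 0 ≠ 0 := S.lowerLeft_ne_zero hw
  have h1 : v⁻¹ * w ≠ 1 := fun h' => h (inv_mul_eq_one.mp h')
  apply S.lowerLeft_ne_zero h1
  obtain ⟨-, -, h2, h3⟩ := S.rep_inv_apply v
  rw [lowerLeft, rep_mul_apply, h2, h3]
  rw [orbitPt, orbitPt, div_eq_div_iff hcv hcw] at e
  linear_combination e

/-- The orbit of ∞ under nontrivial words lies in a ball of radius R. Infinitely many w with |c| ≤ M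
would give, by Bolzano–Weierstrass, distinct w, w' with w∞ and w'∞ arbitrarily close. But with v =
w⁻¹w' the difference is -1/(c²(v∞ - w⁻¹∞)), of modulus at least 1/(2RM²). -/
lemma finite_lowerLeft_le (M : ℝ) : {w : FreeGroup (Fin g) | ‖S.lowerLeft w‖ ≤ M}.Finite := by
  obtain ⟨R, hR0, hR⟩ := S.exists_radius
  by_contra hinf
  have hinf' : ({w : FreeGroup (Fin g) | ‖S.lowerLeft w‖ ≤ M} \ {1}).Infinite :=
    Set.Infinite.sdiff hinf (Set.finite_singleton 1)
  set T := {w : FreeGroup (Fin g) | ‖S.lowerLeft w‖ ≤ M} \ {1} with hT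
  let u : ℕ → T := hinf'.natEmbedding
  have hu : Function.Injective u := hinf'.natEmbedding.injective
  have hu1 : ∀ n, (u n : FreeGroup (Fin g)) ≠ 1 := fun n => (u n).2.2
  have huM : ∀ n, ‖S.lowerLeft (u n)‖ ≤ M := fun n => (u n).2.1
  have hM : 0 < M := (norm_pos_iff.mpr (S.lowerLeft_ne_zero (hu1 0))).trans_le (huM 0)
  obtain ⟨x, -, φ, hφ, hx⟩ := tendsto_subseq_of_bounded (x := fun n => S.orbitPt (u n))
    (Metric.isBounded_closedBall (x := (0 : ℂ)) (r := R))
    (fun n => by simpa using hR _ (hu1 n))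
  have hr : 0 < (2 * R * M ^ 2)⁻¹ := by positivity
  obtain ⟨N, hN⟩ := Metric.cauchySeq_iff.mp hx.cauchySeq _ hr
  have hlt := hN (N + 1) (by simp) N le_rfl
  simp only [Function.comp_apply] at hlt
  set w : FreeGroup (Fin g) := (u (φ N)).1 with hwdef
  set w' : FreeGroup (Fin g) := (u (φ (N + 1))).1 with hwdef'
  have hne : w ≠ w' := fun e => by
    have := hu (Subtype.ext e)
    exact absurd this (hφ (Nat.lt_succ_self N)).ne
  have hw1 : w ≠ 1 := hu1 _
  have hv1 : w⁻¹ * w' ≠ 1 := fun h' => hne (inv_mul_eq_one.mp h')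
  have e1 : S.orbitPt w' = mobius (S.rep w) (S.orbitPt (w⁻¹ * w')) := by
    rw [← S.orbitPt_mul hv1, mul_inv_cancel_left]
  have hpne : S.orbitPt (w⁻¹ * w') ≠ S.orbitPt w⁻¹ := by
    refine S.orbitPt_ne ?_ hv1 (inv_ne_one.mpr hw1)
    intro h
    exact hu1 (φ (N + 1)) (by simpa using h)
  rw [dist_eq_norm, e1, S.mobius_sub_orbitPt hw1 hpne, norm_neg, norm_inv, norm_mul, norm_pow] at hlt
  have hc := norm_pos_iff.mpr (S.lowerLeft_ne_zero hw1)
  have hp := norm_pos_iff.mpr (sub_ne_zero.mpr hpne)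
  have h3 : ‖S.orbitPt (w⁻¹ * w') - S.orbitPt w⁻¹‖ ≤ 2 * R := by
    refine (norm_sub_le _ _).trans ?_
    linarith [hR _ hv1, hR _ (inv_ne_one.mpr hw1)]
  refine absurd hlt (not_lt.mpr ?_)
  refine inv_anti₀ (by positivity) ?_
  rw [mul_comm (2 * R)]
  exact mul_le_mul (pow_le_pow_left₀ hc.le (huM (φ N)) 2) h3 hp.le (by positivity)

/-- A bound for the size of the part of the orbit of `∞` beyond a group element. -/
def err (w : FreeGroup (Fin g)) : ℝ := (S.sep * ‖S.lowerLeft w‖ ^ 2)⁻¹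

lemma err_nonneg (w : FreeGroup (Fin g)) : 0 ≤ S.err w :=
  inv_nonneg.mpr (mul_nonneg S.sep_pos.le (by positivity))

lemma finite_le_err {ε : ℝ} (hε : 0 < ε) : {w : FreeGroup (Fin g) | ε ≤ S.err w}.Finite := by
  refine (S.finite_lowerLeft_le (1 + (S.sep * ε)⁻¹)).subset fun w hw => ?_
  have hs := S.sep_pos
  by_contra h
  have h1 : 1 + (S.sep * ε)⁻¹ < ‖S.lowerLeft w‖ := not_le.mp h
  have h0 : 0 < (S.sep * ε)⁻¹ := by positivity
  have h2 : (S.sep * ε)⁻¹ < ‖S.lowerLeft w‖ ^ 2 := by nlinarith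
  refine absurd (show ε ≤ S.err w from hw) (not_le.mpr ?_)
  rw [err, inv_lt_comm₀ (mul_pos hs (h0.trans h2)) hε]
  calc ε⁻¹ = S.sep * (S.sep * ε)⁻¹ := by field_simp
    _ < _ := by gcongr

/-- A finite set of words has bounded length, so `err` tends to 0 uniformly as the length grows. -/
lemma exists_forall_err_lt {ε : ℝ} (hε : 0 < ε) :
    ∃ N : ℕ, ∀ w : FreeGroup (Fin g), N ≤ w.norm → S.err w < ε := by
  obtain ⟨N, hN⟩ := ((S.finite_le_err hε).image FreeGroup.norm).bddAbove
  refine ⟨N + 1, fun w hw => ?_⟩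
  by_contra h
  have := hN ⟨w, not_lt.mp h, rfl⟩
  omega

lemma err_inv (w : FreeGroup (Fin g)) : S.err w⁻¹ = S.err w := by
  rw [err, lowerLeft_inv, norm_neg, err]

end SchottkyGroup

/-! ### Infinite reduced words and their limit points -/

/-- Infinite reduced words. -/
def IsRed {g : ℕ} (a : ℕ → Letter g) : Prop := ∀ k, a (k + 1) ≠ (a k).inv

lemma IsRed.shift {g : ℕ} {a : ℕ → Letter g} (h : IsRed a) (n : ℕ) : IsRed fun k => a (n + k) :=
  fun k => h (n + k)

/-- The group element given by the first `n` letters. -/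
def pre {g : ℕ} (a : ℕ → Letter g) (n : ℕ) : FreeGroup (Fin g) :=
  FreeGroup.mk ((List.range n).map a)

lemma pre_add {g : ℕ} (a : ℕ → Letter g) (n k : ℕ) :
    pre a (n + k) = pre a n * pre (fun j => a (n + j)) k := by
  rw [pre, pre, pre, FreeGroup.mul_mk, List.range_add, List.map_append, List.map_map]
  rfl

lemma pre_succ {g : ℕ} (a : ℕ → Letter g) (n : ℕ) :
    pre a (n + 1) = FreeGroup.mk (a 0 :: (List.range n).map fun j => a (j + 1)) := by
  rw [pre, List.range_succ_eq_map, List.map_cons, List.map_map]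
  rfl

lemma pre_succ' {g : ℕ} (a : ℕ → Letter g) (n : ℕ) :
    pre a (n + 1) = FreeGroup.mk ((List.range n).map a ++ [a n]) := by
  rw [pre, List.range_succ, List.map_append]
  rfl

lemma pre_congr {g : ℕ} {a b : ℕ → Letter g} {n : ℕ} (h : ∀ k < n, a k = b k) :
    pre a n = pre b n := by
  rw [pre, pre, List.map_congr_left fun k hk => h k (List.mem_range.mp hk)]

lemma IsRed.isReduced {g : ℕ} {a : ℕ → Letter g} (h : IsRed a) (n : ℕ) :
    FreeGroup.IsReduced ((List.range n).map a) := by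
  rw [FreeGroup.IsReduced, List.isChain_map, List.isChain_range]
  exact fun m _ => Letter.ne_inv_iff.mp (h m)

lemma IsRed.isReduced_cons {g : ℕ} {a : ℕ → Letter g} (h : IsRed a) (n : ℕ) :
    FreeGroup.IsReduced (a 0 :: (List.range n).map fun j => a (j + 1)) := by
  have := h.isReduced (n + 1)
  rwa [List.range_succ_eq_map, List.map_cons, List.map_map] at this

lemma IsRed.isReduced_concat {g : ℕ} {a : ℕ → Letter g} (h : IsRed a) (n : ℕ) :
    FreeGroup.IsReduced ((List.range n).map a ++ [a n]) := by
  have := h.isReduced (n + 1)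
  rwa [List.range_succ, List.map_append] at this

lemma IsRed.norm_pre {g : ℕ} {a : ℕ → Letter g} (h : IsRed a) (n : ℕ) : (pre a n).norm = n := by
  rw [pre, FreeGroup.norm, FreeGroup.toWord_mk, (h.isReduced n).reduce_eq]
  simp

lemma IsRed.pre_succ_ne_one {g : ℕ} {a : ℕ → Letter g} (h : IsRed a) (n : ℕ) :
    pre a (n + 1) ≠ 1 := by
  intro e
  have := h.norm_pre (n + 1)
  rw [e, FreeGroup.norm_one] at this
  omega

lemma exists_ne_ne {g : ℕ} (hg : 2 ≤ g) (x y : Letter g) : ∃ b, b ≠ x ∧ b ≠ y := by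
  by_contra! h
  have h1 : (Finset.univ : Finset (Letter g)) ⊆ {x, y} := by
    intro b _
    by_cases hb : b = x
    · simp [hb]
    · simp [h b hb]
  have h2 := (Finset.card_le_card h1).trans Finset.card_le_two
  rw [Finset.card_univ, Fintype.card_prod, Fintype.card_fin, Fintype.card_bool] at h2
  omega

/-- Infinite reduced words with a given finite beginning. -/
lemma exists_isRed_of_isReduced {g : ℕ} {L : List (Letter g)} (hL : FreeGroup.IsReduced L)
    (hne : L ≠ []) : ∃ a : ℕ → Letter g, IsRed a ∧ (List.range L.length).map a = L := by
  -- The word is continued by repeating its last letter, which stays reduced because no letter is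
  -- its own inverse.
  refine ⟨fun k => L.getD k (L.getLast hne), fun k => ?_, ?_⟩
  · beta_reduce
    by_cases hk : k + 1 < L.length
    · rw [FreeGroup.IsReduced, List.isChain_iff_getElem] at hL
      have := hL k hk
      rw [List.getD_eq_getElem _ _ hk, List.getD_eq_getElem _ _ (by omega)]
      exact Letter.ne_inv_iff.mpr this
    · rw [List.getD_eq_default _ _ (by omega)]
      by_cases hk' : k < L.length
      · rw [List.getD_eq_getElem _ _ hk', List.getLast_eq_getElem]
        have : k = L.length - 1 := by omega
        subst this
        exact (Letter.inv_ne _).symm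
      · rw [List.getD_eq_default _ _ (by omega)]
        exact (Letter.inv_ne _).symm
  · refine List.ext_getElem (by simp) fun k h1 h2 => ?_
    rw [List.getElem_map, List.getElem_range, List.getD_eq_getElem _ _ h2]

namespace SchottkyGroup

variable {g : ℕ} (S : SchottkyGroup g)

lemma rep_mk (L : List (Letter g)) : S.rep (FreeGroup.mk L) = (L.map S.letter).prod := by
  induction L with
  | nil =>
    change S.rep 1 = _
    simp
  | cons a L ih =>
    have e : (FreeGroup.mk (a :: L) : FreeGroup (Fin g)) =
        FreeGroup.mk [a] * FreeGroup.mk L := by rw [FreeGroup.mul_mk]; rfl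
    rw [e, map_mul, ih, List.map_cons, List.prod_cons]
    rfl

lemma partialProd_eq (a : ℕ → Letter g) (n : ℕ) : S.partialProd a n = S.rep (pre a (n + 1)) := by
  rw [partialProd, pre, rep_mk, List.map_map]
  rfl

lemma orbitPt_pre_mem {a : ℕ → Letter g} (h : IsRed a) (n : ℕ) :
    S.orbitPt (pre a (n + 1)) ∈ S.disc (a 0).inv := by
  rw [pre_succ]
  exact (S.orbitPt_mk_cons (h.isReduced_cons n)).2

lemma orbitPt_pre_inv_mem {a : ℕ → Letter g} (h : IsRed a) (n : ℕ) :
    S.orbitPt (pre a (n + 1))⁻¹ ∈ S.disc (a n) := by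
  rw [pre_succ']
  exact S.orbitPt_inv_mk_concat (h.isReduced_concat n)

/-- The point z and the pole w⁻¹∞ lie in different closed discs, hence at distance at least `sep`.
-/
lemma norm_mobius_sub_le {w : FreeGroup (Fin g)} (hw : w ≠ 1) {b c : Letter g} (hbc : c ≠ b)
    (hwb : S.orbitPt w⁻¹ ∈ S.disc b) {z : ℂ} (hz : z ∈ closure (S.disc c)) :
    ‖mobius (S.rep w) z - S.orbitPt w‖ ≤ S.err w := by
  have h1 := S.sep_le hbc hz (subset_closure hwb)
  have h0 := S.sep_pos
  have hc := norm_pos_iff.mpr (S.lowerLeft_ne_zero hw)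
  have hne : z ≠ S.orbitPt w⁻¹ := by
    intro e
    rw [e, sub_self, norm_zero] at h1
    linarith
  rw [S.mobius_sub_orbitPt hw hne, norm_neg, norm_inv, norm_mul, norm_pow, err]
  refine inv_anti₀ (by positivity) ?_
  rw [mul_comm]
  gcongr

/-- The longer prefix is the shorter one applied to the orbit point of the remaining letters. That
point lies in the disc of (a_{n+1})⁻¹ and the pole in the disc of a_n, and these discs differ
because the word is reduced. -/
lemma norm_orbitPt_pre_sub_le {a : ℕ → Letter g} (h : IsRed a) (n k : ℕ) :
    ‖S.orbitPt (pre a (n + 1 + k)) - S.orbitPt (pre a (n + 1))‖ ≤ S.err (pre a (n + 1)) := by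
  rcases k with _ | k
  · simpa using S.err_nonneg _
  have hv := (h.shift (n + 1)).pre_succ_ne_one k
  rw [pre_add, S.orbitPt_mul hv]
  refine S.norm_mobius_sub_le (h.pre_succ_ne_one n) (b := a n) (c := (a (n + 1)).inv) ?_
    (S.orbitPt_pre_inv_mem h n) (subset_closure (S.orbitPt_pre_mem (h.shift (n + 1)) k))
  exact fun e => h n (Letter.inv_eq_iff.mp e)

/-- The limit of `(a_0 ⋯ a_n) ∞`. -/
def limPt (a : ℕ → Letter g) : ℂ := limUnder atTop fun n => S.orbitPt (pre a (n + 1))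

lemma tendsto_limPt {a : ℕ → Letter g} (h : IsRed a) :
    Tendsto (fun n => S.orbitPt (pre a (n + 1))) atTop (𝓝 (S.limPt a)) := by
  refine CauchySeq.tendsto_limUnder ?_
  rw [Metric.cauchySeq_iff']
  intro ε hε
  obtain ⟨N, hN⟩ := S.exists_forall_err_lt hε
  refine ⟨N, fun n hn => ?_⟩
  obtain ⟨k, rfl⟩ := Nat.exists_eq_add_of_le hn
  rw [dist_eq_norm, show N + k + 1 = N + 1 + k by ring]
  exact (S.norm_orbitPt_pre_sub_le h N k).trans_lt (hN _ (by rw [h.norm_pre]; omega))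

lemma norm_limPt_sub_le {a : ℕ → Letter g} (h : IsRed a) (n : ℕ) :
    ‖S.limPt a - S.orbitPt (pre a (n + 1))‖ ≤ S.err (pre a (n + 1)) := by
  refine le_of_tendsto (((S.tendsto_limPt h).comp (tendsto_add_atTop_nat n)).sub_const _).norm
    (Eventually.of_forall fun k => ?_)
  simp only [Function.comp_apply]
  rw [show k + n + 1 = n + 1 + k by ring]
  exact S.norm_orbitPt_pre_sub_le h n k

lemma limPt_mem {a : ℕ → Letter g} (h : IsRed a) : S.limPt a ∈ closure (S.disc (a 0).inv) :=
  mem_closure_of_tendsto (S.tendsto_limPt h) (Eventually.of_forall fun n => S.orbitPt_pre_mem h n)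

lemma denom_ne_zero {w : FreeGroup (Fin g)} (hw : w ≠ 1) {z : ℂ} (hz : z ≠ S.orbitPt w⁻¹) :
    (S.rep w).1 1 0 * z + (S.rep w).1 1 1 ≠ 0 := by
  rw [S.denom_eq hw]
  exact mul_ne_zero (S.lowerLeft_ne_zero hw) (sub_ne_zero.mpr hz)

lemma continuousAt_mobius {w : FreeGroup (Fin g)} {z : ℂ}
    (hz : (S.rep w).1 1 0 * z + (S.rep w).1 1 1 ≠ 0) : ContinuousAt (mobius (S.rep w)) z := by
  unfold mobius
  exact ContinuousAt.div (by fun_prop) (by fun_prop) hz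

lemma mk_singleton_ne_one (a : Letter g) : (FreeGroup.mk [a] : FreeGroup (Fin g)) ≠ 1 := by
  intro h
  have := congrArg FreeGroup.norm h
  rw [FreeGroup.norm, FreeGroup.toWord_mk, FreeGroup.reduce_singleton, FreeGroup.norm_one] at this
  simp at this

lemma mk_singleton_inv (a : Letter g) :
    (FreeGroup.mk [a] : FreeGroup (Fin g))⁻¹ = FreeGroup.mk [a.inv] := by
  rw [FreeGroup.inv_mk]; rfl

lemma letter_denom_ne_zero {a b : Letter g} (hab : b ≠ a) {z : ℂ}
    (hz : z ∈ closure (S.disc b)) : (S.letter a).1 1 0 * z + (S.letter a).1 1 1 ≠ 0 := by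
  refine S.denom_ne_zero (mk_singleton_ne_one a) ?_
  rintro rfl
  rw [mk_singleton_inv] at hz
  have h := (S.orbitPt_mk_cons (L := []) (a := a.inv) FreeGroup.IsReduced.singleton).2
  rw [Letter.inv_inv] at h
  exact Set.disjoint_left.mp (S.disc_disjoint b a hab) hz (subset_closure h)

lemma limPt_tail_denom_ne_zero {a : ℕ → Letter g} (h : IsRed a) :
    (S.letter (a 0)).1 1 0 * S.limPt (fun k => a (1 + k)) + (S.letter (a 0)).1 1 1 ≠ 0 :=
  S.letter_denom_ne_zero (fun e => h 0 (Letter.inv_eq_iff.mp e)) (S.limPt_mem (h.shift 1))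

lemma limPt_eq_mobius {a : ℕ → Letter g} (h : IsRed a) :
    S.limPt a = mobius (S.letter (a 0)) (S.limPt fun k => a (1 + k)) := by
  have h1 := (S.tendsto_limPt h).comp (tendsto_add_atTop_nat 1)
  have h2 := (S.continuousAt_mobius (w := FreeGroup.mk [a 0])
    (S.limPt_tail_denom_ne_zero h)).tendsto.comp (S.tendsto_limPt (h.shift 1))
  refine tendsto_nhds_unique h1 (h2.congr fun n => ?_)
  simp only [Function.comp_apply]
  rw [show n + 1 + 1 = 1 + (n + 1) by ring, pre_add a,
    S.orbitPt_mul ((h.shift 1).pre_succ_ne_one n)]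
  rfl

lemma mobius_inv_mobius {w : FreeGroup (Fin g)} {z : ℂ}
    (hz : (S.rep w).1 1 0 * z + (S.rep w).1 1 1 ≠ 0) :
    mobius (S.rep w⁻¹) (mobius (S.rep w) z) = z := by
  rw [← S.mobius_mul hz, inv_mul_cancel, map_one]
  simp [mobius]

lemma limPt_tail_eq_mobius {a : ℕ → Letter g} (h : IsRed a) :
    (S.limPt fun k => a (1 + k)) = mobius (S.letter (a 0).inv) (S.limPt a) := by
  rw [S.limPt_eq_mobius h, letter, letter, ← mk_singleton_inv]
  exact (S.mobius_inv_mobius (S.limPt_tail_denom_ne_zero h)).symm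

/-- The disc containing the limit point reveals the first letter. Applying the inverse of that
letter shifts the word, and the argument repeats. -/
lemma limPt_injOn : Set.InjOn S.limPt {a | IsRed a} := by
  have h0 : ∀ a b : ℕ → Letter g, IsRed a → IsRed b → S.limPt a = S.limPt b → a 0 = b 0 := by
    intro a b ha hb h
    by_contra hne
    have h1 := S.limPt_mem ha
    rw [h] at h1
    exact Set.disjoint_left.mp (S.disc_disjoint _ _ fun e => hne (Letter.inv_injective e)) h1
      (S.limPt_mem hb)
  have hk : ∀ k, ∀ a b : ℕ → Letter g, IsRed a → IsRed b → S.limPt a = S.limPt b → a k = b k := by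
    intro k
    induction k with
    | zero => exact h0
    | succ k ih =>
      intro a b ha hb h
      have := ih _ _ (ha.shift 1) (hb.shift 1) (by
        rw [S.limPt_tail_eq_mobius ha, S.limPt_tail_eq_mobius hb, h, h0 a b ha hb h])
      simpa [add_comm] using this
  exact fun a ha b hb h => funext fun k => hk k a b ha hb h

lemma cylinder_eq {m : ℕ} (w : Fin m → Letter g) :
    S.cylinder w = S.limPt '' {a | IsRed a ∧ ∀ k : Fin m, a k = w k} := by
  have key : ∀ (a : ℕ → Letter g) (x : ℂ), IsRed a →
      (Tendsto (fun n => (S.partialProd a n : GL (Fin 2) ℂ) • (OnePoint.infty : OnePoint ℂ)) atTop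
        (𝓝 (x : OnePoint ℂ)) ↔ S.limPt a = x) := by
    intro a x ha
    have e : (fun n => (S.partialProd a n : GL (Fin 2) ℂ) • (OnePoint.infty : OnePoint ℂ)) =
        (fun z : ℂ => (z : OnePoint ℂ)) ∘ fun n => S.orbitPt (pre a (n + 1)) := by
      ext1 n
      rw [partialProd_eq, rep_smul_infty, if_neg (S.lowerLeft_ne_zero (ha.pre_succ_ne_one n))]
      rfl
    -- All the orbit points are finite, so convergence on the sphere to a finite point is
    -- convergence in ℂ.
    rw [e, ← OnePoint.isOpenEmbedding_coe.isEmbedding.tendsto_nhds_iff]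
    exact ⟨fun h => tendsto_nhds_unique (S.tendsto_limPt ha) h,
      fun h => h ▸ S.tendsto_limPt ha⟩
  ext x
  constructor
  · rintro ⟨a, ha, hw, h⟩
    exact ⟨a, ⟨ha, hw⟩, (key a x ha).mp h⟩
  · rintro ⟨a, ⟨ha, hw⟩, h⟩
    exact ⟨a, ha, hw, (key a x ha).mpr h⟩

/-- A uniform limit of functions that depend on finitely many letters only. -/
lemma continuousOn_limPt : ContinuousOn S.limPt {a | IsRed a} := by
  have hu : TendstoUniformlyOn (fun n (a : ℕ → Letter g) => S.orbitPt (pre a (n + 1))) S.limPt atTop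
      {a | IsRed a} := by
    rw [Metric.tendstoUniformlyOn_iff]
    intro ε hε
    obtain ⟨N, hN⟩ := S.exists_forall_err_lt hε
    filter_upwards [eventually_ge_atTop N] with n hn a ha
    rw [dist_eq_norm]
    exact (S.norm_limPt_sub_le ha n).trans_lt (hN _ (by rw [IsRed.norm_pre ha]; omega))
  refine hu.continuousOn (Frequently.of_forall fun n => Continuous.continuousOn ?_)
  rw [continuous_iff_continuousAt]
  intro a
  refine ContinuousAt.congr (f := fun _ => S.orbitPt (pre a (n + 1))) continuousAt_const ?_
  have : ∀ k ∈ Finset.range (n + 1), ∀ᶠ b : ℕ → Letter g in 𝓝 a, b k = a k := fun k _ =>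
    ((isOpen_discrete {a k}).preimage (by fun_prop : Continuous fun b : ℕ → Letter g => b k)).mem_nhds
      rfl
  filter_upwards [(Filter.eventually_all_finset _).mpr this] with b hb
  rw [pre_congr (a := a) (b := b) fun k hk => (hb k (Finset.mem_range.mpr hk)).symm]

lemma isCompact_isRed {m : ℕ} (w : Fin m → Letter g) :
    IsCompact {a : ℕ → Letter g | IsRed a ∧ ∀ k : Fin m, a k = w k} := by
  refine IsClosed.isCompact ?_
  have e : {a : ℕ → Letter g | IsRed a ∧ ∀ k : Fin m, a k = w k} =
      (⋂ k, {a | a (k + 1) ≠ (a k).inv}) ∩ ⋂ k : Fin m, {a | a k = w k} := by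
    ext a; simp [IsRed]
  rw [e]
  refine (isClosed_iInter fun k => ?_).inter (isClosed_iInter fun k => ?_)
  · have : Continuous fun a : ℕ → Letter g => (a (k + 1), a k) := by fun_prop
    exact (isClosed_discrete {p : Letter g × Letter g | p.1 ≠ p.2.inv}).preimage this
  · exact (isClosed_discrete {w k}).preimage
      (by fun_prop : Continuous fun b : ℕ → Letter g => b k)

lemma isCompact_cylinder {m : ℕ} (w : Fin m → Letter g) : IsCompact (S.cylinder w) := by
  rw [cylinder_eq]
  exact (isCompact_isRed w).image_of_continuousOn (S.continuousOn_limPt.mono fun a ha => ha.1)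

lemma cylinder_disjoint {m : ℕ} {w v : Fin m → Letter g} (h : w ≠ v) :
    Disjoint (S.cylinder w) (S.cylinder v) := by
  rw [cylinder_eq, cylinder_eq, Set.disjoint_left]
  rintro _ ⟨a, ⟨ha, hw⟩, rfl⟩ ⟨b, ⟨hb, hv⟩, hab⟩
  have := S.limPt_injOn hb ha hab
  subst this
  exact h (funext fun k => (hw k).symm.trans (hv k))

/-- Two points of a long cylinder are both close to the image of ∞ under their common prefix. -/
lemma norm_sub_le_of_mem_cylinder {ε : ℝ} (hε : 0 < ε) :
    ∃ N : ℕ, ∀ m, N ≤ m → ∀ w : Fin m → Letter g, ∀ x ∈ S.cylinder w, ∀ y ∈ S.cylinder w,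
      ‖x - y‖ < ε := by
  obtain ⟨N, hN⟩ := S.exists_forall_err_lt (half_pos hε)
  refine ⟨N + 1, fun m hm w x hx y hy => ?_⟩
  rw [cylinder_eq] at hx hy
  obtain ⟨a, ⟨ha, haw⟩, rfl⟩ := hx
  obtain ⟨b, ⟨hb, hbw⟩, rfl⟩ := hy
  have e : pre a (N + 1) = pre b (N + 1) := pre_congr fun k hk => by
    rw [haw ⟨k, by omega⟩, hbw ⟨k, by omega⟩]
  have h1 := (S.norm_limPt_sub_le ha N).trans_lt (hN _ (by rw [ha.norm_pre]; omega))
  have h2 := (S.norm_limPt_sub_le hb N).trans_lt (hN _ (by rw [hb.norm_pre]; omega))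
  rw [← e, norm_sub_rev] at h2
  have := norm_sub_le_norm_sub_add_norm_sub (S.limPt a) (S.orbitPt (pre a (N + 1))) (S.limPt b)
  linarith

/-! ### The limit set -/

/-- Put wz = z in `mobius_sub_orbitPt`. In this form the product of the distances of a fixed point
to w∞ and w⁻¹∞ is |c|⁻². -/
lemma rep_smul_eq_self_iff {w : FreeGroup (Fin g)} (hw : w ≠ 1) {z : ℂ} :
    (S.rep w : GL (Fin 2) ℂ) • (z : OnePoint ℂ) = (z : OnePoint ℂ) ↔
      (z - S.orbitPt w) * (z - S.orbitPt w⁻¹) = -(S.lowerLeft w ^ 2)⁻¹ := by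
  have hc := S.lowerLeft_ne_zero hw
  rw [rep_smul_coe]
  constructor
  · intro h
    split_ifs at h with h0
    · exact absurd h.symm (OnePoint.coe_ne_infty z)
    · have h' : mobius (S.rep w) z = z := OnePoint.coe_injective h
      have hne : z ≠ S.orbitPt w⁻¹ := by
        rintro e
        apply h0
        rw [S.denom_eq hw, ← e, sub_self, mul_zero]
      have := S.mobius_sub_orbitPt hw hne
      have hz := sub_ne_zero.mpr hne
      rw [h'] at this
      rw [this]
      field_simp
  · intro h
    have hz : z - S.orbitPt w⁻¹ ≠ 0 := by
      intro e
      rw [e, mul_zero, eq_comm, neg_eq_zero, inv_eq_zero] at h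
      exact hc (pow_eq_zero_iff two_ne_zero |>.mp h)
    have hne := sub_ne_zero.mp hz
    rw [if_neg (S.denom_ne_zero hw hne)]
    have h1 := S.mobius_sub_orbitPt hw hne
    have h2 : z - S.orbitPt w = -(S.lowerLeft w ^ 2 * (z - S.orbitPt w⁻¹))⁻¹ := by
      rw [mul_inv, ← neg_mul, ← h, mul_inv_cancel_right₀ hz]
    congr 1
    linear_combination h1 - h2

lemma exists_limPt_near {w : FreeGroup (Fin g)} (hw : w ≠ 1) :
    ∃ a, IsRed a ∧ ‖S.limPt a - S.orbitPt w‖ ≤ S.err w := by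
  obtain ⟨b, L, hL, rfl, -⟩ := exists_cons hw
  obtain ⟨a, ha, h⟩ := exists_isRed_of_isReduced hL (List.cons_ne_nil _ _)
  refine ⟨a, ha, ?_⟩
  have : FreeGroup.mk (b :: L) = pre a (L.length + 1) := by
    rw [pre, ← List.length_cons (a := b), h]
  rw [this]
  exact S.norm_limPt_sub_le ha _

lemma isCompact_range_limPt : IsCompact (S.limPt '' {a | IsRed a}) := by
  have := isCompact_isRed (g := g) (m := 0) Fin.elim0
  simp only [IsEmpty.forall_iff, and_true] at this
  exact this.image_of_continuousOn S.continuousOn_limPt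

/-- The point is fixed by all powers of w. These are pairwise distinct, so some power v has tiny
`err`. Then z is close to v∞ or to v⁻¹∞, each of which is close to the limit point of an infinite
word, and the set of these limit points is closed. -/
lemma fixedPoint_mem {w : FreeGroup (Fin g)} (hw : w ≠ 1) {z : ℂ}
    (hz : (S.rep w : GL (Fin 2) ℂ) • (z : OnePoint ℂ) = (z : OnePoint ℂ)) :
    z ∈ S.limPt '' {a | IsRed a} := by
  rw [← S.isCompact_range_limPt.isClosed.closure_eq, Metric.mem_closure_iff]
  intro ε hε
  have hs := S.sep_pos
  have hfix : ∀ n : ℕ, (S.rep (w ^ n) : GL (Fin 2) ℂ) • (z : OnePoint ℂ) = (z : OnePoint ℂ) := by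
    intro n
    induction n with
    | zero => simp
    | succ n ih => rw [pow_succ, map_mul, map_mul, mul_smul, hz, ih]
  have hpow : Function.Injective fun n : ℕ => w ^ n :=
    injective_pow_iff_not_isOfFinOrder.mpr (not_isOfFinOrder_of_isMulTorsionFree hw)
  have hinj : Function.Injective fun n : ℕ => w ^ (n + 1) := fun m n h =>
    Nat.succ_injective (hpow h)
  -- The first bound controls the distance from the orbit point to a limit point, the second the
  -- product sep · err of the distances from z to v∞ and v⁻¹∞.
  have hη : 0 < min (ε / 2) ((ε / 2) ^ 2 / S.sep) := by positivity
  obtain ⟨n, hn⟩ : ∃ n : ℕ, S.err (w ^ (n + 1)) < min (ε / 2) ((ε / 2) ^ 2 / S.sep) := by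
    by_contra! h
    exact Set.infinite_range_of_injective hinj
      ((S.finite_le_err hη).subset (Set.range_subset_iff.mpr h))
  set v := w ^ (n + 1) with hv
  have hv1 : v ≠ 1 := by
    rw [hv]
    intro e
    exact absurd (hpow (e.trans (pow_zero w).symm)) (Nat.succ_ne_zero n)
  have h1 := congrArg norm ((S.rep_smul_eq_self_iff hv1).mp (hfix (n + 1)))
  have hc := norm_pos_iff.mpr (S.lowerLeft_ne_zero hv1)
  have h2 : (‖S.lowerLeft v‖ ^ 2)⁻¹ = S.sep * S.err v := by
    rw [err]; field_simp
  rw [norm_mul, norm_neg, norm_inv, norm_pow, h2] at h1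
  have h3 : S.sep * S.err v < (ε / 2) ^ 2 := by
    have := hn.trans_le (min_le_right _ _)
    rwa [lt_div_iff₀ hs, mul_comm] at this
  have key : ∀ u : FreeGroup (Fin g), u ≠ 1 → S.err u < ε / 2 → ‖z - S.orbitPt u‖ < ε / 2 →
      ∃ b ∈ S.limPt '' {a | IsRed a}, dist z b < ε := by
    intro u hu h4 h5
    obtain ⟨a, ha, h6⟩ := S.exists_limPt_near hu
    refine ⟨_, ⟨a, ha, rfl⟩, ?_⟩
    rw [norm_sub_rev] at h6
    rw [dist_eq_norm]
    have := norm_sub_le_norm_sub_add_norm_sub z (S.orbitPt u) (S.limPt a)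
    linarith
  have h7 := hn.trans_le (min_le_left _ _)
  by_cases h : ‖z - S.orbitPt v‖ < ε / 2
  · exact key v hv1 h7 h
  · refine key v⁻¹ (inv_ne_one.mpr hv1) (by rwa [err_inv]) ?_
    by_contra h'
    rw [not_lt] at h h'
    nlinarith

/-- Solve the quadratic fixed point equation with p = v∞ and q = v⁻¹∞. The numbers t ± (p - q)/2
have product of modulus sep · err and moduli adding up to at least sep. One is therefore at least
sep/2, and the other, which is up to sign the distance of a root to p, is at most 2 · err. -/
lemma exists_fixedPoint_near {v : FreeGroup (Fin g)} (hv : v ≠ 1)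
    (h : S.sep ≤ ‖S.orbitPt v - S.orbitPt v⁻¹‖) :
    ∃ z : ℂ, (S.rep v : GL (Fin 2) ℂ) • (z : OnePoint ℂ) = (z : OnePoint ℂ) ∧
      ‖z - S.orbitPt v‖ ≤ 2 * S.err v := by
  set p := S.orbitPt v
  set q := S.orbitPt v⁻¹
  have hs := S.sep_pos
  have hc := norm_pos_iff.mpr (S.lowerLeft_ne_zero hv)
  obtain ⟨t, ht⟩ := IsAlgClosed.exists_pow_nat_eq (((p - q) / 2) ^ 2 - (S.lowerLeft v ^ 2)⁻¹)
    (n := 2) two_pos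
  have hprod : (t - (p - q) / 2) * (t + (p - q) / 2) = -(S.lowerLeft v ^ 2)⁻¹ := by
    linear_combination ht
  have h2 : (‖S.lowerLeft v‖ ^ 2)⁻¹ = S.sep * S.err v := by
    rw [err]; field_simp
  have hn := congrArg norm hprod
  rw [norm_mul, norm_neg, norm_inv, norm_pow, h2] at hn
  have htri : S.sep ≤ ‖t + (p - q) / 2‖ + ‖t - (p - q) / 2‖ := by
    have := norm_sub_le (t + (p - q) / 2) (t - (p - q) / 2)
    rw [show t + (p - q) / 2 - (t - (p - q) / 2) = p - q by ring] at this
    linarith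
  have he := S.err_nonneg v
  rcases le_total (S.sep / 2) ‖t + (p - q) / 2‖ with h1 | h1
  · refine ⟨(p + q) / 2 + t, (S.rep_smul_eq_self_iff hv).mpr ?_, ?_⟩
    · rw [← hprod]; ring
    · rw [show (p + q) / 2 + t - p = t - (p - q) / 2 by ring]
      by_contra hlt
      rw [not_le] at hlt
      nlinarith [norm_nonneg (t - (p - q) / 2)]
  · refine ⟨(p + q) / 2 - t, (S.rep_smul_eq_self_iff hv).mpr ?_, ?_⟩
    · rw [← hprod]; ring
    · rw [show (p + q) / 2 - t - p = -(t + (p - q) / 2) by ring, norm_neg]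
      have h3 : S.sep / 2 ≤ ‖t - (p - q) / 2‖ := by linarith
      by_contra hlt
      rw [not_le] at hlt
      nlinarith [norm_nonneg (t + (p - q) / 2)]

lemma limPt_mem_limitSet (hg : 2 ≤ g) {a : ℕ → Letter g} (ha : IsRed a) :
    S.limPt a ∈ S.limitSet := by
  rw [limitSet, Metric.mem_closure_iff]
  intro ε hε
  -- The triangle inequality below costs one `err` for the limit point, one for the appended letter
  -- and two for the fixed point.
  have hε4 : 0 < ε / 4 := by positivity
  obtain ⟨N, hN⟩ := S.exists_forall_err_lt hε4
  -- For v = a_0 ⋯ a_N b, the condition b ≠ a_N⁻¹ keeps v reduced, and b ≠ a_0⁻¹ puts v∞ and v⁻¹∞ in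
  -- the discs of two different letters, as `exists_fixedPoint_near` requires.
  obtain ⟨b, hb1, hb2⟩ := exists_ne_ne hg (a N).inv (a 0).inv
  let a' : ℕ → Letter g := fun k => if k ≤ N then a k else b
  have ha' : IsRed a' := by
    intro k
    simp only [a']
    by_cases h1 : k + 1 ≤ N
    · rw [if_pos h1, if_pos (by omega)]
      exact ha k
    · rw [if_neg h1]
      by_cases h2 : k ≤ N
      · rw [if_pos h2, show k = N by omega]
        exact hb1
      · rw [if_neg h2]
        exact (Letter.inv_ne b).symm
  have hpre : pre a' (N + 1) = pre a (N + 1) := pre_congr fun k hk => if_pos (by omega)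
  have h1 := S.norm_orbitPt_pre_sub_le ha' N 1
  have h2 := S.norm_limPt_sub_le ha N
  have h3 := hN (pre a (N + 1)) (by rw [ha.norm_pre]; omega)
  have h4 := hN (pre a' (N + 1 + 1)) (by rw [ha'.norm_pre]; omega)
  rw [hpre] at h1
  obtain ⟨z, hz, hz'⟩ := S.exists_fixedPoint_near (ha'.pre_succ_ne_one (N + 1)) (by
    refine S.sep_le (a := (a 0).inv) (b := b) hb2.symm (subset_closure ?_) (subset_closure ?_)
    · exact S.orbitPt_pre_mem ha' (N + 1)
    · have := S.orbitPt_pre_inv_mem ha' (N + 1)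
      simpa [a'] using this)
  refine ⟨z, ⟨_, ha'.pre_succ_ne_one (N + 1), hz⟩, ?_⟩
  rw [dist_eq_norm]
  rw [norm_sub_rev] at hz' h1
  have h5 := norm_sub_le_norm_sub_add_norm_sub (S.limPt a) (S.orbitPt (pre a (N + 1))) z
  have h6 := norm_sub_le_norm_sub_add_norm_sub (S.orbitPt (pre a (N + 1)))
    (S.orbitPt (pre a' (N + 1 + 1))) z
  linarith

lemma limitSet_eq (hg : 2 ≤ g) : S.limitSet = S.limPt '' {a | IsRed a} := by
  refine Set.Subset.antisymm ?_ ?_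
  · refine closure_minimal ?_ S.isCompact_range_limPt.isClosed
    rintro z ⟨w, hw, hz⟩
    exact S.fixedPoint_mem hw hz
  · rintro _ ⟨a, ha, rfl⟩
    exact S.limPt_mem_limitSet hg ha

lemma cylinder_zero (hg : 2 ≤ g) (w : Fin 0 → Letter g) : S.cylinder w = S.limitSet := by
  rw [cylinder_eq, S.limitSet_eq hg]
  simp

lemma cylinder_subset_limitSet (hg : 2 ≤ g) {m : ℕ} (w : Fin m → Letter g) :
    S.cylinder w ⊆ S.limitSet := by
  rw [cylinder_eq, S.limitSet_eq hg]
  exact Set.image_mono fun a ha => ha.1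

/-- A cylinder is the disjoint union of the cylinders of the words longer by one letter. -/
lemma cylinder_eq_iUnion {m : ℕ} (w : Fin m → Letter g) :
    S.cylinder w = ⋃ b, S.cylinder (Fin.snoc w b : Fin (m + 1) → Letter g) := by
  simp only [cylinder_eq, ← Set.image_iUnion]
  congr 1
  ext a
  simp only [Set.mem_ofPred_eq, Set.mem_iUnion, exists_and_left, and_congr_right_iff]
  intro _
  constructor
  · intro h
    refine ⟨a m, fun k => ?_⟩
    refine Fin.lastCases ?_ (fun k => ?_) k
    · simp
    · simpa using h k
  · rintro ⟨b, h⟩ k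
    simpa using h k.castSucc

/-- The action of a letter on cylinders. -/
lemma cylinder_cons {m : ℕ} (a : Letter g) (w : Fin (m + 1) → Letter g) (h : w 0 ≠ a.inv) :
    S.cylinder (Fin.cons a w : Fin (m + 2) → Letter g) = mobius (S.letter a) '' S.cylinder w := by
  rw [cylinder_eq, cylinder_eq]
  ext x
  constructor
  · rintro ⟨b, ⟨hb, hbw⟩, rfl⟩
    have h0 : b 0 = a := hbw 0
    refine ⟨_, ⟨fun k => b (1 + k), ⟨hb.shift 1, fun k => ?_⟩, rfl⟩, ?_⟩
    · have := hbw k.succ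
      rw [Fin.cons_succ, Fin.val_succ] at this
      beta_reduce
      rw [add_comm 1, this]
    · rw [← h0]; exact (S.limPt_eq_mobius hb).symm
  · rintro ⟨_, ⟨b, ⟨hb, hbw⟩, rfl⟩, rfl⟩
    let c : ℕ → Letter g := fun k => Nat.casesOn k a b
    have hc : IsRed c := by
      intro k
      rcases k with _ | k
      · change b 0 ≠ a.inv
        have := hbw 0
        rw [Fin.val_zero] at this
        rwa [this]
      · exact hb k
    have e : (fun k => c (1 + k)) = b := by
      ext1 k; rw [add_comm]
    refine ⟨c, ⟨hc, fun k => ?_⟩, ?_⟩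
    · refine Fin.cases ?_ (fun k => ?_) k
      · rfl
      · rw [Fin.cons_succ, Fin.val_succ]; exact hbw k
    · rw [S.limPt_eq_mobius hc, e]
      rfl

end SchottkyGroup

/-! ### Weighted composition operators -/

section WeightedComp

variable {α : Type*} [MeasurableSpace α] {μ : Measure α} {φ : α → α} {J : α → ℝ} {A : Set α}

/-- The hypothesis says that the image of J²μ|_A under φ is at most μ, so preimages of null sets are
null wherever J ≠ 0. This makes J · (f ∘ φ) independent of the representative of f. -/
lemma ae_comp_of_ae (hφ : Measurable φ) (hJ : Measurable J) (hA : MeasurableSet A)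
    (h : ∀ F, MeasurableSet F → ∫⁻ x in A ∩ φ ⁻¹' F, ENNReal.ofReal (J x ^ 2) ∂μ ≤ μ F)
    {p : α → Prop} (hp : ∀ᵐ x ∂μ, p x) : ∀ᵐ x ∂μ, x ∈ A → J x ≠ 0 → p (φ x) := by
  obtain ⟨F, hFp, hF, hF0⟩ := exists_measurable_superset_of_null (ae_iff.mp hp)
  have h1 := h F hF
  rw [hF0, nonpos_iff_eq_zero, lintegral_eq_zero_iff (by fun_prop)] at h1
  have h2 := (ae_restrict_iff' (hA.inter (hφ hF))).mp h1
  filter_upwards [h2] with x hx hxA hJx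
  by_contra hpx
  have := hx ⟨hxA, hFp hpx⟩
  simp only [Pi.zero_apply, ENNReal.ofReal_eq_zero] at this
  exact hJx (pow_eq_zero_iff two_ne_zero |>.mp (le_antisymm this (sq_nonneg _)))

lemma lintegral_comp_le (hφ : Measurable φ) (hJ : Measurable J)
    (h : ∀ F, MeasurableSet F → ∫⁻ x in A ∩ φ ⁻¹' F, ENNReal.ofReal (J x ^ 2) ∂μ ≤ μ F)
    {k : α → ENNReal} (hk : Measurable k) :
    ∫⁻ x in A, ENNReal.ofReal (J x ^ 2) * k (φ x) ∂μ ≤ ∫⁻ x, k x ∂μ := by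
  have hJ2 : Measurable fun x => ENNReal.ofReal (J x ^ 2) := by fun_prop
  set ν := (μ.restrict A).withDensity fun x => ENNReal.ofReal (J x ^ 2) with hν
  have hle : ν.map φ ≤ μ := by
    refine Measure.le_iff.mpr fun F hF => ?_
    rw [Measure.map_apply hφ hF, hν, withDensity_apply _ (hφ hF), Measure.restrict_restrict (hφ hF),
      Set.inter_comm]
    exact h F hF
  calc ∫⁻ x in A, ENNReal.ofReal (J x ^ 2) * k (φ x) ∂μ = ∫⁻ x, k (φ x) ∂ν := by
        rw [hν, lintegral_withDensity_eq_lintegral_mul _ hJ2 (g := fun x => k (φ x)) (hk.comp hφ)]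
        rfl
    _ = ∫⁻ x, k x ∂ν.map φ := (lintegral_map hk hφ).symm
    _ ≤ _ := lintegral_mono' hle le_rfl

/-- The operator `f ↦ 1_A · J · (f ∘ φ)` is a contraction of `L²` if the image of the measure
`J² μ|_A` under `φ` is at most `μ`. -/
theorem exists_weightedComp (hφ : Measurable φ) (hJ : Measurable J) (hA : MeasurableSet A)
    (h : ∀ F, MeasurableSet F → ∫⁻ x in A ∩ φ ⁻¹' F, ENNReal.ofReal (J x ^ 2) ∂μ ≤ μ F) :
    ∃ T : Lp ℂ 2 μ →L[ℂ] Lp ℂ 2 μ,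
      (∀ f, (T f : α → ℂ) =ᵐ[μ] A.indicator fun x => (J x : ℂ) * f (φ x)) ∧ ∀ f, ‖T f‖ ≤ ‖f‖ := by
  have hmeas : ∀ f : Lp ℂ 2 μ, StronglyMeasurable (A.indicator fun x => (J x : ℂ) * f (φ x)) :=
    fun f => (((Complex.measurable_ofReal.comp hJ).stronglyMeasurable).mul
      ((Lp.stronglyMeasurable f).comp_measurable hφ)).indicator hA
  have hnorm : ∀ f : Lp ℂ 2 μ,
      eLpNorm (A.indicator fun x => (J x : ℂ) * f (φ x)) 2 μ ≤ eLpNorm f 2 μ := by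
    intro f
    rw [eLpNorm_indicator_eq_eLpNorm_restrict hA,
      eLpNorm_eq_lintegral_rpow_enorm_toReal two_ne_zero ENNReal.ofNat_ne_top,
      eLpNorm_eq_lintegral_rpow_enorm_toReal two_ne_zero ENNReal.ofNat_ne_top]
    refine ENNReal.rpow_le_rpow ?_ (by simp)
    have := lintegral_comp_le hφ hJ h (k := fun x => ‖f x‖ₑ ^ (2 : ENNReal).toReal)
      ((Lp.stronglyMeasurable f).measurable.enorm.pow_const _)
    refine le_trans (le_of_eq ?_) this
    refine lintegral_congr fun x => ?_
    simp only [ENNReal.toReal_ofNat, ENNReal.rpow_ofNat, enorm_mul, mul_pow]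
    congr 1
    rw [← ofReal_norm, ← ENNReal.ofReal_pow (norm_nonneg _), Complex.norm_real, Real.norm_eq_abs,
      sq_abs]
  have hmem : ∀ f : Lp ℂ 2 μ, MemLp (A.indicator fun x => (J x : ℂ) * f (φ x)) 2 μ := fun f =>
    ⟨(hmeas f).aestronglyMeasurable, (hnorm f).trans_lt (Lp.eLpNorm_lt_top f)⟩
  have hcoe : ∀ f, ((hmem f).toLp _ : α → ℂ) =ᵐ[μ] A.indicator fun x => (J x : ℂ) * f (φ x) :=
    fun f => (hmem f).coeFn_toLp
  let T : Lp ℂ 2 μ →ₗ[ℂ] Lp ℂ 2 μ :=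
    { toFun := fun f => (hmem f).toLp _
      map_add' := by
        intro f k
        refine Lp.ext ?_
        filter_upwards [hcoe (f + k), hcoe f, hcoe k, Lp.coeFn_add ((hmem f).toLp _)
          ((hmem k).toLp _), ae_comp_of_ae hφ hJ hA h (Lp.coeFn_add f k)] with x h1 h2 h3 h4 h5
        rw [h1, h4, Pi.add_apply, h2, h3]
        by_cases hx : x ∈ A
        · simp only [Set.indicator_of_mem hx]
          by_cases hJx : J x = 0
          · simp [hJx]
          · rw [h5 hx hJx, Pi.add_apply]; ring
        · simp [Set.indicator_of_notMem hx]
      map_smul' := by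
        intro c f
        refine Lp.ext ?_
        filter_upwards [hcoe (c • f), hcoe f, Lp.coeFn_smul c ((hmem f).toLp _),
          ae_comp_of_ae hφ hJ hA h (Lp.coeFn_smul c f)] with x h1 h2 h3 h5
        rw [h1, RingHom.id_apply, h3, Pi.smul_apply, h2]
        by_cases hx : x ∈ A
        · simp only [Set.indicator_of_mem hx]
          by_cases hJx : J x = 0
          · simp [hJx]
          · rw [h5 hx hJx, Pi.smul_apply, smul_eq_mul, smul_eq_mul]; ring
        · simp [Set.indicator_of_notMem hx] }
  have hT : ∀ f, ‖T f‖ ≤ 1 * ‖f‖ := by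
    intro f
    rw [one_mul]
    change ‖(hmem f).toLp _‖ ≤ ‖f‖
    rw [Lp.norm_toLp, Lp.norm_def]
    exact ENNReal.toReal_mono (Lp.eLpNorm_ne_top f) (hnorm f)
  exact ⟨T.mkContinuous 1 hT, hcoe, fun f => by simpa using hT f⟩

end WeightedComp

/-- Two contractions that are inverse to each other between the ranges of the projections `S R`
and `R S` are adjoint to each other. -/
lemma star_eq_of_contraction {H : Type*} [NormedAddCommGroup H] [InnerProductSpace ℂ H]
    [CompleteSpace H] {S R : H →L[ℂ] H} (hS : ∀ x, ‖S x‖ ≤ ‖x‖) (hR : ∀ x, ‖R x‖ ≤ ‖x‖)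
    (hp : IsSelfAdjoint (S * R)) (hSR : S * R * S = S) (hRS : R * S * R = R)
    (hq : IsSelfAdjoint (R * S)) : star S = R := by
  set p := S * R with hpdef
  have hpp : p * p = p := by rw [hpdef, ← mul_assoc, hSR]
  have hRp : R * p = R := by rw [hpdef, ← mul_assoc, hRS]
  -- Both inequalities come from contractions: R = Rp, and p = SR.
  have hnorm : ∀ x, ‖R x‖ = ‖p x‖ := by
    intro x
    refine le_antisymm ?_ (hS (R x))
    calc ‖R x‖ = ‖R (p x)‖ := by rw [← mul_apply_eq_comp, hRp]
      _ ≤ _ := hR _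
  -- Over ℂ an operator is determined by its quadratic form, and both forms equal ‖R x‖².
  have h1 : star R * R = p := by
    have h : ((star R * R - p : H →L[ℂ] H) : H →ₗ[ℂ] H) = 0 := by
      rw [← inner_map_self_eq_zero]
      intro x
      change inner ℂ ((star R * R - p) x) x = 0
      rw [sub_apply, inner_sub_left, sub_eq_zero, mul_apply_eq_comp,
        ContinuousLinearMap.star_eq_adjoint, ContinuousLinearMap.adjoint_inner_left,
        inner_self_eq_norm_sq_to_K, hnorm, ← inner_self_eq_norm_sq_to_K,
        ← ContinuousLinearMap.adjoint_inner_left, ← ContinuousLinearMap.star_eq_adjoint,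
        ← mul_apply_eq_comp, hp.star_eq, hpp]
    exact sub_eq_zero.mp (ContinuousLinearMap.coe_injective h)
  have h2 : star R = S := by
    calc star R = star (R * S * R) := by rw [hRS]
      _ = star R * (R * S) := by rw [star_mul, hq.star_eq]
      _ = p * S := by rw [← mul_assoc, h1]
      _ = S := hSR
  rw [← h2, star_star]

namespace SchottkyGroup

variable {g : ℕ} (S : SchottkyGroup g) {μ : Measure ℂ}

/-! ### Positivity of the Patterson–Sullivan measure on cylinders -/

lemma measurableSet_cylinder {m : ℕ} (w : Fin m → Letter g) : MeasurableSet (S.cylinder w) :=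
  (S.isCompact_cylinder w).measurableSet

lemma measurable_mobius (A : SL(2, ℂ)) : Measurable (mobius A) := by
  unfold mobius; fun_prop

lemma measurable_absDeriv (A : SL(2, ℂ)) : Measurable (absDeriv A) := by
  unfold absDeriv; fun_prop

lemma absDeriv_pos {A : SL(2, ℂ)} {z : ℂ} (h : A.1 1 0 * z + A.1 1 1 ≠ 0) : 0 < absDeriv A z := by
  unfold absDeriv; positivity

lemma limitSet_disc {m : ℕ} {w : Fin (m + 1) → Letter g} {x : ℂ} (hx : x ∈ S.cylinder w) :
    x ∈ closure (S.disc (w 0).inv) := by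
  rw [cylinder_eq] at hx
  obtain ⟨a, ⟨ha, h⟩, rfl⟩ := hx
  have h0 := h 0
  rw [Fin.val_zero] at h0
  rw [← h0]
  exact S.limPt_mem ha

/-- By conformality the mass of the image is the integral of a strictly positive density over E. -/
lemma measure_mobius_image_pos (hμ : S.IsPattersonSullivan μ) (a : Letter g) {E : Set ℂ}
    (hE : MeasurableSet E) (hEΛ : E ⊆ S.limitSet)
    (hd : ∀ z ∈ E, (S.letter a).1 1 0 * z + (S.letter a).1 1 1 ≠ 0) (hpos : 0 < μ E) :
    0 < μ (mobius (S.letter a) '' E) := by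
  have := hμ.conformal (FreeGroup.mk [a]) E hE hEΛ
  change μ (mobius (S.letter a) '' E) = _ at this
  rw [this, pos_iff_ne_zero, Ne, lintegral_eq_zero_iff
    (((measurable_absDeriv _).pow_const _).ennreal_ofReal)]
  intro h
  have h2 := (ae_restrict_iff' hE).mp h
  have h3 : ∀ᵐ x ∂μ, x ∉ E := by
    filter_upwards [h2] with x hx hxE
    have := hx hxE
    simp only [Pi.zero_apply, ENNReal.ofReal_eq_zero] at this
    exact absurd this (not_le.mpr (Real.rpow_pos_of_pos (absDeriv_pos (hd x hxE)) _))
  rw [ae_iff] at h3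
  simp only [not_not] at h3
  exact hpos.ne' h3

/-- Cylinders of reduced words have positive measure. -/
lemma measure_cylinder_pos (hg : 2 ≤ g) (hμ : S.IsPattersonSullivan μ) {a : ℕ → Letter g}
    (ha : IsRed a) (m : ℕ) : 0 < μ (S.cylinder fun k : Fin m => a k) := by
  have hstep : ∀ (b : Letter g) (m : ℕ) (w : Fin (m + 1) → Letter g), w 0 ≠ b.inv →
      0 < μ (S.cylinder w) → 0 < μ (S.cylinder (Fin.cons b w : Fin (m + 2) → Letter g)) := by
    intro b m w h hpos
    rw [S.cylinder_cons b w h]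
    refine S.measure_mobius_image_pos hμ b (S.measurableSet_cylinder w)
      (S.cylinder_subset_limitSet hg w) (fun z hz => ?_) hpos
    exact S.letter_denom_ne_zero (fun e => h (Letter.inv_eq_iff.mp e)) (S.limitSet_disc hz)
  have h0 : ∀ w : Fin 0 → Letter g, 0 < μ (S.cylinder w) := by
    intro w
    rw [S.cylinder_zero hg, pos_iff_ne_zero]
    intro h
    apply hμ.ne_zero
    rw [← Measure.measure_univ_eq_zero, ← Set.union_compl_self S.limitSet]
    exact measure_union_null h hμ.carried
  have hsub : ∀ b c : Letter g, S.cylinder (Fin.cons b (powWord 1 c) : Fin 2 → Letter g) ⊆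
      S.cylinder (powWord 1 b) := by
    intro b c
    rw [cylinder_eq, cylinder_eq]
    refine Set.image_mono fun x hx => ⟨hx.1, fun k => ?_⟩
    have := hx.2 0
    rw [Subsingleton.elim k 0]
    exact this
  have hone : ∀ b c : Letter g, c ≠ b.inv → 0 < μ (S.cylinder (powWord 1 c)) →
      0 < μ (S.cylinder (powWord 1 b)) := fun b c h hpos =>
    (hstep b 0 (powWord 1 c) h hpos).trans_le (measure_mono (hsub b c))
  -- The limit set carries positive mass and is the union of the one-letter cylinders.
  have hex : ∃ b, 0 < μ (S.cylinder (powWord 1 b)) := by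
    by_contra! hno
    have := h0 Fin.elim0
    rw [S.cylinder_eq_iUnion] at this
    refine this.ne' (measure_iUnion_null fun b => ?_)
    have e : (Fin.snoc Fin.elim0 b : Fin 1 → Letter g) = powWord 1 b := by
      ext1 k; rw [Subsingleton.elim (α := Fin 1) k (Fin.last 0), Fin.snoc_last]; rfl
    have := hno b
    rw [← e] at this
    exact nonpos_iff_eq_zero.mp this
  obtain ⟨b, hb⟩ := hex
  have hall : ∀ c, 0 < μ (S.cylinder (powWord 1 c)) := by
    intro c
    -- Positivity passes from b to c through a letter d for which both db and cd are reduced.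
    obtain ⟨d, hd1, hd2⟩ := exists_ne_ne hg b.inv c.inv
    exact hone c d hd2 (hone d b (fun e => hd1 (by rw [e, Letter.inv_inv])) hb)
  have main : ∀ m, ∀ a : ℕ → Letter g, IsRed a → 0 < μ (S.cylinder fun k : Fin (m + 1) => a k) := by
    intro m
    induction m with
    | zero =>
      intro a ha
      have e : (fun k : Fin 1 => a k) = powWord 1 (a 0) := by
        ext1 k; rw [Subsingleton.elim k 0]; rfl
      rw [e]
      exact hall _
    | succ m ih =>
      intro a ha
      have := hstep (a 0) m (fun k => a (k + 1)) (by simpa using ha 0)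
        (by simpa [add_comm] using ih _ (ha.shift 1))
      convert this using 3
      ext1 k
      refine Fin.cases ?_ (fun k => ?_) k <;> simp
  rcases m with _ | m
  · exact h0 _
  · exact main m a ha

/-! ### The Cuntz–Krieger generators -/

lemma letter_inv (a : Letter g) : (S.letter a)⁻¹ = S.letter a.inv := by
  rw [letter, letter, ← map_inv, mk_singleton_inv]

/-- `|a'|^{δ/2}`. -/
def jac (a : Letter g) (x : ℂ) : ℝ :=
  absDeriv (S.letter a) x ^ ((dimH S.limitSet).toReal / 2)

lemma measurable_jac (a : Letter g) : Measurable (S.jac a) :=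
  (measurable_absDeriv _).pow_const _

lemma jac_sq (a : Letter g) (x : ℂ) :
    S.jac a x ^ 2 = absDeriv (S.letter a) x ^ (dimH S.limitSet).toReal := by
  rw [jac, ← Real.rpow_natCast, ← Real.rpow_mul (by unfold absDeriv; positivity)]
  congr 1
  push_cast
  ring

/-- By conformality the left side is the mass of the image of the set, and that image lies in F.
This is the hypothesis of `exists_weightedComp`. -/
lemma setLIntegral_jac_le (hμ : S.IsPattersonSullivan μ) (a : Letter g) {A : Set ℂ}
    (hA : MeasurableSet A) (hAΛ : A ⊆ S.limitSet) (F : Set ℂ) (hF : MeasurableSet F) :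
    ∫⁻ x in A ∩ mobius (S.letter a) ⁻¹' F, ENNReal.ofReal (S.jac a x ^ 2) ∂μ ≤ μ F := by
  have h := hμ.conformal (FreeGroup.mk [a]) (A ∩ mobius (S.letter a) ⁻¹' F)
    (hA.inter (measurable_mobius _ hF)) (Set.inter_subset_left.trans hAΛ)
  simp only [jac_sq]
  refine (le_of_eq h.symm).trans (measure_mono ?_)
  rintro _ ⟨x, hx, rfl⟩
  exact hx.2

/-- The complement of the cylinder of `a⁻¹` in the limit set. -/
def coCylinder (a : Letter g) : Set ℂ := mobius (S.letter a.inv) '' S.cylinder (powWord 1 a)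

/-- Applying a⁻¹ strips the first letter a, and what may follow a is any reduced word not starting
with a⁻¹. -/
lemma mem_coCylinder_iff (a : Letter g) (x : ℂ) : x ∈ S.coCylinder a ↔
    ∃ b, IsRed b ∧ b 0 ≠ a.inv ∧ S.limPt b = x := by
  rw [coCylinder, cylinder_eq]
  constructor
  · rintro ⟨_, ⟨b, ⟨hb, h⟩, rfl⟩, rfl⟩
    have h0 : b 0 = a := h 0
    refine ⟨_, hb.shift 1, ?_, ?_⟩
    · rw [← h0]; exact hb 0
    · rw [S.limPt_tail_eq_mobius hb, h0]
  · rintro ⟨b, hb, h0, rfl⟩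
    let c : ℕ → Letter g := fun k => Nat.casesOn k a b
    have hc : IsRed c := by
      intro k
      rcases k with _ | k
      · exact h0
      · exact hb k
    have e : (fun k => c (1 + k)) = b := by
      ext1 k; rw [add_comm]
    refine ⟨_, ⟨c, ⟨hc, fun k => ?_⟩, rfl⟩, ?_⟩
    · rw [Subsingleton.elim k 0]; rfl
    · have := S.limPt_tail_eq_mobius hc
      rw [e] at this
      exact this.symm

lemma denom_coCylinder {a : Letter g} {x : ℂ} (hx : x ∈ S.coCylinder a) :
    (S.letter a).1 1 0 * x + (S.letter a).1 1 1 ≠ 0 := by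
  obtain ⟨b, hb, h0, rfl⟩ := (S.mem_coCylinder_iff a x).mp hx
  exact S.letter_denom_ne_zero (fun e => h0 (Letter.inv_eq_iff.mp e)) (S.limPt_mem hb)

lemma denom_inv_mobius {w : FreeGroup (Fin g)} {z : ℂ}
    (hz : (S.rep w).1 1 0 * z + (S.rep w).1 1 1 ≠ 0) :
    (S.rep w⁻¹).1 1 0 * mobius (S.rep w) z + (S.rep w⁻¹).1 1 1 =
      ((S.rep w).1 1 0 * z + (S.rep w).1 1 1)⁻¹ := by
  obtain ⟨-, -, h1, h2⟩ := S.rep_inv_apply w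
  rw [h1, h2, mobius]
  field_simp
  linear_combination S.rep_det w

lemma letter_inv_denom {a : Letter g} {z : ℂ}
    (hz : (S.letter a).1 1 0 * z + (S.letter a).1 1 1 ≠ 0) :
    (S.letter a.inv).1 1 0 * mobius (S.letter a) z + (S.letter a.inv).1 1 1 =
      ((S.letter a).1 1 0 * z + (S.letter a).1 1 1)⁻¹ := by
  have := S.denom_inv_mobius hz
  rwa [mk_singleton_inv] at this

lemma letter_inv_mobius {a : Letter g} {z : ℂ}
    (hz : (S.letter a).1 1 0 * z + (S.letter a).1 1 1 ≠ 0) :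
    mobius (S.letter a.inv) (mobius (S.letter a) z) = z := by
  have := S.mobius_inv_mobius hz
  rwa [mk_singleton_inv] at this

/-- The chain rule for a⁻¹ ∘ a, raised to the power δ/2. -/
lemma jac_mul_jac {a : Letter g} {z : ℂ}
    (hz : (S.letter a).1 1 0 * z + (S.letter a).1 1 1 ≠ 0) :
    S.jac a z * S.jac a.inv (mobius (S.letter a) z) = 1 := by
  have h := absDeriv_pos hz
  have e : absDeriv (S.letter a.inv) (mobius (S.letter a) z) = (absDeriv (S.letter a) z)⁻¹ := by
    rw [absDeriv, S.letter_inv_denom hz, absDeriv, norm_inv, inv_pow]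
  rw [jac, jac, e, ← Real.mul_rpow h.le (inv_nonneg.mpr h.le), mul_inv_cancel₀ h.ne',
    Real.one_rpow]

lemma mobius_mem_coCylinder {a : Letter g} {x : ℂ} (hx : x ∈ S.cylinder (powWord 1 a)) :
    mobius (S.letter a.inv) x ∈ S.coCylinder a := ⟨x, hx, rfl⟩

lemma exists_eq_mobius {a : Letter g} {x : ℂ} (hx : x ∈ S.cylinder (powWord 1 a)) :
    ∃ y, (S.letter a).1 1 0 * y + (S.letter a).1 1 1 ≠ 0 ∧ mobius (S.letter a) y = x := by
  rw [cylinder_eq] at hx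
  obtain ⟨b, ⟨hb, h⟩, rfl⟩ := hx
  have h0 : b 0 = a := h 0
  refine ⟨S.limPt fun k => b (1 + k), ?_, ?_⟩
  · rw [← h0]; exact S.limPt_tail_denom_ne_zero hb
  · rw [← h0]; exact (S.limPt_eq_mobius hb).symm

lemma denom_cylinder {a : Letter g} {x : ℂ} (hx : x ∈ S.cylinder (powWord 1 a)) :
    (S.letter a.inv).1 1 0 * x + (S.letter a.inv).1 1 1 ≠ 0 := by
  obtain ⟨y, hy, rfl⟩ := S.exists_eq_mobius hx
  rw [S.letter_inv_denom hy]
  exact inv_ne_zero hy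

lemma mobius_mem_cylinder {a : Letter g} {x : ℂ} (hx : x ∈ S.coCylinder a) :
    mobius (S.letter a) x ∈ S.cylinder (powWord 1 a) := by
  obtain ⟨y, hy, rfl⟩ := hx
  have := S.letter_inv_mobius (S.denom_cylinder hy)
  rw [Letter.inv_inv] at this
  rwa [this]

lemma coCylinder_eq (a : Letter g) :
    S.coCylinder a = ⋃ b, ⋃ (_ : b ≠ a.inv), S.cylinder (powWord 1 b) := by
  ext x
  simp only [mem_coCylinder_iff, Set.mem_iUnion, cylinder_eq]
  constructor
  · rintro ⟨b, hb, h, rfl⟩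
    refine ⟨b 0, h, b, ⟨hb, fun k => ?_⟩, rfl⟩
    rw [Subsingleton.elim k 0]; rfl
  · rintro ⟨c, hc, b, ⟨hb, h⟩, rfl⟩
    have h0 : b 0 = c := h 0
    exact ⟨b, hb, h0 ▸ hc, rfl⟩

lemma measurableSet_coCylinder (a : Letter g) : MeasurableSet (S.coCylinder a) := by
  rw [coCylinder_eq]
  exact MeasurableSet.iUnion fun b => MeasurableSet.iUnion fun _ => S.measurableSet_cylinder _

lemma coCylinder_subset (hg : 2 ≤ g) (a : Letter g) : S.coCylinder a ⊆ S.limitSet := by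
  rw [coCylinder_eq]
  exact Set.iUnion_subset fun b => Set.iUnion_subset fun _ => S.cylinder_subset_limitSet hg _

lemma mem_cylinder_powWord_succ {a : Letter g} {x : ℂ} (hx : x ∈ S.cylinder (powWord 1 a))
    (n : ℕ) : x ∈ S.cylinder (powWord (n + 1) a) ↔
      mobius (S.letter a.inv) x ∈ S.cylinder (powWord n a) := by
  rw [cylinder_eq] at hx
  obtain ⟨b, ⟨hb, h⟩, rfl⟩ := hx
  have h0 : b 0 = a := h 0
  have e := S.limPt_tail_eq_mobius hb
  rw [h0] at e
  rw [← e, cylinder_eq, cylinder_eq]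
  constructor
  · rintro ⟨c, ⟨hc, hca⟩, hcb⟩
    have := S.limPt_injOn hc hb hcb
    subst this
    refine ⟨_, ⟨hc.shift 1, fun k => ?_⟩, rfl⟩
    have := hca k.succ
    rw [Fin.val_succ] at this
    rw [add_comm 1, this]; rfl
  · rintro ⟨c, ⟨hc, hca⟩, hcb⟩
    have := S.limPt_injOn hc (hb.shift 1) hcb
    subst this
    refine ⟨b, ⟨hb, fun k => ?_⟩, rfl⟩
    refine Fin.cases ?_ (fun k => ?_) k
    · exact h0
    · have := hca k
      rw [Fin.val_succ, add_comm]
      exact this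

lemma cylinder_powWord_succ_subset (n : ℕ) (a : Letter g) :
    S.cylinder (powWord (n + 1) a) ⊆ S.cylinder (powWord 1 a) := by
  rw [cylinder_eq, cylinder_eq]
  refine Set.image_mono fun b hb => ⟨hb.1, fun k => ?_⟩
  have := hb.2 0
  rw [Subsingleton.elim k 0]
  exact this

lemma exists_ckGen (hg : 2 ≤ g) (hμ : S.IsPattersonSullivan μ) (i : Letter g) :
    ∃ T, S.IsCuntzKriegerGen μ i T ∧ ∀ f, ‖T f‖ ≤ ‖f‖ := by
  obtain ⟨T, hT, hT'⟩ := exists_weightedComp (μ := μ) (measurable_mobius (S.letter i.inv))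
    (S.measurable_jac i.inv) (S.measurableSet_cylinder (powWord 1 i))
    (S.setLIntegral_jac_le hμ i.inv (S.measurableSet_cylinder _) (S.cylinder_subset_limitSet hg _))
  refine ⟨T, fun f => ?_, hT'⟩
  have := hT f
  rw [letter_inv]
  exact this

lemma isCuntzKriegerGen_ckGen (hg : 2 ≤ g) (hμ : S.IsPattersonSullivan μ) (i : Letter g) :
    S.IsCuntzKriegerGen μ i (S.ckGen μ i) :=
  Classical.epsilon_spec (p := S.IsCuntzKriegerGen μ i)
    ((S.exists_ckGen hg hμ i).imp fun _ h => h.1)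

lemma norm_ckGen_le (hg : 2 ≤ g) (hμ : S.IsPattersonSullivan μ) (i : Letter g) (f : L2 μ) :
    ‖S.ckGen μ i f‖ ≤ ‖f‖ := by
  obtain ⟨T, hT, hT'⟩ := S.exists_ckGen hg hμ i
  have : S.ckGen μ i f = T f :=
    Lp.ext ((S.isCuntzKriegerGen_ckGen hg hμ i f).trans (hT f).symm)
  rw [this]
  exact hT' f

lemma isSelfAdjoint_of_indicator {T : L2 μ →L[ℂ] L2 μ} {A : Set ℂ}
    (hT : ∀ f, (T f : ℂ → ℂ) =ᵐ[μ] A.indicator f) : IsSelfAdjoint T := by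
  rw [ContinuousLinearMap.isSelfAdjoint_iff_isSymmetric]
  intro f h
  change inner ℂ (T f) h = inner ℂ f (T h)
  rw [L2.inner_def, L2.inner_def]
  refine integral_congr_ae ?_
  filter_upwards [hT f, hT h] with x h1 h2
  rw [h1, h2]
  by_cases hx : x ∈ A <;> simp [hx]

/-- Composition of a Cuntz–Krieger generator with an operator that is given by multiplication by an
indicator function after the candidate `R` for the adjoint. -/
lemma ckGen_comp (hg : 2 ≤ g) (hμ : S.IsPattersonSullivan μ) (i : Letter g) {C D : Set ℂ}
    {M R : L2 μ →L[ℂ] L2 μ}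
    (hR : ∀ f : L2 μ, (R f : ℂ → ℂ) =ᵐ[μ] (S.coCylinder i).indicator
      fun x => (S.jac i x : ℂ) * f (mobius (S.letter i) x))
    (hM : ∀ f : L2 μ, (M f : ℂ → ℂ) =ᵐ[μ] C.indicator f)
    (hD : ∀ x, x ∈ D ↔ x ∈ S.cylinder (powWord 1 i) ∧ mobius (S.letter i.inv) x ∈ C) (f : L2 μ) :
    (S.ckGen μ i (M (R f)) : ℂ → ℂ) =ᵐ[μ] D.indicator f := by
  -- Identities valid almost everywhere are needed at the point g_i⁻¹x. They transfer because the
  -- weight does not vanish there.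
  have hpull := fun {p : ℂ → Prop} (hp : ∀ᵐ x ∂μ, p x) =>
    ae_comp_of_ae (μ := μ) (measurable_mobius (S.letter i.inv)) (S.measurable_jac i.inv)
      (S.measurableSet_cylinder (powWord 1 i)) (S.setLIntegral_jac_le hμ i.inv
        (S.measurableSet_cylinder _) (S.cylinder_subset_limitSet hg _)) hp
  filter_upwards [S.isCuntzKriegerGen_ckGen hg hμ i (M (R f)), hpull (hM (R f)), hpull (hR f)]
    with x h1 h2 h3
  rw [h1]
  by_cases hx : x ∈ S.cylinder (powWord 1 i)
  · rw [Set.indicator_of_mem hx, letter_inv]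
    obtain ⟨y, hy, rfl⟩ := S.exists_eq_mobius hx
    have hJ := S.jac_mul_jac hy
    have hJ0 : S.jac i.inv (mobius (S.letter i) y) ≠ 0 := fun e => by simp [e] at hJ
    have hyB := S.mobius_mem_coCylinder hx
    have h2 := h2 hx hJ0
    have h3 := h3 hx hJ0
    rw [S.letter_inv_mobius hy] at h2 h3 hyB ⊢
    rw [Set.indicator_of_mem hyB] at h3
    change (S.jac i.inv (mobius (S.letter i) y) : ℂ) * _ = _
    have hD' := hD (mobius (S.letter i) y)
    rw [S.letter_inv_mobius hy] at hD'
    rw [h2]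
    by_cases hC : y ∈ C
    · rw [Set.indicator_of_mem hC, h3, Set.indicator_of_mem (hD'.mpr ⟨hx, hC⟩), ← mul_assoc,
        ← Complex.ofReal_mul, mul_comm (S.jac i.inv _), hJ, Complex.ofReal_one, one_mul]
    · rw [Set.indicator_of_notMem hC, Set.indicator_of_notMem fun h => hC (hD'.mp h).2, mul_zero]
  · rw [Set.indicator_of_notMem hx, Set.indicator_of_notMem fun h => hx ((hD x).mp h).1]

/-- The reverse weighted composition R is also a contraction. Both products of it with S_i are
multiplications by indicators, hence self-adjoint, and `star_eq_of_contraction` identifies R with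
the adjoint without a change of variables in the inner product. -/
lemma star_ckGen_apply (hg : 2 ≤ g) (hμ : S.IsPattersonSullivan μ) (i : Letter g) (f : L2 μ) :
    (star (S.ckGen μ i) f : ℂ → ℂ) =ᵐ[μ] (S.coCylinder i).indicator
      fun x => (S.jac i x : ℂ) * f (mobius (S.letter i) x) := by
  obtain ⟨R, hR, hR'⟩ := exists_weightedComp (μ := μ) (measurable_mobius (S.letter i))
    (S.measurable_jac i) (S.measurableSet_coCylinder i)
    (S.setLIntegral_jac_le hμ i (S.measurableSet_coCylinder i) (S.coCylinder_subset hg i))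
  have hSR : ∀ f : L2 μ, ((S.ckGen μ i * R) f : ℂ → ℂ) =ᵐ[μ]
      (S.cylinder (powWord 1 i)).indicator f := by
    refine S.ckGen_comp hg hμ i (C := Set.univ) (M := ContinuousLinearMap.id ℂ _) hR ?_ (by simp)
    intro f
    simp
  have hRS : ∀ f : L2 μ, ((R * S.ckGen μ i) f : ℂ → ℂ) =ᵐ[μ] (S.coCylinder i).indicator f := by
    intro f
    have hpull := fun {p : ℂ → Prop} (hp : ∀ᵐ x ∂μ, p x) =>
      ae_comp_of_ae (μ := μ) (measurable_mobius (S.letter i)) (S.measurable_jac i)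
        (S.measurableSet_coCylinder i) (S.setLIntegral_jac_le hμ i
          (S.measurableSet_coCylinder i) (S.coCylinder_subset hg i)) hp
    filter_upwards [hR (S.ckGen μ i f), hpull (S.isCuntzKriegerGen_ckGen hg hμ i f)] with x h1 h2
    rw [mul_apply_eq_comp, h1]
    by_cases hx : x ∈ S.coCylinder i
    · have hd := S.denom_coCylinder hx
      have hJ := S.jac_mul_jac hd
      have hJ0 : S.jac i x ≠ 0 := fun e => by simp [e] at hJ
      have h2 := h2 hx hJ0
      rw [Set.indicator_of_mem (S.mobius_mem_cylinder hx), letter_inv, S.letter_inv_mobius hd] at h2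
      rw [Set.indicator_of_mem hx, Set.indicator_of_mem hx, h2, ← mul_assoc]
      change (S.jac i x : ℂ) * (S.jac i.inv (mobius (S.letter i) x) : ℂ) * _ = _
      rw [← Complex.ofReal_mul, hJ, Complex.ofReal_one, one_mul]
    · rw [Set.indicator_of_notMem hx, Set.indicator_of_notMem hx]
  have hstar : star (S.ckGen μ i) = R := by
    refine star_eq_of_contraction (S.norm_ckGen_le hg hμ i) hR' (isSelfAdjoint_of_indicator hSR)
      ?_ ?_ (isSelfAdjoint_of_indicator hRS)
    · ext1 f
      refine Lp.ext ((hSR _).trans ?_)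
      filter_upwards [S.isCuntzKriegerGen_ckGen hg hμ i f] with x hx
      by_cases h : x ∈ S.cylinder (powWord 1 i)
      · rw [Set.indicator_of_mem h]
        rfl
      · rw [Set.indicator_of_notMem h, hx, Set.indicator_of_notMem h]
    · ext1 f
      refine Lp.ext ((hRS _).trans ?_)
      filter_upwards [hR f] with x hx
      by_cases h : x ∈ S.coCylinder i
      · rw [Set.indicator_of_mem h]
        rfl
      · rw [Set.indicator_of_notMem h, hx, Set.indicator_of_notMem h]
  rw [hstar]
  exact hR f

lemma ae_mem_limitSet (hμ : S.IsPattersonSullivan μ) : ∀ᵐ x ∂μ, x ∈ S.limitSet := by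
  rw [ae_iff]
  exact hμ.carried

/-- `Q_{i,n}` is the multiplication by the characteristic function of the cylinder of
`g_i ⋯ g_i`. -/
theorem Q_apply (hg : 2 ≤ g) (hμ : S.IsPattersonSullivan μ) (i : Letter g) (n : ℕ) (f : L2 μ) :
    (S.Q μ i n f : ℂ → ℂ) =ᵐ[μ] (S.cylinder (powWord n i)).indicator f := by
  induction n generalizing f with
  | zero =>
    -- Q_{i,0} is the identity, and the cylinder of the empty word is the limit set, of full
    -- measure.
    filter_upwards [S.ae_mem_limitSet hμ] with x hx
    rw [S.cylinder_zero hg, Set.indicator_of_mem hx]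
    simp [Q]
  | succ n ih =>
    -- Conjugation by S_i prefixes one more letter g_i to the word.
    have e : S.Q μ i (n + 1) = S.ckGen μ i * S.Q μ i n * star (S.ckGen μ i) := by
      rw [Q, Q, pow_succ', pow_succ]
      simp only [mul_assoc]
    rw [e]
    refine S.ckGen_comp hg hμ i (C := S.cylinder (powWord n i)) (S.star_ckGen_apply hg hμ i) ih
      (fun x => ?_) f
    constructor
    · intro h
      have h1 := S.cylinder_powWord_succ_subset n i h
      exact ⟨h1, (S.mem_cylinder_powWord_succ h1 n).mp h⟩
    · rintro ⟨h1, h2⟩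
      exact (S.mem_cylinder_powWord_succ h1 n).mpr h2

lemma isStarProjection_Q (hg : 2 ≤ g) (hμ : S.IsPattersonSullivan μ) (i : Letter g) (n : ℕ) :
    IsStarProjection (S.Q μ i n) := by
  refine ⟨?_, isSelfAdjoint_of_indicator (S.Q_apply hg hμ i n)⟩
  ext1 f
  refine Lp.ext ?_
  filter_upwards [S.Q_apply hg hμ i n (S.Q μ i n f), S.Q_apply hg hμ i n f] with x h1 h2
  rw [mul_apply_eq_comp, h1]
  by_cases h : x ∈ S.cylinder (powWord n i)
  · rw [Set.indicator_of_mem h]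
  · rw [Set.indicator_of_notMem h, h2, Set.indicator_of_notMem h]

lemma Q_mem_afCore (i : Letter g) (n : ℕ) : S.Q μ i n ∈ S.afCore μ := by
  refine StarSubalgebra.le_topologicalClosure _ (StarAlgebra.subset_adjoin ℂ _ ?_)
  refine ⟨List.replicate n i, List.replicate n i, rfl, ?_⟩
  rw [Q, ckWord, List.map_replicate, List.prod_replicate, star_pow]

lemma afCore_le_ckAlgebra : S.afCore μ ≤ S.ckAlgebra μ := by
  refine StarSubalgebra.topologicalClosure_mono (StarAlgebra.adjoin_le ?_)
  rintro _ ⟨α, β, -, rfl⟩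
  have h : ∀ l : List (Letter g), S.ckWord μ l ∈ StarAlgebra.adjoin ℂ (Set.range (S.ckGen μ)) := by
    intro l
    refine list_prod_mem fun T hT => ?_
    obtain ⟨i, -, rfl⟩ := List.mem_map.mp hT
    exact StarAlgebra.subset_adjoin ℂ _ ⟨i, rfl⟩
  exact mul_mem (h α) (star_mem (h β))

end SchottkyGroup

/-! ### Diagonal operators of a graded Hilbert space -/

section Graded

variable {H : Type*} [NormedAddCommGroup H] [InnerProductSpace ℂ H]

/-- Mutually orthogonal projections with total ranges. -/
structure IsGrading [CompleteSpace H] (E : ℕ → H →L[ℂ] H) : Prop where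
  mul_self : ∀ n, E n * E n = E n
  mul_of_ne : ∀ m n, m ≠ n → E m * E n = 0
  selfAdjoint : ∀ n, IsSelfAdjoint (E n)
  total : ∀ x, (∀ n, E n x = 0) → x = 0

/-- The operator `0 ⊕ T` on `H ⊕ H`. -/
def sndOp (T : H →L[ℂ] H) : WithLp 2 (H × H) →L[ℂ] WithLp 2 (H × H) :=
  (WithLp.prodContinuousLinearEquiv 2 ℂ H H).symm.toContinuousLinearMap ∘L
    (0 : H →L[ℂ] H).prodMap T ∘L (WithLp.prodContinuousLinearEquiv 2 ℂ H H).toContinuousLinearMap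

/-- The inclusion of `0 ⊕ H` in `H ⊕ H`. -/
def inrMap (H : Type*) [NormedAddCommGroup H] [InnerProductSpace ℂ H] : H →ₗ[ℂ] WithLp 2 (H × H) :=
  (WithLp.linearEquiv 2 ℂ (H × H)).symm.toLinearMap ∘ₗ LinearMap.inr ℂ H H

lemma inrMap_apply (x : H) : inrMap H x = WithLp.toLp 2 (0, x) := rfl

lemma inrMap_injective : Function.Injective (inrMap H) := by
  intro x y h
  have := congrArg WithLp.snd h
  exact this

lemma norm_inrMap (x : H) : ‖inrMap H x‖ = ‖x‖ := by
  rw [inrMap_apply, WithLp.prod_norm_eq_of_L2]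
  simp

lemma sndOp_apply (T : H →L[ℂ] H) (z : WithLp 2 (H × H)) :
    sndOp T z = inrMap H (T z.snd) := rfl

lemma sndOp_mul (A B : H →L[ℂ] H) : sndOp A * sndOp B = sndOp (A * B) := rfl

lemma sndOp_smul (c : ℂ) (A : H →L[ℂ] H) : sndOp (c • A) = c • sndOp A := by
  ext1 z
  simp [sndOp_apply]

lemma range_sndOp (T : H →L[ℂ] H) : LinearMap.range (sndOp T : WithLp 2 (H × H) →ₗ[ℂ] _) =
    (LinearMap.range (T : H →ₗ[ℂ] H)).map (inrMap H) := by
  ext z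
  constructor
  · rintro ⟨x, rfl⟩
    exact ⟨_, ⟨x.snd, rfl⟩, rfl⟩
  · rintro ⟨_, ⟨x, rfl⟩, rfl⟩
    exact ⟨inrMap H x, rfl⟩

lemma sndOp_starProjection (K : Submodule ℂ H) [FiniteDimensional ℂ K] :
    sndOp K.starProjection = (K.map (inrMap H)).starProjection := by
  ext1 z
  refine (Submodule.eq_starProjection_of_mem_orthogonal ?_ ?_).symm
  · exact ⟨_, Submodule.starProjection_apply_mem _ _, rfl⟩
  · rw [Submodule.mem_orthogonal]
    rintro _ ⟨x, hx, rfl⟩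
    rw [sndOp_apply, inrMap_apply, inrMap_apply, WithLp.prod_inner_apply]
    simp only [WithLp.ofLp_sub, Prod.fst_sub, Prod.snd_sub, inner_zero_left, zero_add]
    exact (Submodule.mem_orthogonal _ _).mp
      (Submodule.sub_starProjection_mem_orthogonal (K := K) z.snd) x hx

/-- A projection acts as the identity on its range. -/
lemma finiteRankTrace_starProjection (K : Submodule ℂ H) [FiniteDimensional ℂ K] :
    finiteRankTrace K.starProjection = Module.finrank ℂ K := by
  have hr : LinearMap.range (K.starProjection : H →ₗ[ℂ] H) = K := Submodule.range_starProjection K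
  have : FiniteDimensional ℂ (LinearMap.range (K.starProjection : H →ₗ[ℂ] H)) := by
    rw [hr]; infer_instance
  rw [finiteRankTrace]
  have : ((K.starProjection : H →ₗ[ℂ] H).restrict
      (p := LinearMap.range (K.starProjection : H →ₗ[ℂ] H))
      (q := LinearMap.range (K.starProjection : H →ₗ[ℂ] H)) fun x _ => ⟨x, rfl⟩) =
      LinearMap.id := by
    ext ⟨x, hx⟩
    rw [hr] at hx
    exact Submodule.starProjection_eq_self_iff.mpr hx
  rw [this, LinearMap.trace_id, hr]

/-! ### Eigenspaces and spectrum of unbounded operators -/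

lemma mem_eigenspace_iff {D : H →ₗ.[ℂ] H} {c : ℂ} {x : H} :
    x ∈ eigenspace D c ↔ ∃ h : x ∈ D.domain, D ⟨x, h⟩ = c • x := by
  constructor
  · rintro ⟨⟨y, hy⟩, h, rfl⟩
    refine ⟨hy, ?_⟩
    have h' : D ⟨y, hy⟩ - c • y = 0 := h
    exact sub_eq_zero.mp h'
  · rintro ⟨h, e⟩
    refine ⟨⟨x, h⟩, ?_, rfl⟩
    change D ⟨x, h⟩ - c • x = 0
    rw [e, sub_self]

lemma mem_spec_of_eigenvector {D : H →ₗ.[ℂ] H} {c : ℂ} {x : H} (hx : x ∈ eigenspace D c)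
    (h0 : x ≠ 0) : c ∈ spec D := by
  rintro ⟨R, -, hR⟩
  obtain ⟨h, e⟩ := mem_eigenspace_iff.mp hx
  have := hR ⟨x, h⟩
  rw [e, sub_self, map_zero] at this
  exact h0 this.symm

variable [CompleteSpace H]

lemma sndOp_closure_starProjection (K : Submodule ℂ H) :
    (K.map (inrMap H)).topologicalClosure.starProjection =
      sndOp K.topologicalClosure.starProjection := by
  ext1 z
  refine Submodule.eq_starProjection_of_mem_orthogonal ?_ ?_
  · rw [sndOp_apply]
    have hmaps : Set.MapsTo (inrMap H) K (K.map (inrMap H)) := fun x hx => ⟨x, hx, rfl⟩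
    have hcont : Continuous (inrMap H) :=
      AddMonoidHomClass.continuous_of_bound (inrMap H) 1 fun x => by rw [norm_inrMap, one_mul]
    have hm : K.topologicalClosure.starProjection z.snd ∈ closure (K : Set H) :=
      Submodule.starProjection_apply_mem K.topologicalClosure z.snd
    exact hmaps.closure hcont hm
  · rw [Submodule.orthogonal_closure, Submodule.mem_orthogonal]
    rintro _ ⟨x, hx, rfl⟩
    rw [sndOp_apply, inrMap_apply, inrMap_apply, WithLp.prod_inner_apply]
    simp only [WithLp.ofLp_sub, Prod.fst_sub, Prod.snd_sub, inner_zero_left, zero_add]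
    have := Submodule.sub_starProjection_mem_orthogonal (K := K.topologicalClosure) z.snd
    exact (Submodule.mem_orthogonal _ _).mp this x (subset_closure hx)

namespace IsGrading

variable {E : ℕ → H →L[ℂ] H} (hE : IsGrading E)
include hE

lemma apply_apply_self (n : ℕ) (x : H) : E n (E n x) = E n x :=
  congrArg (fun T : H →L[ℂ] H => T x) (hE.mul_self n)

lemma apply_apply_of_ne {m n : ℕ} (h : m ≠ n) (x : H) : E m (E n x) = 0 :=
  congrArg (fun T : H →L[ℂ] H => T x) (hE.mul_of_ne m n h)

lemma inner_apply (n : ℕ) (x y : H) : inner ℂ (E n x) y = inner ℂ x (E n y) :=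
  (ContinuousLinearMap.isSelfAdjoint_iff_isSymmetric.mp (hE.selfAdjoint n)) x y

lemma apply_tsum (a : ℕ → ℂ) {x : H} (h : Summable fun n => (a n • E n) x) (k : ℕ) :
    E k (∑' n, (a n • E n) x) = a k • E k x := by
  rw [(E k).map_tsum h, tsum_eq_single k]
  · rw [smul_apply, map_smul, hE.apply_apply_self]
  · intro n hn
    rw [smul_apply, map_smul, hE.apply_apply_of_ne hn.symm, smul_zero]

/-- The operator `∑ (n + 1) E_n` on `H ⊕ 0` and `-∑ n E_n` on `0 ⊕ H`. -/
local notation "𝔇" => seriesOp (fun n : ℕ => ((n : ℂ) + 1) • E n) (fun n : ℕ => (-(n : ℂ)) • E n)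

/-- Each E_k is bounded and commutes with the defining series, so it reads off one coordinate of the
eigenvalue equation. -/
lemma eigenvector_components {τ c : ℂ} {z : WithLp 2 (H × H)} (hz : z ∈ eigenspace (τ • 𝔇) c)
    (k : ℕ) : (τ * (k + 1) - c) • E k z.fst = 0 ∧ (τ * -k - c) • E k z.snd = 0 := by
  obtain ⟨h, e⟩ := mem_eigenspace_iff.mp hz
  have h1 := congrArg (fun w : WithLp 2 (H × H) => E k w.fst) e
  have h2 := congrArg (fun w : WithLp 2 (H × H) => E k w.snd) e
  change E k (τ • ∑' n : ℕ, (((n : ℂ) + 1) • E n) z.fst) = E k (c • z.fst) at h1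
  change E k (τ • ∑' n : ℕ, ((-(n : ℂ)) • E n) z.snd) = E k (c • z.snd) at h2
  rw [map_smul, map_smul, hE.apply_tsum (fun n : ℕ => (n : ℂ) + 1) h.1] at h1
  rw [map_smul, map_smul, hE.apply_tsum (fun n : ℕ => -(n : ℂ)) h.2] at h2
  constructor
  · rw [sub_smul, mul_smul, h1, sub_self]
  · rw [sub_smul, mul_smul, h2, sub_self]

lemma snd_eq_zero_of_mem_eigenspace {τ c : ℂ} (hc : ∀ n : ℕ, c ≠ -n * τ) {z : WithLp 2 (H × H)}
    (hz : z ∈ eigenspace (τ • 𝔇) c) : z.snd = 0 := by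
  refine hE.total _ fun k => ?_
  refine (smul_eq_zero.mp (hE.eigenvector_components hz k).2).resolve_left fun h => hc k ?_
  linear_combination -h

/-- The shift n + 1 in the first summand matters here: k + 1 + n is never 0, so even the eigenvalue
0 lives on 0 ⊕ H alone. -/
lemma mem_eigenspace_neg_iff {τ : ℂ} (hτ : τ ≠ 0) (n : ℕ) (z : WithLp 2 (H × H)) :
    z ∈ eigenspace (τ • 𝔇) (-n * τ) ↔ ∃ y, z = inrMap H (E n y) := by
  constructor
  · intro hz
    have h := hE.eigenvector_components hz
    have h1 : z.fst = 0 := by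
      refine hE.total _ fun k => (smul_eq_zero.mp (h k).1).resolve_left ?_
      rw [show τ * ((k : ℂ) + 1) - -n * τ = τ * ((k + 1 + n : ℕ) : ℂ) by push_cast; ring]
      exact mul_ne_zero hτ (by exact_mod_cast (by omega : k + 1 + n ≠ 0))
    have h2 : z.snd - E n z.snd = 0 := by
      refine hE.total _ fun k => ?_
      rw [map_sub]
      by_cases hk : k = n
      · subst hk
        rw [hE.apply_apply_self, sub_self]
      · rw [hE.apply_apply_of_ne hk, sub_zero]
        refine (smul_eq_zero.mp (h k).2).resolve_left ?_
        rw [show τ * -(k : ℂ) - -n * τ = τ * ((n : ℂ) - k) by ring]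
        exact mul_ne_zero hτ (sub_ne_zero.mpr (by exact_mod_cast Ne.symm hk))
    refine ⟨z.snd, ?_⟩
    rw [← sub_eq_zero.mp h2]
    refine WithLp.ofLp_injective 2 (Prod.ext h1 rfl)
  · rintro ⟨y, rfl⟩
    have hs : ∀ k : ℕ, k ≠ n → ((-(k : ℂ)) • E k) (E n y) = 0 := fun k hk => by
      rw [smul_apply, hE.apply_apply_of_ne hk, smul_zero]
    refine mem_eigenspace_iff.mpr ⟨⟨?_, ?_⟩, ?_⟩
    · change Summable fun k : ℕ => (((k : ℂ) + 1) • E k) 0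
      simp
    · change Summable fun k : ℕ => ((-(k : ℂ)) • E k) (E n y)
      exact summable_of_ne_finset_zero (s := {n}) fun k hk => hs k (by simpa using hk)
    · change WithLp.toLp 2 (τ • ∑' k : ℕ, (((k : ℂ) + 1) • E k) (0 : H),
        τ • ∑' k : ℕ, ((-(k : ℂ)) • E k) (E n y)) = WithLp.toLp 2 ((-n * τ) • (0 : H), (-n * τ) • E n y)
      rw [tsum_eq_single n hs, smul_apply, hE.apply_apply_self]
      simp only [map_zero, tsum_zero, smul_zero, smul_smul]
      rw [mul_comm]

lemma spectralProj_neg {τ : ℂ} (hτ : τ ≠ 0) (n : ℕ) :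
    spectralProj (τ • 𝔇) (-n * τ) = sndOp (E n) := by
  ext1 z
  refine Submodule.eq_starProjection_of_mem_orthogonal ?_ ?_
  · exact subset_closure ((hE.mem_eigenspace_neg_iff hτ n _).mpr ⟨z.snd, rfl⟩)
  · rw [Submodule.orthogonal_closure, Submodule.mem_orthogonal]
    intro w hw
    obtain ⟨y, rfl⟩ := (hE.mem_eigenspace_neg_iff hτ n w).mp hw
    rw [sndOp_apply, inrMap_apply, inrMap_apply, WithLp.prod_inner_apply]
    simp only [WithLp.ofLp_sub, Prod.fst_sub, Prod.snd_sub, inner_zero_left, zero_add]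
    rw [hE.inner_apply, map_sub, hE.apply_apply_self]
    change inner ℂ y (E n z.snd - E n z.snd) = 0
    rw [sub_self, inner_zero_right]

/-- An eigenvector for any other value lies in H ⊕ 0, a closed condition, and 0 ⊕ T annihilates it.
-/
lemma sndOp_mul_spectralProj {τ c : ℂ} (hc : ∀ n : ℕ, c ≠ -n * τ) (T : H →L[ℂ] H) :
    sndOp T * spectralProj (τ • 𝔇) c = 0 := by
  ext1 z
  have hclosed : IsClosed {w : WithLp 2 (H × H) | w.snd = 0} :=
    isClosed_eq (WithLp.prod_continuous_ofLp 2 H H).snd continuous_const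
  have hmem : spectralProj (τ • 𝔇) c z ∈ {w : WithLp 2 (H × H) | w.snd = 0} := by
    refine closure_minimal ?_ hclosed (Submodule.starProjection_apply_mem
      (eigenspace (τ • 𝔇) c).topologicalClosure z)
    exact fun w hw => hE.snd_eq_zero_of_mem_eigenspace hc hw
  rw [mul_apply_eq_comp, sndOp_apply, show (spectralProj (τ • 𝔇) c z).snd = 0 from hmem]
  simp

/-- The projection on the closure of a graded subspace, restricted to a homogeneous component. -/
lemma closure_starProjection_mul {W : Submodule ℂ H} (n : ℕ)
    (hW : W.map (E n : H →ₗ[ℂ] H) ≤ W) [FiniteDimensional ℂ (W.map (E n : H →ₗ[ℂ] H))] :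
    W.topologicalClosure.starProjection * E n = (W.map (E n : H →ₗ[ℂ] H)).starProjection := by
  ext1 x
  refine Submodule.eq_starProjection_of_mem_orthogonal ?_ ?_
  · exact subset_closure (hW (Submodule.starProjection_apply_mem _ _))
  · rw [Submodule.orthogonal_closure, Submodule.mem_orthogonal]
    intro w hw
    set U := W.map (E n : H →ₗ[ℂ] H)
    have hp : E n (U.starProjection x) = U.starProjection x := by
      obtain ⟨y, -, hy⟩ := Submodule.starProjection_apply_mem U x
      rw [← hy]
      exact hE.apply_apply_self n y
    change inner ℂ w (E n x - U.starProjection x) = 0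
    rw [← hp, ← map_sub, ← hE.inner_apply]
    exact (Submodule.mem_orthogonal _ _).mp (Submodule.sub_starProjection_mem_orthogonal x) _
      ⟨w, hw, rfl⟩

/-- The regularized determinant of a projection of constant finite multiplicity. -/
theorem exists_isRegularizedDet {W : Submodule ℂ H} (hW : ∀ n, W.map (E n : H →ₗ[ℂ] H) ≤ W) {N : ℕ}
    (hN : N ≠ 0) (hfin : ∀ n, Module.finrank ℂ (W.map (E n : H →ₗ[ℂ] H)) = N) {s : ℂ}
    (hs : ∀ n : ℕ, s ≠ -n) :
    ∃ d : ℂ, IsRegularizedDet (W.map (inrMap H)).topologicalClosure.starProjection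
      (((2 * Real.pi : ℂ)⁻¹) • 𝔇) (s / (2 * Real.pi)) d ∧ d⁻¹ = gammaC s ^ N := by
  have hfd : ∀ n, FiniteDimensional ℂ (W.map (E n : H →ₗ[ℂ] H)) := fun n =>
    FiniteDimensional.of_finrank_pos (by rw [hfin]; omega)
  obtain ⟨Z, hZ1, hZ2, hZ3, hZ4⟩ := exists_regularized_gammaC hs N
  refine ⟨Complex.exp (-deriv Z 0), ⟨?_, Z, 1, -(1 / 2), by norm_num, hZ1, hZ2, ?_, rfl⟩, ?_⟩
  all_goals
    have hpi : (2 * Real.pi : ℂ) ≠ 0 := by exact_mod_cast Real.two_pi_pos.ne'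
    set τ := (2 * Real.pi : ℂ)⁻¹ with hτdef
    have hτ : τ ≠ 0 := inv_ne_zero hpi
  · intro c
    rw [sndOp_closure_starProjection]
    by_cases hc : ∀ n : ℕ, c ≠ -n * τ
    · rw [hE.sndOp_mul_spectralProj hc, ContinuousLinearMap.toLinearMap_zero, LinearMap.range_zero]
      infer_instance
    · push Not at hc
      obtain ⟨n, rfl⟩ := hc
      rw [hE.spectralProj_neg hτ, sndOp_mul, hE.closure_starProjection_mul n (hW n), range_sndOp,
        show LinearMap.range ((W.map (E n : H →ₗ[ℂ] H)).starProjection : H →ₗ[ℂ] H) = _ from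
          Submodule.range_starProjection _]
      infer_instance
  · intro z hz
    have hspec : ∀ n : ℕ, -(n : ℂ) * τ ∈ spec (τ • 𝔇) := by
      intro n
      -- Nonzero multiplicity provides an eigenvector for every -nτ, so all these numbers belong to
      -- the spectrum.
      have hpos : 0 < Module.finrank ℂ (W.map (E n : H →ₗ[ℂ] H)) := by rw [hfin]; omega
      have := Module.finrank_pos_iff.mp hpos
      obtain ⟨⟨_, ⟨y, hy, rfl⟩⟩, hne⟩ := exists_ne (0 : W.map (E n : H →ₗ[ℂ] H))
      refine mem_spec_of_eigenvector ((hE.mem_eigenspace_neg_iff hτ n _).mpr ⟨y, rfl⟩) ?_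
      intro h0
      apply hne
      exact Subtype.ext (inrMap_injective (h0.trans (map_zero _).symm))
    let φ : ℕ → spec (τ • 𝔇) := fun n => ⟨-(n : ℂ) * τ, hspec n⟩
    have hφ : Function.Injective φ := by
      intro m n h
      have := mul_right_cancel₀ hτ (congrArg Subtype.val h)
      exact_mod_cast neg_injective this
    -- The full spectrum need not be known: every spectral value outside the image of φ contributes
    -- trace 0.
    rw [← hφ.hasSum_iff]
    · refine (hZ3 z hz).congr_fun fun n => ?_
      simp only [Function.comp_apply, φ]
      rw [sndOp_closure_starProjection, hE.spectralProj_neg hτ, sndOp_mul,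
        hE.closure_starProjection_mul n (hW n), sndOp_starProjection, finiteRankTrace_starProjection,
        ← (Submodule.equivMapOfInjective (inrMap H) inrMap_injective _).finrank_eq, hfin]
    · rintro ⟨c, hc⟩ hcr
      have hc' : ∀ n : ℕ, c ≠ -n * τ := fun n h => hcr ⟨n, Subtype.ext h.symm⟩
      have : ∀ K : Submodule ℂ H, (K.map (inrMap H)).topologicalClosure.starProjection *
          spectralProj (τ • 𝔇) c = (⊥ : Submodule ℂ _).starProjection := fun K => by
        rw [sndOp_closure_starProjection, hE.sndOp_mul_spectralProj hc', Submodule.starProjection_bot]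
      rw [this, finiteRankTrace_starProjection]
      simp
  · rw [Complex.exp_neg, inv_inv, hZ4]

end IsGrading

end Graded

namespace SchottkyGroup

variable {g : ℕ} (S : SchottkyGroup g) {μ : Measure ℂ}

/-! ### Characteristic functions of cylinders -/

lemma chi_mem_P {n : ℕ} (w : Fin (n + 1) → Letter g) : S.chi μ w ∈ S.P μ n :=
  Submodule.subset_span ⟨w, rfl⟩

section Chi

variable [IsFiniteMeasure μ]

lemma chi_eq {m : ℕ} (w : Fin m → Letter g) :
    S.chi μ w = indicatorConstLp 2 (S.measurableSet_cylinder w) (measure_ne_top μ _) (1 : ℂ) := by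
  have h : MemLp ((S.cylinder w).indicator fun _ => (1 : ℂ)) 2 μ :=
    memLp_indicator_const 2 (S.measurableSet_cylinder w) 1 (Or.inr (measure_ne_top μ _))
  rw [chi, dif_pos h]
  rfl

lemma coeFn_chi {m : ℕ} (w : Fin m → Letter g) :
    (S.chi μ w : ℂ → ℂ) =ᵐ[μ] (S.cylinder w).indicator fun _ => (1 : ℂ) := by
  rw [chi_eq]
  exact indicatorConstLp_coeFn

lemma inner_chi {m : ℕ} (w : Fin m → Letter g) (f : L2 μ) :
    inner ℂ (S.chi μ w) f = ∫ x in S.cylinder w, f x ∂μ := by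
  rw [chi_eq]
  exact L2.inner_indicatorConstLp_one _ _ f

lemma inner_chi_chi {m k : ℕ} (w : Fin m → Letter g) (v : Fin k → Letter g) :
    inner ℂ (S.chi μ w) (S.chi μ v) = (μ.real (S.cylinder w ∩ S.cylinder v) : ℂ) := by
  rw [inner_chi, setIntegral_congr_ae (g := (S.cylinder v).indicator fun _ => (1 : ℂ))
    (S.measurableSet_cylinder w) ((S.coeFn_chi v).mono fun x hx _ => hx),
    setIntegral_indicator (S.measurableSet_cylinder v), setIntegral_const]
  simp

lemma norm_chi_sq {m : ℕ} (w : Fin m → Letter g) :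
    ‖S.chi μ w‖ ^ 2 = μ.real (S.cylinder w) := by
  have := S.inner_chi_chi (μ := μ) w w
  rw [inner_self_eq_norm_sq_to_K, Set.inter_self] at this
  apply Complex.ofReal_injective
  rw [← this]
  simp

lemma inner_chi_of_ne {m : ℕ} {w v : Fin m → Letter g} (h : w ≠ v) :
    inner ℂ (S.chi μ w) (S.chi μ v) = 0 := by
  rw [inner_chi_chi, (S.cylinder_disjoint h).inter_eq]
  simp

lemma chi_eq_sum {m : ℕ} (w : Fin m → Letter g) :
    S.chi μ w = ∑ b, S.chi μ (Fin.snoc w b : Fin (m + 1) → Letter g) := by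
  refine Lp.ext ?_
  have h1 : ∀ᵐ x ∂μ, ∀ b, S.chi μ (Fin.snoc w b : Fin (m + 1) → Letter g) x =
      (S.cylinder (Fin.snoc w b : Fin (m + 1) → Letter g)).indicator (fun _ => (1 : ℂ)) x :=
    ae_all_iff.mpr fun b => S.coeFn_chi _
  filter_upwards [S.coeFn_chi w, h1, Lp.coeFn_fun_finsetSum Finset.univ
    fun b => S.chi μ (Fin.snoc w b : Fin (m + 1) → Letter g)] with x hx hb hs
  rw [hx, hs]
  simp only [hb]
  have hinj : ∀ b c : Letter g, b ≠ c →
      (Fin.snoc w b : Fin (m + 1) → Letter g) ≠ Fin.snoc w c := fun b c h e => h (by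
    have := congrFun e (Fin.last m)
    simpa using this)
  by_cases hxw : x ∈ S.cylinder w
  · rw [Set.indicator_of_mem hxw]
    rw [cylinder_eq_iUnion, Set.mem_iUnion] at hxw
    obtain ⟨b, hxb⟩ := hxw
    rw [Finset.sum_eq_single b, Set.indicator_of_mem hxb]
    · intro c _ hc
      exact Set.indicator_of_notMem
        (fun h => Set.disjoint_left.mp (S.cylinder_disjoint (hinj c b hc)) h hxb) _
    · simp
  · rw [Set.indicator_of_notMem hxw, Finset.sum_eq_zero]
    intro b _
    refine Set.indicator_of_notMem (fun h => hxw ?_) _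
    rw [cylinder_eq_iUnion]
    exact Set.mem_iUnion.mpr ⟨b, h⟩

lemma P_le_succ (n : ℕ) : S.P μ n ≤ S.P μ (n + 1) := by
  refine Submodule.span_le.mpr ?_
  rintro _ ⟨w, rfl⟩
  change S.chi μ w ∈ _
  rw [chi_eq_sum]
  exact Submodule.sum_mem _ fun b _ => S.chi_mem_P _

lemma P_mono : Monotone (S.P μ) := monotone_nat_of_le_succ S.P_le_succ

end Chi

/-- The cylinder functions are total in `L²`. -/
lemma eq_zero_of_forall_inner_chi (hg : 2 ≤ g) (hμ : S.IsPattersonSullivan μ) {f : L2 μ}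
    (h : ∀ (n : ℕ) (w : Fin (n + 1) → Letter g), inner ℂ (S.chi μ w) f = 0) : f = 0 := by
  have := hμ.finite
  have hint : Integrable f μ := (Lp.memLp f).integrable (by norm_num)
  have hcyl : ∀ (n : ℕ) (w : Fin (n + 1) → Letter g), ∫ x in S.cylinder w, f x ∂μ = 0 :=
    fun n w => by rw [← inner_chi]; exact h n w
  rw [Lp.eq_zero_iff_ae_eq_zero]
  refine ae_eq_zero_of_forall_setIntegral_isClosed_eq_zero hint fun K hK => ?_
  -- U n is the union of the cylinders of level n that meet K. The integral of f over it vanishes,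
  -- and on the limit set its indicator converges pointwise to that of K because cylinders shrink to
  -- points.
  let U : ℕ → Set ℂ := fun n => ⋃ w : {w : Fin (n + 1) → Letter g // (S.cylinder w ∩ K).Nonempty},
    S.cylinder w.1
  have hUm : ∀ n, MeasurableSet (U n) := fun n =>
    MeasurableSet.iUnion fun w => S.measurableSet_cylinder _
  have hU0 : ∀ n, ∫ x in U n, f x ∂μ = 0 := by
    intro n
    rw [integral_iUnion (fun w => S.measurableSet_cylinder _) _ hint.integrableOn]
    · simp [hcyl]
    · intro w v hwv
      exact S.cylinder_disjoint fun e => hwv (Subtype.ext e)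
  have hcov : ∀ x ∈ S.limitSet, ∀ n, ∃ w : Fin (n + 1) → Letter g, x ∈ S.cylinder w := by
    intro x hx n
    rw [S.limitSet_eq hg] at hx
    obtain ⟨a, ha, rfl⟩ := hx
    refine ⟨fun k => a k, ?_⟩
    rw [cylinder_eq]
    exact ⟨a, ⟨ha, fun _ => rfl⟩, rfl⟩
  have hlim : Tendsto (fun n => ∫ x, (U n).indicator f x ∂μ) atTop
      (𝓝 (∫ x, K.indicator f x ∂μ)) := by
    refine tendsto_integral_of_dominated_convergence (fun x => ‖f x‖)
      (fun n => (hint.indicator (hUm n)).aestronglyMeasurable) hint.norm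
      (fun n => Eventually.of_forall fun x => norm_indicator_le_norm_self _ _) ?_
    filter_upwards [S.ae_mem_limitSet hμ] with x hx
    by_cases hxK : x ∈ K
    · rw [Set.indicator_of_mem hxK]
      refine tendsto_const_nhds.congr fun n => ?_
      obtain ⟨w, hw⟩ := hcov x hx n
      rw [Set.indicator_of_mem (Set.mem_iUnion.mpr ⟨⟨w, x, hw, hxK⟩, hw⟩)]
    · rw [Set.indicator_of_notMem hxK]
      obtain ⟨ε, hε, hball⟩ := Metric.isOpen_iff.mp hK.isOpen_compl x hxK
      obtain ⟨N, hN⟩ := S.norm_sub_le_of_mem_cylinder hε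
      refine tendsto_const_nhds.congr' ?_
      filter_upwards [eventually_ge_atTop N] with n hn
      rw [Set.indicator_of_notMem]
      intro hxU
      obtain ⟨⟨w, y, hyw, hyK⟩, hxw⟩ := Set.mem_iUnion.mp hxU
      refine hball ?_ hyK
      rw [Metric.mem_ball, dist_eq_norm]
      exact hN (n + 1) (by omega) w y hyw x hxw
  rw [← integral_indicator hK.measurableSet]
  refine tendsto_nhds_unique hlim (tendsto_const_nhds.congr fun n => ?_)
  rw [integral_indicator (hUm n), hU0]

/-! ### The grading -/

lemma gradedProj_isSelfAdjoint (n : ℕ) : IsSelfAdjoint (S.gradedProj μ n) := by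
  rcases n with _ | n
  · exact isSelfAdjoint_starProjection _
  · exact (isSelfAdjoint_starProjection _).sub (isSelfAdjoint_starProjection _)

lemma gradedProj_inner (n : ℕ) (x y : L2 μ) :
    inner ℂ (S.gradedProj μ n x) y = inner ℂ x (S.gradedProj μ n y) :=
  (ContinuousLinearMap.isSelfAdjoint_iff_isSymmetric.mp (S.gradedProj_isSelfAdjoint n)) x y

/-- The `n`-th projection is the identity on vectors of level `n` orthogonal to lower levels. -/
lemma gradedProj_eq_self {n : ℕ} {x : L2 μ} (hx : x ∈ S.P μ n)
    (ho : ∀ m < n, ∀ y ∈ S.P μ m, inner ℂ y x = 0) : S.gradedProj μ n x = x := by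
  rcases n with _ | n
  · exact Submodule.starProjection_eq_self_iff.mpr hx
  · change (S.P μ (n + 1)).starProjection x - (S.P μ n).starProjection x = x
    rw [Submodule.starProjection_eq_self_iff.mpr hx, sub_eq_self]
    exact Submodule.eq_starProjection_of_mem_orthogonal (zero_mem _) (by
      rw [sub_zero, Submodule.mem_orthogonal]
      exact ho n (Nat.lt_succ_self n))

section Grading

variable [IsFiniteMeasure μ]

lemma gradedProj_mem (n : ℕ) (x : L2 μ) : S.gradedProj μ n x ∈ S.P μ n := by
  rcases n with _ | n
  · exact Submodule.starProjection_apply_mem _ _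
  · exact sub_mem (Submodule.starProjection_apply_mem _ _)
      (S.P_le_succ n (Submodule.starProjection_apply_mem _ _))

lemma gradedProj_of_mem_of_lt {m n : ℕ} (h : m < n) {x : L2 μ} (hx : x ∈ S.P μ m) :
    S.gradedProj μ n x = 0 := by
  rcases n with _ | n
  · omega
  · change (S.P μ (n + 1)).starProjection x - (S.P μ n).starProjection x = 0
    rw [Submodule.starProjection_eq_self_iff.mpr (S.P_mono (by omega) hx),
      Submodule.starProjection_eq_self_iff.mpr (S.P_mono (by omega) hx), sub_self]

lemma inner_gradedProj_of_lt {m n : ℕ} (h : m < n) {y : L2 μ} (hy : y ∈ S.P μ m) (x : L2 μ) :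
    inner ℂ y (S.gradedProj μ n x) = 0 := by
  rw [← gradedProj_inner, S.gradedProj_of_mem_of_lt h hy, inner_zero_left]

end Grading

/-- Orthogonality follows from the nesting of the 𝓟_n. For totality, if all Π̂_n x vanish then all
Π_n x vanish by telescoping, so x is orthogonal to every cylinder function. -/
theorem isGrading_gradedProj (hg : 2 ≤ g) (hμ : S.IsPattersonSullivan μ) :
    IsGrading (S.gradedProj μ) := by
  have := hμ.finite
  refine ⟨fun n => ?_, fun m n hmn => ?_, S.gradedProj_isSelfAdjoint, fun x hx => ?_⟩
  · ext1 x
    exact S.gradedProj_eq_self (S.gradedProj_mem n x)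
      fun m hm y hy => S.inner_gradedProj_of_lt hm hy x
  · ext1 x
    change S.gradedProj μ m (S.gradedProj μ n x) = 0
    rcases lt_or_gt_of_ne hmn with h | h
    · rw [← inner_self_eq_zero (𝕜 := ℂ), ← S.gradedProj_inner]
      exact S.inner_gradedProj_of_lt h (S.gradedProj_mem _ _) x
    · exact S.gradedProj_of_mem_of_lt h (S.gradedProj_mem n x)
  · have hproj : ∀ n, (S.P μ n).starProjection x = 0 := by
      intro n
      induction n with
      | zero => exact hx 0
      | succ n ih =>
        have h : (S.P μ (n + 1)).starProjection x - (S.P μ n).starProjection x = 0 := hx (n + 1)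
        rwa [ih, sub_zero] at h
    refine S.eq_zero_of_forall_inner_chi hg hμ fun n w => ?_
    have := (Submodule.mem_orthogonal _ _).mp
      (Submodule.sub_starProjection_mem_orthogonal (K := S.P μ n) x) _ (S.chi_mem_P w)
    rwa [hproj, sub_zero] at this

end SchottkyGroup

/-! ### Projections on spans of orthogonal families -/

section Orthogonal

variable {H : Type*} [NormedAddCommGroup H] [InnerProductSpace ℂ H] {ι : Type*} [Fintype ι]
  {v : ι → H}

lemma starProjection_singleton_of_inner_eq_zero {x y : H} (h : inner ℂ x y = 0) :
    (Submodule.span ℂ {x}).starProjection y = 0 := by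
  rw [Submodule.starProjection_singleton, h, zero_div, zero_smul]

lemma starProjection_singleton_self (x : H) : (Submodule.span ℂ {x}).starProjection x = x :=
  Submodule.starProjection_eq_self_iff.mpr (Submodule.mem_span_singleton_self x)

lemma sum_smul_starProjection_apply (hv : Pairwise fun i j => inner ℂ (v i) (v j) = 0)
    (t : ι → ℂ) (j : ι) :
    (∑ i, t i • (Submodule.span ℂ {v i}).starProjection) (v j) = t j • v j := by
  rw [sum_apply, Finset.sum_eq_single j]
  · rw [smul_apply, starProjection_singleton_self]
  · intro i _ hij
    rw [smul_apply, starProjection_singleton_of_inner_eq_zero (hv hij), smul_zero]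
  · simp

/-- The v_i are eigenvectors with nonzero eigenvalues t_i, so rescaling the projections does not
change the range. -/
lemma range_sum_smul_starProjection (hv : Pairwise fun i j => inner ℂ (v i) (v j) = 0)
    {t : ι → ℂ} (ht : ∀ i, t i ≠ 0) :
    LinearMap.range ((∑ i, t i • (Submodule.span ℂ {v i}).starProjection : H →L[ℂ] H) :
      H →ₗ[ℂ] H) = Submodule.span ℂ (Set.range v) := by
  refine le_antisymm ?_ ?_
  · rintro _ ⟨x, rfl⟩
    change (∑ i, t i • (Submodule.span ℂ {v i}).starProjection : H →L[ℂ] H) x ∈ _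
    rw [sum_apply]
    refine Submodule.sum_mem _ fun i _ => Submodule.smul_mem _ _ ?_
    refine Submodule.span_mono ?_ (Submodule.starProjection_apply_mem (Submodule.span ℂ {v i}) x)
    rintro _ rfl
    exact ⟨i, rfl⟩
  · refine Submodule.span_le.mpr ?_
    rintro _ ⟨j, rfl⟩
    refine ⟨(t j)⁻¹ • v j, ?_⟩
    change (∑ i, t i • (Submodule.span ℂ {v i}).starProjection : H →L[ℂ] H) _ = _
    rw [map_smul, sum_smul_starProjection_apply hv, smul_smul, inv_mul_cancel₀ (ht j), one_smul]

lemma starProjection_span_range (hv : Pairwise fun i j => inner ℂ (v i) (v j) = 0)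
    (U : Submodule ℂ H) [FiniteDimensional ℂ U] (hU : U = Submodule.span ℂ (Set.range v)) :
    U.starProjection = ∑ i, (Submodule.span ℂ {v i}).starProjection := by
  subst hU
  have hsum : ∑ i, (Submodule.span ℂ {v i}).starProjection =
      ∑ i, (1 : ℂ) • (Submodule.span ℂ {v i}).starProjection := by simp
  ext1 x
  refine Submodule.eq_starProjection_of_mem_orthogonal ?_ ?_
  · rw [← range_sum_smul_starProjection hv (t := fun _ => 1) fun _ => one_ne_zero, hsum]
    exact ⟨x, rfl⟩
  · rw [Submodule.mem_orthogonal]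
    suffices h : Submodule.span ℂ (Set.range v) ≤
        (Submodule.span ℂ {x - (∑ i, (Submodule.span ℂ {v i}).starProjection) x})ᗮ by
      intro u hu
      rw [inner_eq_zero_symm]
      exact (Submodule.mem_orthogonal _ _).mp (h hu) _ (Submodule.mem_span_singleton_self _)
    refine Submodule.span_le.mpr ?_
    rintro _ ⟨j, rfl⟩
    refine (Submodule.mem_orthogonal_singleton_iff_inner_left).mpr ?_
    rw [inner_sub_right, sum_apply, inner_sum, Finset.sum_eq_single j]
    · rw [← inner_sub_right, inner_eq_zero_symm]
      exact Submodule.starProjection_inner_eq_zero x _ (Submodule.mem_span_singleton_self _)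
    · intro i _ hij
      rw [Submodule.starProjection_singleton, inner_smul_right, hv hij.symm, mul_zero]
    · simp

end Orthogonal

namespace SchottkyGroup

variable {g : ℕ} (S : SchottkyGroup g) {μ : Measure ℂ}

/-! ### The generators of `𝓥` -/

lemma isRed_const (k : Letter g) : IsRed fun _ : ℕ => k := fun _ => (Letter.inv_ne k).symm

lemma measureReal_cylinder_pos (hg : 2 ≤ g) (hμ : S.IsPattersonSullivan μ) {m : ℕ}
    {w : Fin m → Letter g} {a : ℕ → Letter g} (ha : IsRed a) (h : ∀ k : Fin m, a k = w k) :
    0 < μ.real (S.cylinder w) := by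
  have := hμ.finite
  have hw : w = fun k : Fin m => a k := funext fun k => (h k).symm
  subst hw
  exact ENNReal.toReal_pos (S.measure_cylinder_pos hg hμ ha m).ne' (measure_ne_top μ _)

lemma measureReal_powWord_pos (hg : 2 ≤ g) (hμ : S.IsPattersonSullivan μ) (n : ℕ) (k : Letter g) :
    0 < μ.real (S.cylinder (powWord n k)) :=
  S.measureReal_cylinder_pos hg hμ (isRed_const k) fun _ => rfl

lemma powWord_succ_eq_snoc (n : ℕ) (k : Letter g) :
    powWord (n + 1) k = Fin.snoc (powWord n k) k := by
  ext1 j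
  refine Fin.lastCases ?_ (fun j => ?_) j
  · rw [Fin.snoc_last]; rfl
  · rw [Fin.snoc_castSucc]; rfl

lemma cylinder_snoc_subset {m : ℕ} (w : Fin m → Letter g) (b : Letter g) :
    S.cylinder (Fin.snoc w b : Fin (m + 1) → Letter g) ⊆ S.cylinder w := by
  rw [cylinder_eq_iUnion S w]
  exact Set.subset_iUnion (fun b => S.cylinder (Fin.snoc w b : Fin (m + 1) → Letter g)) b

lemma cylinder_powWord_subset (n : ℕ) (k : Letter g) :
    S.cylinder (powWord (n + 1) k) ⊆ S.cylinder (powWord n k) := by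
  rw [powWord_succ_eq_snoc]
  exact S.cylinder_snoc_subset _ _

lemma powWord_injective (n : ℕ) : Function.Injective (powWord (g := g) (n + 1)) :=
  fun _ _ h => congrFun h 0

lemma disjoint_powWord (m n : ℕ) {k l : Letter g} (h : k ≠ l) :
    Disjoint (S.cylinder (powWord (m + 1) k)) (S.cylinder (powWord (n + 1) l)) :=
  (S.cylinder_disjoint fun e => h (powWord_injective 0 e)).mono
    (S.cylinder_powWord_succ_subset m k) (S.cylinder_powWord_succ_subset n l)

lemma vGen_zero (k : Letter g) : S.vGen μ 0 k = S.chi μ (powWord 1 k) :=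
  Submodule.starProjection_eq_self_iff.mpr (S.chi_mem_P _)

lemma norm_gradedProj_le (n : ℕ) (hE : S.gradedProj μ n * S.gradedProj μ n = S.gradedProj μ n)
    (x : L2 μ) : ‖S.gradedProj μ n x‖ ≤ ‖x‖ := by
  have h1 : ‖S.gradedProj μ n x‖ ^ 2 ≤ ‖S.gradedProj μ n x‖ * ‖x‖ := by
    have h2 : inner ℂ (S.gradedProj μ n x) (S.gradedProj μ n x) =
        inner ℂ (S.gradedProj μ n x) x := by
      rw [← S.gradedProj_inner, ← mul_apply_eq_comp, hE]
    have h3 := norm_inner_le_norm (𝕜 := ℂ) (S.gradedProj μ n x) x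
    rwa [← h2, inner_self_eq_norm_sq_to_K, norm_pow, RCLike.norm_ofReal, abs_norm] at h3
  by_contra h
  rw [not_le] at h
  nlinarith [norm_nonneg x, norm_nonneg (S.gradedProj μ n x)]

section Finite

variable [IsFiniteMeasure μ]

lemma inner_chi_powWord_of_ne (m n : ℕ) {k l : Letter g} (h : k ≠ l) :
    inner ℂ (S.chi μ (powWord (m + 1) k)) (S.chi μ (powWord (n + 1) l)) = 0 := by
  rw [inner_chi_chi, (S.disjoint_powWord m n h).inter_eq]
  simp

end Finite

/-- Among words of length n + 1 only w_{n+1,k} has a cylinder meeting that of w_{n+2,k}. The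
projection on 𝓟_n is thus a multiple of one characteristic function, the factor being the
conditional mass. -/
lemma vGen_succ (hg : 2 ≤ g) (hμ : S.IsPattersonSullivan μ) (n : ℕ) (k : Letter g) :
    S.vGen μ (n + 1) k = S.chi μ (powWord (n + 2) k) -
      ((μ.real (S.cylinder (powWord (n + 2) k)) / μ.real (S.cylinder (powWord (n + 1) k)) : ℝ) : ℂ) •
        S.chi μ (powWord (n + 1) k) := by
  have := hμ.finite
  have hpos := S.measureReal_powWord_pos hg hμ (n + 1) k
  change (S.P μ (n + 1)).starProjection (S.chi μ (powWord (n + 2) k)) -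
    (S.P μ n).starProjection (S.chi μ (powWord (n + 2) k)) = _
  rw [Submodule.starProjection_eq_self_iff.mpr (S.chi_mem_P _)]
  congr 1
  refine Submodule.eq_starProjection_of_mem_orthogonal (Submodule.smul_mem _ _ (S.chi_mem_P _)) ?_
  set z := S.chi μ (powWord (n + 2) k) -
      ((μ.real (S.cylinder (powWord (n + 2) k)) / μ.real (S.cylinder (powWord (n + 1) k)) : ℝ) : ℂ) •
        S.chi μ (powWord (n + 1) k) with hz
  rw [Submodule.mem_orthogonal]
  suffices h : S.P μ n ≤ (Submodule.span ℂ {z})ᗮ from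
    fun u hu => (Submodule.mem_orthogonal_singleton_iff_inner_left).mp (h hu)
  refine Submodule.span_le.mpr ?_
  rintro _ ⟨w, rfl⟩
  refine (Submodule.mem_orthogonal_singleton_iff_inner_left).mpr ?_
  change inner ℂ (S.chi μ w) z = 0
  rw [hz, inner_sub_right, inner_smul_right, inner_chi_chi, inner_chi_chi]
  by_cases hw : w = powWord (n + 1) k
  · subst hw
    rw [Set.inter_self, Set.inter_eq_right.mpr (S.cylinder_powWord_subset (n + 1) k),
      ← Complex.ofReal_mul, div_mul_cancel₀ _ hpos.ne', sub_self]
  · have hd := S.cylinder_disjoint hw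
    rw [hd.inter_eq, (hd.mono_right (S.cylinder_powWord_subset (n + 1) k)).inter_eq]
    simp

/-- The supports are disjoint, since the cylinders already differ in their first letter. -/
lemma inner_vGen_of_ne (hg : 2 ≤ g) (hμ : S.IsPattersonSullivan μ) (n : ℕ) {k l : Letter g}
    (h : k ≠ l) : inner ℂ (S.vGen μ n k) (S.vGen μ n l) = 0 := by
  have := hμ.finite
  rcases n with _ | n
  · rw [vGen_zero, vGen_zero]
    exact S.inner_chi_powWord_of_ne 0 0 h
  · rw [S.vGen_succ hg hμ, S.vGen_succ hg hμ]
    simp only [inner_sub_left, inner_sub_right, inner_smul_left, inner_smul_right]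
    simp only [S.inner_chi_powWord_of_ne _ _ h, mul_zero, sub_zero]

lemma pairwise_inner_vGen (hg : 2 ≤ g) (hμ : S.IsPattersonSullivan μ) (n : ℕ) :
    Pairwise fun k l => inner ℂ (S.vGen μ n k) (S.vGen μ n l) = 0 :=
  fun _ _ h => S.inner_vGen_of_ne hg hμ n h

lemma norm_chi_powWord_pos (hg : 2 ≤ g) (hμ : S.IsPattersonSullivan μ) (n : ℕ) (k : Letter g) :
    0 < ‖S.chi μ (powWord n k)‖ := by
  have := hμ.finite
  have h := S.measureReal_powWord_pos hg hμ n k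
  rw [← norm_chi_sq] at h
  exact norm_pos_iff.mpr fun e => by rw [e] at h; simp at h

lemma vGen_ne_zero (hg : 2 ≤ g) (hμ : S.IsPattersonSullivan μ) (n : ℕ) (k : Letter g) :
    S.vGen μ n k ≠ 0 := by
  have := hμ.finite
  rcases n with _ | n
  · rw [vGen_zero]
    exact norm_pos_iff.mp (S.norm_chi_powWord_pos hg hμ 1 k)
  · intro h0
    rw [S.vGen_succ hg hμ] at h0
    -- The word k^{n+1}b is reduced and different from k^{n+2}. Its cylinder has positive mass and
    -- sees only the correction term of v_{n+1,k}, so the pairing with it is nonzero.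
    obtain ⟨b, hb1, hb2⟩ := exists_ne_ne hg k k.inv
    let w : Fin (n + 2) → Letter g := Fin.snoc (powWord (n + 1) k) b
    have hwpos : 0 < μ.real (S.cylinder w) := by
      refine S.measureReal_cylinder_pos hg hμ (a := fun j => if j < n + 1 then k else b) ?_ ?_
      · intro j
        by_cases h1 : j + 1 < n + 1
        · simp only [h1, if_true, show j < n + 1 by omega]
          exact (Letter.inv_ne k).symm
        · by_cases h2 : j < n + 1
          · simp only [h1, h2, if_true, if_false]
            exact hb2
          · simp only [h1, h2, if_false]
            exact (Letter.inv_ne b).symm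
      · intro j
        refine Fin.lastCases ?_ (fun j => ?_) j
        · simp [w]
        · simp only [w, powWord, Fin.snoc_castSucc, Fin.val_castSucc]
          exact if_pos j.2
    have hne : w ≠ powWord (n + 2) k := by
      intro e
      have := congrFun e (Fin.last (n + 1))
      simp only [w, Fin.snoc_last] at this
      exact hb1 this
    have h1 := congrArg (inner ℂ (S.chi μ w)) h0
    rw [inner_sub_right, inner_smul_right, S.inner_chi_of_ne hne, inner_chi_chi,
      Set.inter_eq_left.mpr (S.cylinder_snoc_subset _ _), inner_zero_right, zero_sub, neg_eq_zero,
      ← Complex.ofReal_mul, Complex.ofReal_eq_zero] at h1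
    have h2 := S.measureReal_powWord_pos hg hμ (n + 1) k
    have h3 := S.measureReal_powWord_pos hg hμ (n + 2) k
    exact absurd h1 (by positivity)

lemma gradedProj_vGen (hg : 2 ≤ g) (hμ : S.IsPattersonSullivan μ) (m n : ℕ) (k : Letter g) :
    S.gradedProj μ m (S.vGen μ n k) = if m = n then S.vGen μ n k else 0 := by
  have hE := S.isGrading_gradedProj hg hμ
  split_ifs with h
  · subst h
    exact hE.apply_apply_self m _
  · exact hE.apply_apply_of_ne h _

lemma weight_zero (hg : 2 ≤ g) (hμ : S.IsPattersonSullivan μ) (i : Letter g) :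
    S.weight μ 0 i = 1 := by
  have := hμ.finite
  have h := S.norm_chi_powWord_pos hg hμ 1 i
  rw [weight, vGen_zero]
  exact div_self (pow_pos h 2).ne'

lemma weight_pos (hg : 2 ≤ g) (hμ : S.IsPattersonSullivan μ) (n : ℕ) (i : Letter g) :
    0 < S.weight μ n i :=
  div_pos (pow_pos (norm_pos_iff.mpr (S.vGen_ne_zero hg hμ n i)) 2)
    (pow_pos (S.norm_chi_powWord_pos hg hμ _ i) 2)

lemma weight_le_one (hg : 2 ≤ g) (hμ : S.IsPattersonSullivan μ) (n : ℕ) (i : Letter g) :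
    S.weight μ n i ≤ 1 := by
  have := hμ.finite
  refine div_le_one_of_le₀ ?_ (by positivity)
  have := S.norm_gradedProj_le n ((S.isGrading_gradedProj hg hμ).mul_self n)
    (S.chi μ (powWord (n + 1) i))
  exact pow_le_pow_left₀ (norm_nonneg _) this 2

/-! ### Graded pieces of `𝓥` and of its invariants -/

lemma map_gradedProj_V (hg : 2 ≤ g) (hμ : S.IsPattersonSullivan μ) (n : ℕ) :
    (S.V μ).map (S.gradedProj μ n : L2 μ →ₗ[ℂ] L2 μ) =
      Submodule.span ℂ (Set.range (S.vGen μ n)) := by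
  rw [V, Submodule.map_span]
  refine le_antisymm (Submodule.span_le.mpr ?_) (Submodule.span_mono ?_)
  · rintro _ ⟨_, ⟨⟨m, k⟩, rfl⟩, rfl⟩
    change S.gradedProj μ n (S.vGen μ m k) ∈ _
    rw [S.gradedProj_vGen hg hμ]
    split_ifs with h
    · subst h
      exact Submodule.subset_span ⟨k, rfl⟩
    · exact zero_mem _
  · rintro _ ⟨k, rfl⟩
    refine ⟨_, ⟨(n, k), rfl⟩, ?_⟩
    change S.gradedProj μ n (S.vGen μ n k) = _
    rw [S.gradedProj_vGen hg hμ, if_pos rfl]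

lemma span_vGen_le_V (n : ℕ) : Submodule.span ℂ (Set.range (S.vGen μ n)) ≤ S.V μ := by
  refine Submodule.span_mono ?_
  rintro _ ⟨k, rfl⟩
  exact ⟨(n, k), rfl⟩

lemma map_gradedProj_V_le (hg : 2 ≤ g) (hμ : S.IsPattersonSullivan μ) (n : ℕ) :
    (S.V μ).map (S.gradedProj μ n : L2 μ →ₗ[ℂ] L2 μ) ≤ S.V μ := by
  rw [S.map_gradedProj_V hg hμ]
  exact S.span_vGen_le_V n

lemma linearIndependent_vGen (hg : 2 ≤ g) (hμ : S.IsPattersonSullivan μ) (n : ℕ) :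
    LinearIndependent ℂ (S.vGen μ n) :=
  linearIndependent_of_ne_zero_of_inner_eq_zero (S.vGen_ne_zero hg hμ n)
    (S.pairwise_inner_vGen hg hμ n)

lemma finrank_map_V (hg : 2 ≤ g) (hμ : S.IsPattersonSullivan μ) (n : ℕ) :
    Module.finrank ℂ ((S.V μ).map (S.gradedProj μ n : L2 μ →ₗ[ℂ] L2 μ)) = 2 * g := by
  rw [S.map_gradedProj_V hg hμ, finrank_span_eq_card (S.linearIndependent_vGen hg hμ n),
    Fintype.card_prod, Fintype.card_fin, Fintype.card_bool, mul_comm]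

/-- For a cylinder of measure zero the coefficient in `flip` is 0⁻¹ = 0, so the image must be shown
to vanish too. A nonempty inverted cylinder would make w reduced, hence of positive mass. -/
lemma chi_inv_eq_zero (hg : 2 ≤ g) (hμ : S.IsPattersonSullivan μ) {m : ℕ} {w : Fin m → Letter g}
    (h : S.chi μ w = 0) : S.chi μ (fun k => (w k).inv) = 0 := by
  have := hμ.finite
  have hempty : S.cylinder (fun k => (w k).inv) = ∅ := by
    rw [cylinder_eq, Set.image_eq_empty, Set.eq_empty_iff_forall_notMem]
    rintro a ⟨ha, haw⟩
    have hpos := S.measureReal_cylinder_pos hg hμ (w := w) (a := fun k => (a k).inv)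
      (fun k e => ha k (Letter.inv_injective e)) fun k => by rw [haw, Letter.inv_inv]
    rw [← norm_chi_sq, h] at hpos
    simp at hpos
  rw [← norm_eq_zero, ← pow_eq_zero_iff two_ne_zero, norm_chi_sq, hempty]
  simp

/-- Inversion of letters, as a permutation. -/
def invEquiv (g : ℕ) : Letter g ≃ Letter g :=
  ⟨Letter.inv, Letter.inv, Letter.inv_inv, Letter.inv_inv⟩

/-- The change of orientation on characteristic functions of cylinders. -/
lemma flip_chi (hg : 2 ≤ g) (hμ : S.IsPattersonSullivan μ) {n : ℕ} (w : Fin (n + 1) → Letter g) :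
    S.flip μ n (S.chi μ w) = S.chi μ fun k => (w k).inv := by
  have := hμ.finite
  rw [flip, sum_apply, Finset.sum_eq_single w]
  · simp only [ContinuousLinearMap.smulRight_apply, smul_apply, innerSL_apply_apply]
    by_cases h : S.chi μ w = 0
    · rw [S.chi_inv_eq_zero hg hμ h, smul_zero]
    · have hn : ‖S.chi μ w‖ ^ 2 ≠ 0 := pow_ne_zero 2 (norm_ne_zero_iff.mpr h)
      have hnc : ((‖S.chi μ w‖ ^ 2 : ℝ) : ℂ) ≠ 0 := by exact_mod_cast hn
      have : inner ℂ (S.chi μ w) (S.chi μ w) = ((‖S.chi μ w‖ ^ 2 : ℝ) : ℂ) := by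
        rw [inner_self_eq_norm_sq_to_K]; simp
      rw [this, smul_eq_mul, Complex.ofReal_inv, inv_mul_cancel₀ hnc, one_smul]
  · intro v _ hv
    simp only [ContinuousLinearMap.smulRight_apply, smul_apply, innerSL_apply_apply]
    rw [S.inner_chi_of_ne hv, smul_zero, zero_smul]
  · simp

/-- Inverting letters permutes the one-letter extensions, so the change of orientation is compatible
with 𝓟_n ⊆ 𝓟_{n+1} and descends to the quotient. -/
lemma flip_succ_chi (hg : 2 ≤ g) (hμ : S.IsPattersonSullivan μ) {n : ℕ}
    (w : Fin (n + 1) → Letter g) :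
    S.flip μ (n + 1) (S.chi μ w) = S.chi μ fun k => (w k).inv := by
  have := hμ.finite
  rw [chi_eq_sum, map_sum, chi_eq_sum]
  simp only [S.flip_chi hg hμ]
  refine (Finset.sum_congr rfl fun b _ => ?_).trans (Equiv.sum_comp (invEquiv g) fun b =>
    S.chi μ (Fin.snoc (fun k => (w k).inv) b : Fin (n + 1 + 1) → Letter g))
  congr 1
  ext1 j
  refine Fin.lastCases ?_ (fun j => ?_) j
  · simp [invEquiv]
  · simp

/-- The correction term of v_{n,k} is flipped within the lower level, where Π̂_n vanishes, so only
the leading characteristic function matters. -/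
lemma frobenius_vGen (hg : 2 ≤ g) (hμ : S.IsPattersonSullivan μ) (n : ℕ) (k : Letter g) :
    S.frobenius μ n (S.vGen μ n k) = (-1 : ℂ) ^ n • S.vGen μ n k.inv := by
  have := hμ.finite
  rw [frobenius, smul_apply, ContinuousLinearMap.comp_apply, ContinuousLinearMap.comp_apply,
    S.gradedProj_vGen hg hμ, if_pos rfl]
  congr 1
  rcases n with _ | n
  · rw [vGen_zero, S.flip_chi hg hμ]
    rfl
  · have h0 : S.gradedProj μ (n + 1) (S.chi μ fun j => (powWord (n + 1) k j).inv) = 0 :=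
      S.gradedProj_of_mem_of_lt (Nat.lt_succ_self n) (S.chi_mem_P _)
    rw [S.vGen_succ hg hμ, map_sub, map_smul, S.flip_chi hg hμ, S.flip_succ_chi hg hμ, map_sub,
      map_smul, h0, smul_zero, sub_zero]
    rfl

lemma frobenius_gradedProj (hg : 2 ≤ g) (hμ : S.IsPattersonSullivan μ) (m n : ℕ) (v : L2 μ) :
    S.frobenius μ m (S.gradedProj μ n v) = if m = n then S.frobenius μ m v else 0 := by
  have hE := S.isGrading_gradedProj hg hμ
  rw [frobenius, smul_apply, smul_apply, ContinuousLinearMap.comp_apply,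
    ContinuousLinearMap.comp_apply, ContinuousLinearMap.comp_apply, ContinuousLinearMap.comp_apply]
  split_ifs with h
  · subst h
    rw [hE.apply_apply_self]
  · rw [hE.apply_apply_of_ne h, map_zero, map_zero, smul_zero]

lemma map_gradedProj_VInv_le (hg : 2 ≤ g) (hμ : S.IsPattersonSullivan μ) (n : ℕ) :
    (S.VInv μ).map (S.gradedProj μ n : L2 μ →ₗ[ℂ] L2 μ) ≤ S.VInv μ := by
  have hE := S.isGrading_gradedProj hg hμ
  rintro _ ⟨v, ⟨hv, hf⟩, rfl⟩
  refine ⟨S.map_gradedProj_V_le hg hμ n ⟨v, hv, rfl⟩, fun m => ?_⟩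
  change S.frobenius μ m (S.gradedProj μ n v) = S.gradedProj μ m (S.gradedProj μ n v)
  rw [S.frobenius_gradedProj hg hμ]
  split_ifs with h
  · subst h
    rw [hf, hE.apply_apply_self]
  · rw [hE.apply_apply_of_ne h]

/-- The invariants of the real Frobenius in the `n`-th graded piece of `𝓥`. -/
def vInvGen (μ : Measure ℂ) (n : ℕ) (i : Fin g) : L2 μ :=
  S.vGen μ n (i, true) + (-1 : ℂ) ^ n • S.vGen μ n (i, false)

/-- In the basis v_{n,k} invariance reads c(k) = (-1)^n c(k⁻¹), leaving one free coefficient for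
each pair of mutually inverse letters. -/
lemma map_gradedProj_VInv (hg : 2 ≤ g) (hμ : S.IsPattersonSullivan μ) (n : ℕ) :
    (S.VInv μ).map (S.gradedProj μ n : L2 μ →ₗ[ℂ] L2 μ) =
      Submodule.span ℂ (Set.range (S.vInvGen μ n)) := by
  have hE := S.isGrading_gradedProj hg hμ
  have hsq : (-1 : ℂ) ^ n * (-1 : ℂ) ^ n = 1 := by
    rw [← mul_pow]; simp
  refine le_antisymm ?_ (Submodule.span_le.mpr ?_)
  · rintro _ ⟨v, hv, rfl⟩
    have h1 := S.map_gradedProj_VInv_le hg hμ n ⟨v, hv, rfl⟩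
    have h2 : S.gradedProj μ n v ∈ Submodule.span ℂ (Set.range (S.vGen μ n)) := by
      rw [← S.map_gradedProj_V hg hμ]
      exact ⟨v, hv.1, rfl⟩
    obtain ⟨c, hc⟩ := (Submodule.mem_span_range_iff_exists_fun ℂ).mp h2
    have h3 : S.frobenius μ n (S.gradedProj μ n v) = S.gradedProj μ n v := by
      rw [S.frobenius_gradedProj hg hμ, if_pos rfl, hv.2]
    change S.gradedProj μ n v ∈ _
    have h4 : ∑ k : Letter g, ((-1 : ℂ) ^ n * c k.inv - c k) • S.vGen μ n k = 0 := by
      have h5 : ∑ k : Letter g, ((-1 : ℂ) ^ n * c k.inv) • S.vGen μ n k = S.gradedProj μ n v := by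
        rw [← h3, ← hc, map_sum]
        refine (Equiv.sum_comp (invEquiv g) fun k =>
          ((-1 : ℂ) ^ n * c k.inv) • S.vGen μ n k).symm.trans (Finset.sum_congr rfl fun k _ => ?_)
        rw [map_smul, S.frobenius_vGen hg hμ, smul_smul, mul_comm]
        simp [invEquiv, Letter.inv_inv]
      simp only [sub_smul, Finset.sum_sub_distrib, h5, hc, sub_self]
    have h6 := Fintype.linearIndependent_iff.mp (S.linearIndependent_vGen hg hμ n) _ h4
    rw [← hc, Fintype.sum_prod_type]
    refine Submodule.sum_mem _ fun i _ => ?_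
    have h7 : c (i, false) = (-1 : ℂ) ^ n * c (i, true) :=
      (sub_eq_zero.mp (h6 (i, false))).symm
    rw [Fintype.sum_bool, h7, mul_comm, mul_smul, ← smul_add]
    exact Submodule.smul_mem _ _ (Submodule.subset_span ⟨i, rfl⟩)
  · rintro _ ⟨i, rfl⟩
    have hfix : S.gradedProj μ n (S.vInvGen μ n i) = S.vInvGen μ n i := by
      rw [vInvGen, map_add, map_smul, S.gradedProj_vGen hg hμ, S.gradedProj_vGen hg hμ, if_pos rfl,
        if_pos rfl]
    refine ⟨S.vInvGen μ n i, ⟨?_, fun m => ?_⟩, hfix⟩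
    · exact add_mem (Submodule.subset_span ⟨(n, (i, true)), rfl⟩)
        (Submodule.smul_mem _ _ (Submodule.subset_span ⟨(n, (i, false)), rfl⟩))
    · rw [← hfix, S.frobenius_gradedProj hg hμ]
      split_ifs with h
      · subst h
        rw [hfix, hfix, vInvGen, map_add, map_smul, S.frobenius_vGen hg hμ, S.frobenius_vGen hg hμ,
          smul_smul, hsq, one_smul]
        exact add_comm _ _
      · rw [hE.apply_apply_of_ne h]

lemma finrank_map_VInv (hg : 2 ≤ g) (hμ : S.IsPattersonSullivan μ) (n : ℕ) :
    Module.finrank ℂ ((S.VInv μ).map (S.gradedProj μ n : L2 μ →ₗ[ℂ] L2 μ)) = g := by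
  have hind : LinearIndependent ℂ (S.vInvGen μ n) := by
    rw [Fintype.linearIndependent_iff]
    intro c hc i
    -- The relation is expanded in the independent vectors v_{n,k}; the coefficient at (i, true) is
    -- c i.
    have h : ∑ k : Letter g, (if k.2 then c k.1 else c k.1 * (-1 : ℂ) ^ n) • S.vGen μ n k = 0 := by
      rw [Fintype.sum_prod_type, ← hc]
      refine Finset.sum_congr rfl fun i _ => ?_
      rw [Fintype.sum_bool, vInvGen, smul_add, smul_smul]
      simp
    exact Fintype.linearIndependent_iff.mp (S.linearIndependent_vGen hg hμ n) _ h (i, true)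
  rw [S.map_gradedProj_VInv hg hμ, finrank_span_eq_card hind, Fintype.card_fin]

/-! ### Compressions -/

lemma spectralProj_dirac_neg (hg : 2 ≤ g) (hμ : S.IsPattersonSullivan μ) (n : ℕ) :
    spectralProj (S.dirac μ) (-n) = sndOp (S.gradedProj μ n) := by
  have := (S.isGrading_gradedProj hg hμ).spectralProj_neg one_ne_zero n
  rwa [one_smul, mul_one] at this

lemma compress_eq (hg : 2 ≤ g) (hμ : S.IsPattersonSullivan μ) (n : ℕ) (T : L2 μ →L[ℂ] L2 μ) :
    S.compress μ n T = sndOp (S.gradedProj μ n * T * S.gradedProj μ n) := by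
  rw [compress, S.spectralProj_dirac_neg hg hμ]
  rfl

/-- On functions of level `n`, `Q_{i,n+1}` is the projection on the line of a characteristic
function. -/
lemma Q_apply_of_mem (hg : 2 ≤ g) (hμ : S.IsPattersonSullivan μ) (i : Letter g) (n : ℕ) {f : L2 μ}
    (hf : f ∈ S.P μ n) :
    S.Q μ i (n + 1) f = (Submodule.span ℂ {S.chi μ (powWord (n + 1) i)}).starProjection f := by
  have := hμ.finite
  have hle : S.P μ n ≤ LinearMap.eqLocus (S.Q μ i (n + 1) : L2 μ →ₗ[ℂ] L2 μ)
      ((Submodule.span ℂ {S.chi μ (powWord (n + 1) i)}).starProjection : L2 μ →ₗ[ℂ] L2 μ) := by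
    refine Submodule.span_le.mpr ?_
    rintro _ ⟨w, rfl⟩
    change S.Q μ i (n + 1) (S.chi μ w) =
      (Submodule.span ℂ {S.chi μ (powWord (n + 1) i)}).starProjection (S.chi μ w)
    by_cases hw : w = powWord (n + 1) i
    · subst hw
      rw [starProjection_singleton_self]
      refine Lp.ext ?_
      filter_upwards [S.Q_apply hg hμ i (n + 1) (S.chi μ (powWord (n + 1) i)),
        S.coeFn_chi (μ := μ) (powWord (n + 1) i)] with x h1 h2
      rw [h1]
      by_cases hx : x ∈ S.cylinder (powWord (n + 1) i)
      · rw [Set.indicator_of_mem hx]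
      · rw [Set.indicator_of_notMem hx, h2, Set.indicator_of_notMem hx]
    · rw [starProjection_singleton_of_inner_eq_zero (S.inner_chi_of_ne (Ne.symm hw))]
      rw [Lp.eq_zero_iff_ae_eq_zero]
      filter_upwards [S.Q_apply hg hμ i (n + 1) (S.chi μ w), S.coeFn_chi (μ := μ) w] with x h1 h2
      rw [h1]
      by_cases hx : x ∈ S.cylinder (powWord (n + 1) i)
      · rw [Set.indicator_of_mem hx, h2, Set.indicator_of_notMem
          (Set.disjoint_right.mp (S.cylinder_disjoint hw) hx)]
        rfl
      · rw [Set.indicator_of_notMem hx]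
        rfl
  exact hle hf

/-- On 𝓟_n the operator Q is x ↦ ⟨χ, x⟩χ/‖χ‖². Moving the self-adjoint Π̂_n onto both copies of χ
turns them into v = Π̂_n χ while the denominator stays ‖χ‖², which yields the weight ‖v‖²/‖χ‖². -/
lemma gradedProj_mul_Q_mul (hg : 2 ≤ g) (hμ : S.IsPattersonSullivan μ) (n : ℕ) (i : Letter g) :
    S.gradedProj μ n * S.Q μ i (n + 1) * S.gradedProj μ n =
      (S.weight μ n i : ℂ) • (Submodule.span ℂ {S.vGen μ n i}).starProjection := by
  have := hμ.finite
  ext1 x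
  rw [mul_apply_eq_comp, mul_apply_eq_comp, S.Q_apply_of_mem hg hμ i n (S.gradedProj_mem n x),
    smul_apply, Submodule.starProjection_singleton, Submodule.starProjection_singleton, map_smul,
    ← S.gradedProj_inner, smul_smul]
  have h1 : ((‖S.vGen μ n i‖ ^ 2 : ℝ) : ℂ) ≠ 0 := by
    exact_mod_cast pow_ne_zero 2 (norm_ne_zero_iff.mpr (S.vGen_ne_zero hg hμ n i))
  change (inner ℂ (S.vGen μ n i) x / _) • S.vGen μ n i = _
  congr 1
  rw [weight, Complex.ofReal_div]
  change _ / ((‖S.chi μ (powWord (n + 1) i)‖ ^ 2 : ℝ) : ℂ) =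
    _ * (_ / ((‖S.vGen μ n i‖ ^ 2 : ℝ) : ℂ))
  field_simp

lemma inr_span_singleton (x : L2 μ) :
    Submodule.span ℂ {inr μ x} = (Submodule.span ℂ {x}).map (inrMap (L2 μ)) := by
  rw [Submodule.map_span, Set.image_singleton]
  rfl

lemma compress_Q (hg : 2 ≤ g) (hμ : S.IsPattersonSullivan μ) (n : ℕ) (i : Letter g) :
    S.compress μ n (S.Q μ i (n + 1)) = (S.weight μ n i : ℂ) •
      (Submodule.span ℂ {inr μ (S.vGen μ n i)}).starProjection := by
  rw [S.compress_eq hg hμ, S.gradedProj_mul_Q_mul hg hμ, sndOp_smul, sndOp_starProjection]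
  simp only [inr_span_singleton]

lemma finiteDimensional_map_V (hg : 2 ≤ g) (hμ : S.IsPattersonSullivan μ) (n : ℕ) :
    FiniteDimensional ℂ ((S.V μ).map (S.gradedProj μ n : L2 μ →ₗ[ℂ] L2 μ)) := by
  rw [S.map_gradedProj_V hg hμ]
  exact FiniteDimensional.span_of_finite ℂ (Set.finite_range _)

/-- `π(𝓥) Π(-n, D)` is the normalised compression of the projections `Q_{i,n+1}`. -/
theorem projV_mul_spectralProj (hg : 2 ≤ g) (hμ : S.IsPattersonSullivan μ) (n : ℕ) :
    S.projV μ * spectralProj (S.dirac μ) (-n) =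
      S.compress μ n (∑ i, ((S.weight μ n i : ℂ)⁻¹) • S.Q μ i (n + 1)) := by
  have hE := S.isGrading_gradedProj hg hμ
  have := S.finiteDimensional_map_V hg hμ n
  have h1 : S.projV μ = sndOp (S.V μ).topologicalClosure.starProjection :=
    sndOp_closure_starProjection (S.V μ)
  rw [h1, S.spectralProj_dirac_neg hg hμ, S.compress_eq hg hμ, sndOp_mul,
    hE.closure_starProjection_mul n (S.map_gradedProj_V_le hg hμ n),
    starProjection_span_range (S.pairwise_inner_vGen hg hμ n) _ (S.map_gradedProj_V hg hμ n),
    Finset.mul_sum, Finset.sum_mul]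
  congr 1
  refine Finset.sum_congr rfl fun i _ => ?_
  have hw : (S.weight μ n i : ℂ) ≠ 0 := Complex.ofReal_ne_zero.mpr (S.weight_pos hg hμ n i).ne'
  rw [mul_smul_comm, smul_mul_assoc, S.gradedProj_mul_Q_mul hg hμ, smul_smul, inv_mul_cancel₀ hw,
    one_smul]

lemma range_compress_sum_Q (hg : 2 ≤ g) (hμ : S.IsPattersonSullivan μ) (n : ℕ) :
    LinearMap.range ((S.compress μ n (∑ i, S.Q μ i (n + 1)) : HSpace μ →L[ℂ] HSpace μ) :
      HSpace μ →ₗ[ℂ] HSpace μ) = (S.grV μ n).map (inr μ) := by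
  have hw : ∀ i, (S.weight μ n i : ℂ) ≠ 0 := fun i =>
    Complex.ofReal_ne_zero.mpr (S.weight_pos hg hμ n i).ne'
  rw [S.compress_eq hg hμ, Finset.mul_sum, Finset.sum_mul]
  simp only [S.gradedProj_mul_Q_mul hg hμ]
  rw [range_sndOp, range_sum_smul_starProjection (S.pairwise_inner_vGen hg hμ n) hw, grV,
    S.map_gradedProj_V hg hμ]
  rfl

lemma projV_mul_spectralProj_eq_zero (hg : 2 ≤ g) (hμ : S.IsPattersonSullivan μ) {c : ℂ}
    (hc : ∀ n : ℕ, c ≠ -n) : S.projV μ * spectralProj (S.dirac μ) c = 0 := by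
  have h1 : S.projV μ = sndOp (S.V μ).topologicalClosure.starProjection :=
    sndOp_closure_starProjection (S.V μ)
  have h2 := (S.isGrading_gradedProj hg hμ).sndOp_mul_spectralProj (τ := 1) (c := c)
    (by simpa using hc) (S.V μ).topologicalClosure.starProjection
  rw [one_smul] at h2
  rw [h1]
  exact h2

/-! ### The local factors -/

/-- Complex conjugation is an additive bijection that is semilinear over an automorphism of ℂ, and
such maps preserve rank. -/
lemma finrank_conjDifferentials : Module.finrank ℂ S.conjDifferentials = S.genus := by
  let e : S.conjDifferentials ≃+ S.differentials :=
    { toFun := fun v => ⟨fun z => (starRingEnd ℂ) (v.1 z), v.2⟩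
      invFun := fun f => ⟨fun z => (starRingEnd ℂ) (f.1 z), by
        change (fun z => (starRingEnd ℂ) ((starRingEnd ℂ) (f.1 z))) ∈ S.differentials
        simp only [Complex.conj_conj]
        exact f.2⟩
      left_inv := fun v => by ext z; simp
      right_inv := fun f => by ext z; simp
      map_add' := fun u v => by ext z; simp }
  refine congrArg Cardinal.toNat (rank_eq_of_equiv_equiv (starRingEnd ℂ) e
    (Function.Involutive.bijective Complex.conj_conj) fun c v => ?_)
  ext z
  simp [e]

lemma hodgeNumber_one_zero : S.hodgeNumber 1 0 = S.genus := by
  have h : S.hodgePiece 1 0 = S.differentials.map (LinearMap.inl ℂ (ℂ → ℂ) (ℂ → ℂ)) := by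
    rw [hodgePiece, if_pos ⟨rfl, rfl⟩, Submodule.map_inl]
  rw [hodgeNumber, h, genus]
  exact ((Submodule.equivMapOfInjective _ LinearMap.inl_injective _).finrank_eq).symm

lemma hodgeNumber_zero_one : S.hodgeNumber 0 1 = S.genus := by
  have h : S.hodgePiece 0 1 = S.conjDifferentials.map (LinearMap.inr ℂ (ℂ → ℂ) (ℂ → ℂ)) := by
    rw [hodgePiece, if_neg (by simp), if_pos ⟨rfl, rfl⟩, Submodule.map_inr]
  rw [hodgeNumber, h, ← S.finrank_conjDifferentials]
  exact ((Submodule.equivMapOfInjective _ LinearMap.inr_injective _).finrank_eq).symm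

lemma hodgePiece_eq_bot {p q : ℤ} (h1 : ¬(p = 1 ∧ q = 0)) (h2 : ¬(p = 0 ∧ q = 1)) :
    S.hodgePiece p q = ⊥ := by
  rw [hodgePiece, if_neg h1, if_neg h2]

lemma hodgeNumber_eq_zero {p q : ℤ} (h1 : ¬(p = 1 ∧ q = 0)) (h2 : ¬(p = 0 ∧ q = 1)) :
    S.hodgeNumber p q = 0 := by
  rw [hodgeNumber, S.hodgePiece_eq_bot h1 h2, finrank_bot]

lemma hodgeNumberSign_eq_zero (p : ℤ) (ε : ℂ) : S.hodgeNumberSign p ε = 0 := by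
  rw [hodgeNumberSign, S.hodgePiece_eq_bot (by omega) (by omega), bot_inf_eq, finrank_bot]

/-- Only (1,0) and (0,1) contribute, both with min(p,q) = 0. -/
theorem LC_eq (s : ℂ) : S.LC s = gammaC s ^ (2 * S.genus) := by
  have hsub : (Function.mulSupport fun pq : ℤ × ℤ =>
      gammaC (s - (min pq.1 pq.2 : ℤ)) ^ S.hodgeNumber pq.1 pq.2) ⊆
      (({(1, 0), (0, 1)} : Finset (ℤ × ℤ)) : Set (ℤ × ℤ)) := by
    rintro ⟨p, q⟩ h
    by_contra hn
    simp only [Finset.coe_insert, Finset.coe_singleton, Set.mem_insert_iff,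
      Set.mem_singleton_iff, Prod.mk.injEq, not_or] at hn
    refine h ?_
    change gammaC _ ^ S.hodgeNumber p q = 1
    rw [S.hodgeNumber_eq_zero hn.1 hn.2, pow_zero]
  rw [LC, finprod_eq_prod_of_mulSupport_subset _ hsub, Finset.prod_pair (by simp)]
  simp [hodgeNumber_one_zero, hodgeNumber_zero_one, two_mul, pow_add]

/-- Weight one has no (p,p) part, so the Γ_ℝ factors are trivial, and (0,1) is the only contributing
pair with p < q. -/
theorem LR_eq (s : ℂ) : S.LR s = gammaC s ^ S.genus := by
  have h1 : (∏ᶠ pq : {pq : ℤ × ℤ // pq.1 < pq.2},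
      gammaC (s - (pq.1.1 : ℤ)) ^ S.hodgeNumber pq.1.1 pq.1.2) = gammaC s ^ S.genus := by
    rw [finprod_eq_single _ ⟨(0, 1), zero_lt_one⟩]
    · simp [hodgeNumber_zero_one]
    · rintro ⟨⟨p, q⟩, hlt⟩ hne
      have hlt' : p < q := hlt
      have h2 : ¬(p = 0 ∧ q = 1) := fun h => hne (by simp [h.1, h.2])
      change gammaC _ ^ S.hodgeNumber p q = 1
      rw [S.hodgeNumber_eq_zero (by omega) h2, pow_zero]
  rw [LR, h1]
  simp [hodgeNumberSign_eq_zero]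

end SchottkyGroup
end ArchFactor

end

theorem proposition6p8 {g : ℕ} (hg : 2 ≤ g) (S : ArchFactor.SchottkyGroup g)
    (hF : S.IsFuchsian) (hX : S.genus = g)
    (μ : Measure ℂ) (hμ : S.IsPattersonSullivan μ) :
    -- the regularized determinants recover the local factors
    (∀ s : ℂ, (∀ n : ℕ, s ≠ -n) →
      (∃ d : ℂ, ArchFactor.IsRegularizedDet (S.projV μ)
          (((2 * Real.pi : ℂ)⁻¹) • S.dirac μ) (s / (2 * Real.pi)) d ∧
        d⁻¹ = S.LC s) ∧
      (∃ d : ℂ, ArchFactor.IsRegularizedDet (S.projVInv μ)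
          (((2 * Real.pi : ℂ)⁻¹) • S.dirac μ) (s / (2 * Real.pi)) d ∧
        d⁻¹ = S.LR s) ∧
      S.LC s = ArchFactor.gammaC s ^ (2 * g) ∧ S.LR s = ArchFactor.gammaC s ^ g) ∧
    -- the operators `Q_{i,n} = S_i^n S_i^{*n}` are projections in the AF core of `𝓞_A`
    (∀ i, S.IsCuntzKriegerGen μ i (S.ckGen μ i)) ∧
    S.afCore μ ≤ S.ckAlgebra μ ∧
    (∀ i n, IsStarProjection (S.Q μ i n) ∧ S.Q μ i n ∈ S.afCore μ ∧
      ∀ f : ArchFactor.SchottkyGroup.L2 μ, (S.Q μ i n f : ℂ → ℂ) =ᵐ[μ]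
        (S.cylinder (ArchFactor.SchottkyGroup.powWord n i)).indicator f) ∧
    -- their normalised compressions by the spectral projections of `D` give `π(𝓥)`
    (∀ i, S.weight μ 0 i = 1) ∧
    (∀ n i, 0 < S.weight μ n i ∧ S.weight μ n i ≤ 1 ∧
      S.compress μ n (S.Q μ i (n + 1)) = (S.weight μ n i : ℂ) •
        (Submodule.span ℂ {ArchFactor.SchottkyGroup.inr μ (S.vGen μ n i)}).starProjection) ∧
    (∀ n : ℕ, S.projV μ * ArchFactor.spectralProj (S.dirac μ) (-n) =
      S.compress μ n (∑ i, ((S.weight μ n i : ℂ)⁻¹) • S.Q μ i (n + 1))) ∧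
    (∀ n : ℕ, LinearMap.range ((S.compress μ n (∑ i, S.Q μ i (n + 1)) :
        ArchFactor.SchottkyGroup.HSpace μ →L[ℂ] ArchFactor.SchottkyGroup.HSpace μ) :
        ArchFactor.SchottkyGroup.HSpace μ →ₗ[ℂ] ArchFactor.SchottkyGroup.HSpace μ) =
      (S.grV μ n).map (ArchFactor.SchottkyGroup.inr μ)) ∧
    (∀ c : ℂ, (∀ n : ℕ, c ≠ -n) →
      S.projV μ * ArchFactor.spectralProj (S.dirac μ) c = 0) := by
  refine ⟨fun s hs => ⟨?_, ?_, ?_, ?_⟩, fun i => S.isCuntzKriegerGen_ckGen hg hμ i,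
    S.afCore_le_ckAlgebra,
    fun i n => ⟨S.isStarProjection_Q hg hμ i n, S.Q_mem_afCore i n, S.Q_apply hg hμ i n⟩,
    S.weight_zero hg hμ, fun n i => ⟨S.weight_pos hg hμ n i, S.weight_le_one hg hμ n i,
      S.compress_Q hg hμ n i⟩, S.projV_mul_spectralProj hg hμ, S.range_compress_sum_Q hg hμ,
    fun c hc => S.projV_mul_spectralProj_eq_zero hg hμ hc⟩
  · rw [S.LC_eq, hX]
    -- The rank 2g of each graded piece of 𝓥 matches h^{1,0} + h^{0,1}; for the invariants below,
    -- the rank g matches h^{0,1}.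
    exact (S.isGrading_gradedProj hg hμ).exists_isRegularizedDet (S.map_gradedProj_V_le hg hμ)
      (by omega) (S.finrank_map_V hg hμ) hs
  · rw [S.LR_eq, hX]
    exact (S.isGrading_gradedProj hg hμ).exists_isRegularizedDet (S.map_gradedProj_VInv_le hg hμ)
      (by omega) (S.finrank_map_VInv hg hμ) hs
  · rw [S.LC_eq, hX]
  · rw [S.LR_eq, hX]
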